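/- Let $D\subset\mathbb{R}^3$ be a bounded connected open set with $C^1$ boundary. For $\omega\in\mathbb{C}$ let $$\mathcal{K}_D^{\omega}[f](x)=\int_D\frac{e^{i\omega|x-y|}}{4\pi|x-y|}f(y)\,dy,\qquad \mathcal{K}_D:=\mathcal{K}_D^{0},\qquad N(u)=u+|u|^2u .$$ Let $\lambda_j>0$ be a simple eigenvalue of the Newtonian potential $\mathcal{K}_D$ on $L^2(D)=L^2(D;\mathbb{C})$, with real-valued eigenfunction $\varphi_j$, $\|\varphi_j\|_{L^2(D)}=1$, and put $\hat\omega_j:=\lambda_j^{-1/2}$. For $\delta>0$ let $U_\delta=\{(a,\epsilon)\in\mathbb{R}\times(0,\infty):|a|+\epsilon<\delta\}$. A *resonance branch* on $U_\delta$ consists of $C^1$ maps $\hat\omega:U_\delta\to\mathbb{C}$ and $h:U_\delta\to H^2(D)$ such that, for all $(a,\epsilon)\in U_\delta$, $\langle\varphi_j,h(a,\epsilon)\rangle_{L^2(D)}=0$ and $u(a,\epsilon):=a\varphi_j+h(a,\epsilon)\in H^2(D)$ solves the scaled nonlinear Lippmann–Schwinger equation $$u(a,\epsilon)=\hat\omega(a,\epsilon)^2\,\mathcal{K}_D^{\epsilon\hat\omega(a,\epsilon)}\big[N(u(a,\epsilon))\big]\quad\text{on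 }D,$$ and such that $\hat\omega(a,\epsilon)\to\hat\omega_j$ and $h(a,\epsilon)\to0$ in $H^2(D)$ as $(a,\epsilon)\to(0,0)$ in $U_\delta$. Then a resonance branch exists on $U_\delta$ for some $\delta>0$. Moreover $\varphi_j\in H^2(D)$, and every resonance branch (on any $U_\delta$, $\delta>0$) satisfies, as $(a,\epsilon)\to(0,0)$ in $U_\delta$, $$\hat\omega(a,\epsilon)=\hat\omega_j-\frac{i\,\hat\omega_j^4}{8\pi}\Big(\int_D\varphi_j\,dx\Big)^2\epsilon+\mathcal{O}(a^2+\epsilon^2)$$ and, in $H^2(D)$, $$u(a,\epsilon)=a\varphi_j+\mathcal{O}(a^2+\epsilon^2).$$ -/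

import Mathlib

open MeasureTheory Filter Topology Asymptotics

noncomputable section

namespace DielectricResonance

/-- Three-dimensional Euclidean space. -/
abbrev E3 : Type := EuclideanSpace ℝ (Fin 3)

/-- The coordinate vectors of `E3`. -/
abbrev e3 (i : Fin 3) : E3 := EuclideanSpace.single i (1 : ℝ)

/-- The boundary of `D` is of class `C^k`: near each boundary point, `D` is the sublevel set
`{ρ < 0}` of a `C^k` function `ρ` with non-vanishing differential at that point. -/
def HasBoundaryOfClass (k : WithTop ℕ∞) (D : Set E3) : Prop :=
  ∀ x ∈ frontier D, ∃ (V : Set E3) (ρ : E3 → ℝ), IsOpen V ∧ x ∈ V ∧ ContDiffOn ℝ k ρ V ∧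
    fderiv ℝ ρ x ≠ 0 ∧ ∀ y ∈ V, (y ∈ D ↔ ρ y < 0)

/-- The space `L²(D)` of complex-valued functions; `inner ℂ f g` is `∫_D conj f * g`. -/
abbrev L2 (D : Set E3) : Type := Lp ℂ 2 (volume.restrict D)

/-- `ψ` is a (real-valued) test function on `D`: smooth with compact support contained in `D`. -/
structure IsTest (D : Set E3) (ψ : E3 → ℝ) : Prop where
  contDiff : ContDiff ℝ ((⊤ : ℕ∞) : WithTop ℕ∞) ψ
  hasCompactSupport : HasCompactSupport ψ
  tsupport_subset : tsupport ψ ⊆ D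

/-- `g ∈ L²(D)` is the weak partial derivative `∂ᵢ f` of `f ∈ L²(D)` on `D`. -/
def IsWeakDeriv (D : Set E3) (i : Fin 3) (f g : L2 D) : Prop :=
  ∀ ψ : E3 → ℝ, IsTest D ψ →
    ∫ x in D, f x * ((fderiv ℝ ψ x (e3 i) : ℝ) : ℂ) = -∫ x in D, g x * ((ψ x : ℝ) : ℂ)

theorem IsTest.memLp {D : Set E3} {ψ : E3 → ℝ} (hψ : IsTest D ψ) :
    MemLp (fun x => ((ψ x : ℝ) : ℂ)) 2 (volume.restrict D) :=
  ((Complex.continuous_ofReal.comp hψ.contDiff.continuous).memLp_of_hasCompactSupport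
    (hψ.hasCompactSupport.comp_left (g := fun t : ℝ => (t : ℂ)) (by simp)))

theorem IsTest.memLp_fderiv {D : Set E3} {ψ : E3 → ℝ} (hψ : IsTest D ψ) (v : E3) :
    MemLp (fun x => ((fderiv ℝ ψ x v : ℝ) : ℂ)) 2 (volume.restrict D) := by
  have hc : Continuous (fun x => fderiv ℝ ψ x v) :=
    (hψ.contDiff.continuous_fderiv (by simp)).clm_apply continuous_const
  have hs : HasCompactSupport (fun x => fderiv ℝ ψ x v) :=
    (hψ.hasCompactSupport.fderiv ℝ).comp_left (g := fun L : E3 →L[ℝ] ℝ => L v) (by simp)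
  exact (Complex.continuous_ofReal.comp hc).memLp_of_hasCompactSupport
    (hs.comp_left (g := fun t : ℝ => (t : ℂ)) (by simp))

theorem IsWeakDeriv.zero (D : Set E3) (i : Fin 3) : IsWeakDeriv D i 0 0 := by
  intro ψ _
  have h0 : (⇑(0 : L2 D) : E3 → ℂ) =ᵐ[volume.restrict D] fun _ => 0 := Lp.coeFn_zero ..
  have h1 : ∫ x in D, (0 : L2 D) x * ((fderiv ℝ ψ x (e3 i) : ℝ) : ℂ) = 0 :=
    integral_eq_zero_of_ae (h0.mono fun x hx => by simp only [hx, zero_mul, Pi.zero_apply])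
  have h2 : ∫ x in D, (0 : L2 D) x * ((ψ x : ℝ) : ℂ) = 0 :=
    integral_eq_zero_of_ae (h0.mono fun x hx => by simp only [hx, zero_mul, Pi.zero_apply])
  rw [h1, h2, neg_zero]

theorem integral_add_mul {D : Set E3} (f g : L2 D) {k : E3 → ℂ}
    (hk : MemLp k 2 (volume.restrict D)) :
    ∫ x in D, (f + g) x * k x = (∫ x in D, f x * k x) + ∫ x in D, g x * k x := by
  have hf : Integrable (fun x => f x * k x) (volume.restrict D) := (Lp.memLp f).integrable_mul hk
  have hg : Integrable (fun x => g x * k x) (volume.restrict D) := (Lp.memLp g).integrable_mul hk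
  rw [← integral_add hf hg]
  refine integral_congr_ae ((Lp.coeFn_add f g).mono fun x hx => ?_)
  simp only [hx, Pi.add_apply, add_mul]

theorem integral_smul_mul {D : Set E3} (c : ℂ) (f : L2 D) (k : E3 → ℂ) :
    ∫ x in D, (c • f) x * k x = c * ∫ x in D, f x * k x := by
  rw [← integral_const_mul]
  refine integral_congr_ae ((Lp.coeFn_smul c f).mono fun x hx => ?_)
  simp only [hx, Pi.smul_apply, smul_eq_mul, mul_assoc]

theorem IsWeakDeriv.add {D : Set E3} {i : Fin 3} {f g f' g' : L2 D}
    (h : IsWeakDeriv D i f g) (h' : IsWeakDeriv D i f' g') :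
    IsWeakDeriv D i (f + f') (g + g') := by
  intro ψ hψ
  rw [integral_add_mul f f' (hψ.memLp_fderiv _), integral_add_mul g g' hψ.memLp,
    h ψ hψ, h' ψ hψ, neg_add]

theorem IsWeakDeriv.smul {D : Set E3} {i : Fin 3} {f g : L2 D} (c : ℂ)
    (h : IsWeakDeriv D i f g) : IsWeakDeriv D i (c • f) (c • g) := by
  intro ψ hψ
  rw [integral_smul_mul, integral_smul_mul, h ψ hψ, mul_neg]

/-- Index of the partial derivatives of order at most two: the function itself, the first order
derivatives `∂ᵢ`, and the second order derivatives `∂ⱼ∂ᵢ`, indexed by `(i, j)`. -/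
abbrev JetIndex : Type := Unit ⊕ Fin 3 ⊕ (Fin 3 × Fin 3)

/-- The Sobolev space `H²(D)`. An element is a function in `L²(D)` together with its (uniquely
determined) weak derivatives of order one and two, which lie in `L²(D)`; the norm inherited from
the `ℓ²`-sum is `(‖f‖² + ∑ᵢ ‖∂ᵢ f‖² + ∑ᵢⱼ ‖∂ⱼ∂ᵢ f‖²)^(1/2)`. -/
def H2 (D : Set E3) : Submodule ℂ (PiLp 2 (fun _ : JetIndex => L2 D)) where
  carrier := {p | (∀ i, IsWeakDeriv D i (p (Sum.inl ())) (p (Sum.inr (Sum.inl i)))) ∧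
    ∀ i j, IsWeakDeriv D j (p (Sum.inr (Sum.inl i))) (p (Sum.inr (Sum.inr (i, j))))}
  zero_mem' := ⟨fun i => IsWeakDeriv.zero D i, fun _ j => IsWeakDeriv.zero D j⟩
  add_mem' := fun hp hq =>
    ⟨fun i => (hp.1 i).add (hq.1 i), fun i j => (hp.2 i j).add (hq.2 i j)⟩
  smul_mem' := fun c _ hp => ⟨fun i => (hp.1 i).smul c, fun i j => (hp.2 i j).smul c⟩

/-- The underlying `L²(D)` function of an element of `H²(D)`. -/
def toL2 {D : Set E3} (u : H2 D) : L2 D := (u : PiLp 2 (fun _ : JetIndex => L2 D)) (Sum.inl ())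

/-- The outgoing Green's function `exp(i ω |x|) / (4 π |x|)` of `-(Δ + ω²)` on `ℝ³`. -/
def green (ω : ℂ) (x : E3) : ℂ :=
  Complex.exp (Complex.I * ω * (‖x‖ : ℂ)) / (4 * (Real.pi : ℂ) * (‖x‖ : ℂ))

/-- The volume potential `K_D^ω[f](x) = ∫_D G^ω(x - y) f(y) dy`. -/
def volumePotential (D : Set E3) (ω : ℂ) (f : E3 → ℂ) (x : E3) : ℂ :=
  ∫ y in D, green ω (x - y) * f y

/-- The Newtonian potential `K_D[f](x) = ∫_D f(y) / (4 π |x - y|) dy`. -/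
def newtonianPotential (D : Set E3) (f : E3 → ℂ) (x : E3) : ℂ :=
  ∫ y in D, ((1 / (4 * Real.pi * ‖x - y‖) : ℝ) : ℂ) * f y

/-- `f ∈ L²(D)` satisfies `K_D[f] = μ f` in `L²(D)`. -/
def NewtonianEigenEq (D : Set E3) (μ : ℝ) (f : L2 D) : Prop :=
  newtonianPotential D f =ᵐ[volume.restrict D] fun x => (μ : ℂ) * f x

/-- `μ` is a simple eigenvalue of the Newtonian potential `K_D` on `L²(D)`, and `φ` is an
`L²`-normalized eigenfunction. -/
structure IsSimpleEigenpair (D : Set E3) (μ : ℝ) (φ : L2 D) : Prop where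
  norm_eq_one : ‖φ‖ = 1
  eigen_eq : NewtonianEigenEq D μ φ
  simple : ∀ f : L2 D, NewtonianEigenEq D μ f → ∃ c : ℂ, f = c • φ

/-- The Kerr nonlinearity `N(z) = z + |z|² z`. -/
def kerr (z : ℂ) : ℂ := z + ((‖z‖ ^ 2 : ℝ) : ℂ) * z

/-- The scaled nonlinear Lippmann-Schwinger equation `u = ω² K_D^{ε ω}[N(u)]` on `D`. -/
def SolvesLippmannSchwinger (D : Set E3) (ε : ℝ) (ω : ℂ) (u : H2 D) : Prop :=
  toL2 u =ᵐ[volume.restrict D]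
    fun x => ω ^ 2 * volumePotential D ((ε : ℂ) * ω) (fun y => kerr (toL2 u y)) x

/-- The parameter set of all `(a, ε) ∈ ℝ × (0, ∞)` with `|a| + ε < δ`. -/
def paramSet (δ : ℝ) : Set (ℝ × ℝ) := {p | 0 < p.2 ∧ |p.1| + p.2 < δ}

/-- A branch of scaled nonlinear resonances `ω(a, ε)` with small-amplitude resonant states
`u(a, ε) = a φ + h(a, ε)`, `⟨φ, h(a, ε)⟩ = 0`, where `ω` and `h` are `C¹` and
`ω(a, ε) → 1/√μ`, `h(a, ε) → 0` in `H²(D)` as `(a, ε) → 0`. -/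
structure IsResonanceBranch (D : Set E3) (μ : ℝ) (φ : L2 D) (δ : ℝ)
    (ω : ℝ × ℝ → ℂ) (u h : ℝ × ℝ → H2 D) : Prop where
  contDiffOn_freq : ContDiffOn ℝ 1 ω (paramSet δ)
  contDiffOn_corr : ContDiffOn ℝ 1 h (paramSet δ)
  solves : ∀ p ∈ paramSet δ, SolvesLippmannSchwinger D p.2 (ω p) (u p)
  decomp : ∀ p ∈ paramSet δ, toL2 (u p) = (p.1 : ℂ) • φ + toL2 (h p)
  orthogonal : ∀ p ∈ paramSet δ, inner ℂ φ (toL2 (h p)) = 0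
  tendsto_freq : Tendsto ω (𝓝[paramSet δ] 0) (𝓝 (((√μ)⁻¹ : ℝ) : ℂ))
  tendsto_corr : Tendsto h (𝓝[paramSet δ] 0) (𝓝 0)

end DielectricResonance

end

noncomputable section

namespace DielectricResonance

open scoped ENNReal BoundedContinuousFunction ContDiff Convolution

/-! Existence. Put c = μ^(-1/2). With u = a v and N(u) = a f the equation becomes f = v + a²|v|²v, v
= ω² K^{εω} f, normalised by ⟨φ, v⟩ = 1. At a = ε = 0 it is solved by ω = c, f = φ, and the implicit
function theorem, over ℝ because |v|² is not holomorphic, continues this solution. The unknown is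
(ω, f) ∈ ℂ × L²: since 1/|z| is locally square integrable in dimension three, K^κ maps L² to L^∞,
where the cubic term is smooth. The linearisation is bijective (`bijective_branchDeriv`) because 1 -
μ⁻¹K + ⟨φ, ·⟩φ is invertible (`isUnit_bordered`): K is Hilbert–Schmidt, so the Fredholm alternative
applies, and self-adjointness with simplicity of μ gives a trivial kernel.

Regularity. K^κ maps L² to H², smoothly in κ (`exists_potential_H2`). Cutting off the Green's
function outside the relevant distances makes the potential w of a test function f compactly
supported; then ∑ ‖∂ᵢ∂ⱼw‖² = ‖Δw‖² by integration by parts, while Δw is -f plus the convolution of f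
with an L² kernel.

Expansion. Let u be on any branch, with f now denoting its L² function. The integral equation
implies the nonlinear Helmholtz equation (`kerr_ae_eq_of_solves`), so N(u) is a combination of Δu
and u and tends to 0 in L². The L^∞ representative v = ω² K^{εω} N(u) is then O(‖f‖), and the cubic
term O(‖f‖³). Inverting the bordered operator gives f - aφ = O((|ω - c| + ε + ‖f‖²)‖f‖), hence f =
O(|a|). Pairing with φ leaves a scalar equation for ω (`frequency_eq`), every term of which carries
a factor a. It is divided by a where a ≠ 0. At a = 0 the equation says nothing about ω, and the
estimate passes there by continuity.

The first-order term is radiation: (e^{iκs} - 1)/(4πs) = iκ/(4π) + O(κ²) on bounded ranges of s, so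
K^κ - K ≈ κ (i/4π)∫_D, and ⟨φ, K'φ⟩ = (i/4π)(∫φ)² for real φ. The cubic term only contributes O(a²).
-/

/-! ### Integral operators with square integrable difference kernels -/

/-- The space `L^∞(D)` of complex-valued functions. -/
abbrev LInf (D : Set E3) : Type := Lp ℂ ⊤ (volume.restrict D)

/-- The integral operator over `A` with the difference kernel `q (x - y)`. -/
def convInt (A : Set E3) (q f : E3 → ℂ) (x : E3) : ℂ := ∫ y in A, q (x - y) * f y

theorem memLp_comp_sub_left {q : E3 → ℂ} (hq : MemLp q 2 volume) (A : Set E3) (x : E3) :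
    MemLp (fun y => q (x - y)) 2 (volume.restrict A) :=
  (hq.comp_measurePreserving (Measure.measurePreserving_sub_left volume x)).restrict A

theorem eLpNorm_comp_sub_left_le {q : E3 → ℂ} (hq : MemLp q 2 volume) (A : Set E3) (x : E3) :
    eLpNorm (fun y => q (x - y)) 2 (volume.restrict A) ≤ eLpNorm q 2 volume := by
  refine (eLpNorm_mono_measure _ Measure.restrict_le_self).trans ?_
  exact (eLpNorm_comp_measurePreserving hq.1 (Measure.measurePreserving_sub_left volume x)).le

theorem enorm_integral_mul_le {α : Type*} [MeasurableSpace α] {ν : Measure α} {f g : α → ℂ}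
    (hf : MemLp f 2 ν) (hg : MemLp g 2 ν) :
    ‖∫ x, f x * g x ∂ν‖ₑ ≤ eLpNorm f 2 ν * eLpNorm g 2 ν := by
  refine (enorm_integral_le_lintegral_enorm _).trans ?_
  rw [← eLpNorm_one_eq_lintegral_enorm]
  have h := eLpNorm_smul_le_mul_eLpNorm (p := 2) (q := 2) (r := 1) hg.1 hf.1
  exact h

theorem norm_integral_mul_le {α : Type*} [MeasurableSpace α] {ν : Measure α} {f g : α → ℂ}
    (hf : MemLp f 2 ν) (hg : MemLp g 2 ν) :
    ‖∫ x, f x * g x ∂ν‖ ≤ (eLpNorm f 2 ν).toReal * (eLpNorm g 2 ν).toReal := by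
  rw [← ENNReal.toReal_mul, ← toReal_enorm]
  exact ENNReal.toReal_mono (ENNReal.mul_ne_top hf.eLpNorm_ne_top hg.eLpNorm_ne_top)
    (enorm_integral_mul_le hf hg)

/-- Cauchy–Schwarz in y for fixed x, and translation invariance of the norm of q. The bound holds at
every x, hence the target space L^∞ below. -/
theorem norm_convInt_le {A : Set E3} {q f : E3 → ℂ} (hq : MemLp q 2 volume)
    (hf : MemLp f 2 (volume.restrict A)) (x : E3) :
    ‖convInt A q f x‖ ≤ (eLpNorm q 2 volume).toReal * (eLpNorm f 2 (volume.restrict A)).toReal := by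
  refine (norm_integral_mul_le (memLp_comp_sub_left hq A x) hf).trans ?_
  gcongr
  · exact hq.eLpNorm_ne_top
  · exact eLpNorm_comp_sub_left_le hq A x

theorem integrable_convInt {A : Set E3} {q f : E3 → ℂ} (hq : MemLp q 2 volume)
    (hf : MemLp f 2 (volume.restrict A)) (x : E3) :
    Integrable (fun y => q (x - y) * f y) (volume.restrict A) :=
  (memLp_comp_sub_left hq A x).integrable_mul hf

theorem convInt_congr {A : Set E3} {q q' f f' : E3 → ℂ} (hq : q =ᵐ[volume] q')
    (hf : f =ᵐ[volume.restrict A] f') : convInt A q f = convInt A q' f' := by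
  funext x
  refine integral_congr_ae ?_
  have h1 : (fun y => q (x - y)) =ᵐ[volume.restrict A] fun y => q' (x - y) :=
    ae_restrict_of_ae ((Measure.measurePreserving_sub_left volume x).quasiMeasurePreserving.ae_eq hq)
  filter_upwards [h1, hf] with y h1 h2
  rw [h1, h2]

/-- Changing q and f on null sets does not change the integral at any point x, so both may be
replaced by strongly measurable representatives before the measurability of parametric integrals is
invoked. -/
theorem aestronglyMeasurable_convInt {A : Set E3} {q f : E3 → ℂ} (hq : MemLp q 2 volume)
    (hf : MemLp f 2 (volume.restrict A)) {B : Set E3} :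
    AEStronglyMeasurable (convInt A q f) (volume.restrict B) := by
  rw [convInt_congr hq.1.ae_eq_mk hf.1.ae_eq_mk]
  refine StronglyMeasurable.aestronglyMeasurable ?_
  refine StronglyMeasurable.integral_prod_right (f := fun x y => hq.1.mk q (x - y) * hf.1.mk f y) ?_
  exact (hq.1.stronglyMeasurable_mk.comp_measurable (measurable_fst.sub measurable_snd)).mul
    (hf.1.stronglyMeasurable_mk.comp_measurable measurable_snd)

theorem memLp_top_convInt {A : Set E3} {q f : E3 → ℂ} (hq : MemLp q 2 volume)
    (hf : MemLp f 2 (volume.restrict A)) (B : Set E3) :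
    MemLp (convInt A q f) ⊤ (volume.restrict B) :=
  memLp_top_of_bound (aestronglyMeasurable_convInt hq hf) _
    (Eventually.of_forall (norm_convInt_le hq hf))

/-- The operator `L²(A) → L^∞(B)` with the difference kernel `q ∈ L²(ℝ³)`. -/
def convOp (A B : Set E3) : Lp ℂ 2 (volume : Measure E3) →L[ℂ] L2 A →L[ℂ] LInf B :=
  LinearMap.mkContinuous₂
    (LinearMap.mk₂ ℂ (fun q f => (memLp_top_convInt (Lp.memLp q) (Lp.memLp f) B).toLp _)
      (fun q q' f => by
        rw [← MemLp.toLp_add]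
        congr 1
        rw [convInt_congr (Lp.coeFn_add q q') (ae_eq_refl _)]
        funext x
        rw [Pi.add_apply, convInt, convInt, convInt, ← integral_add
          (integrable_convInt (Lp.memLp q) (Lp.memLp f) x)
          (integrable_convInt (Lp.memLp q') (Lp.memLp f) x)]
        simp only [Pi.add_apply, add_mul])
      (fun c q f => by
        rw [← MemLp.toLp_const_smul]
        congr 1
        rw [convInt_congr (Lp.coeFn_smul c q) (ae_eq_refl _)]
        funext x
        simp only [convInt, Pi.smul_apply, smul_eq_mul, mul_assoc, integral_const_mul])
      (fun q f f' => by
        rw [← MemLp.toLp_add]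
        congr 1
        rw [convInt_congr (ae_eq_refl _) (Lp.coeFn_add f f')]
        funext x
        rw [Pi.add_apply, convInt, convInt, convInt, ← integral_add
          (integrable_convInt (Lp.memLp q) (Lp.memLp f) x)
          (integrable_convInt (Lp.memLp q) (Lp.memLp f') x)]
        simp only [Pi.add_apply, mul_add])
      (fun c q f => by
        rw [← MemLp.toLp_const_smul]
        congr 1
        rw [convInt_congr (ae_eq_refl _) (Lp.coeFn_smul c f)]
        funext x
        simp only [convInt, Pi.smul_apply, smul_eq_mul, mul_left_comm _ c, integral_const_mul])) 1
    (fun q f => by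
      rw [LinearMap.mk₂_apply, one_mul, Lp.norm_toLp]
      refine ENNReal.toReal_le_of_le_ofReal (by positivity) ?_
      rw [eLpNorm_exponent_top]
      refine eLpNormEssSup_le_of_ae_bound (Eventually.of_forall ?_)
      exact norm_convInt_le (Lp.memLp q) (Lp.memLp f))

theorem coeFn_convOp (A B : Set E3) (q : Lp ℂ 2 (volume : Measure E3)) (f : L2 A) :
    convOp A B q f =ᵐ[volume.restrict B] convInt A q f :=
  MemLp.coeFn_toLp (memLp_top_convInt (Lp.memLp q) (Lp.memLp f) B)

/-! ### Weakly singular kernels g(z)/|z| -/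

/-- In polar coordinates the Jacobian r² cancels the singularity. This is where dimension three
enters the L² to L^∞ bounds. -/
theorem integrableOn_norm_inv_sq_ball (R : ℝ) :
    IntegrableOn (fun x : E3 => (‖x‖⁻¹) ^ 2) (Metric.ball 0 R) volume := by
  rw [integrableOn_fun_norm_addHaar volume (f := fun r : ℝ => (r⁻¹) ^ 2)]
  have h : IntegrableOn (fun _ : ℝ => (1 : ℝ)) (Set.Ioo 0 R) volume := by simp
  refine h.congr_fun (fun r hr => ?_) measurableSet_Ioo
  have : r ≠ 0 := hr.1.ne'
  simp [this]

/-- The truncated kernel `1_{|z| < R} / |z|`. -/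
def invNormTrunc (R : ℝ) : E3 → ℂ :=
  (Metric.ball (0 : E3) R).indicator fun z => (((‖z‖)⁻¹ : ℝ) : ℂ)

theorem memLp_invNormTrunc (R : ℝ) : MemLp (invNormTrunc R) 2 volume := by
  have hm : Measurable (fun z : E3 => (((‖z‖)⁻¹ : ℝ) : ℂ)) := by fun_prop
  have hm' : Measurable (invNormTrunc R) := hm.indicator Metric.isOpen_ball.measurableSet
  rw [memLp_two_iff_integrable_sq_norm hm'.aestronglyMeasurable]
  have := (integrable_indicator_iff Metric.isOpen_ball.measurableSet).2
    (integrableOn_norm_inv_sq_ball R)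
  refine this.congr (Eventually.of_forall fun z => ?_)
  by_cases hz : z ∈ Metric.ball (0 : E3) R
  · simp only [invNormTrunc, Set.indicator_of_mem hz, Complex.norm_real, norm_inv, norm_norm]
  · simp [invNormTrunc, Set.indicator_of_notMem hz]

theorem memLp_mul_invNormTrunc (g : E3 →ᵇ ℂ) (R : ℝ) :
    MemLp (fun z => g z * invNormTrunc R z) 2 volume :=
  MemLp.of_le_mul (c := ‖g‖) (memLp_invNormTrunc R)
    (g.continuous.aestronglyMeasurable.mul (memLp_invNormTrunc R).1)
    (Eventually.of_forall fun z => by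
      rw [norm_mul]
      gcongr
      exact g.norm_coe_le_norm z)

/-- The weakly singular kernel `1_{|z| < R} g(z) / |z|` as an element of `L²(ℝ³)`. -/
def singKernel (R : ℝ) : (E3 →ᵇ ℂ) →L[ℂ] Lp ℂ 2 (volume : Measure E3) :=
  LinearMap.mkContinuous
    { toFun := fun g => (memLp_mul_invNormTrunc g R).toLp _
      map_add' := fun g g' => by
        rw [← MemLp.toLp_add]
        congr 1
        funext z
        simp [add_mul]
      map_smul' := fun c g => by
        rw [RingHom.id_apply, ← MemLp.toLp_const_smul]
        congr 1
        funext z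
        simp [mul_assoc] } (eLpNorm (invNormTrunc R) 2 volume).toReal
    (fun g => by
      rw [LinearMap.coe_mk, AddHom.coe_mk, Lp.norm_toLp, mul_comm,
        ← ENNReal.toReal_ofReal (norm_nonneg g), ← ENNReal.toReal_mul]
      refine ENNReal.toReal_mono
        (ENNReal.mul_ne_top ENNReal.ofReal_ne_top (memLp_invNormTrunc R).eLpNorm_ne_top) ?_
      refine eLpNorm_le_mul_eLpNorm_of_ae_le_mul (Eventually.of_forall fun z => ?_) 2
      rw [norm_mul]
      gcongr
      exact g.norm_coe_le_norm z)

theorem coeFn_singKernel (R : ℝ) (g : E3 →ᵇ ℂ) :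
    singKernel R g =ᵐ[volume] fun z => g z * invNormTrunc R z :=
  MemLp.coeFn_toLp (memLp_mul_invNormTrunc g R)

/-- The operator `L²(A) → L^∞(B)` with kernel `g(x - y) / |x - y|`, for `A, B ⊆ ball 0 r`. -/
def singOp (r : ℝ) (A B : Set E3) : (E3 →ᵇ ℂ) →L[ℂ] L2 A →L[ℂ] LInf B :=
  (convOp A B).comp (singKernel (2 * r))

theorem convInt_singKernel {r : ℝ} {A : Set E3} (hAm : MeasurableSet A)
    (hA : A ⊆ Metric.ball 0 r) (g : E3 →ᵇ ℂ)
    (f : E3 → ℂ) {x : E3} (hx : x ∈ Metric.ball (0 : E3) r) :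
    convInt A (singKernel (2 * r) g) f x =
      ∫ y in A, g (x - y) * (((‖x - y‖)⁻¹ : ℝ) : ℂ) * f y := by
  rw [convInt_congr (coeFn_singKernel (2 * r) g) (ae_eq_refl _)]
  refine setIntegral_congr_fun hAm fun y hy => ?_
  -- Differences of points of the ball of radius r stay in the ball of radius 2r, so the truncation
  -- is invisible.
  have h : x - y ∈ Metric.ball (0 : E3) (2 * r) := by
    have h1 := hA hy
    rw [mem_ball_zero_iff] at *
    linarith [norm_sub_le x y]
  simp only [invNormTrunc, Set.indicator_of_mem h]

theorem coeFn_singOp {r : ℝ} {A B : Set E3} (hAm : MeasurableSet A) (hBm : MeasurableSet B)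
    (hA : A ⊆ Metric.ball 0 r) (hB : B ⊆ Metric.ball 0 r) (g : E3 →ᵇ ℂ) (f : L2 A) :
    singOp r A B g f =ᵐ[volume.restrict B]
      fun x => ∫ y in A, g (x - y) * (((‖x - y‖)⁻¹ : ℝ) : ℂ) * f y := by
  filter_upwards [coeFn_convOp A B (singKernel (2 * r) g) f, ae_restrict_mem hBm] with x hx hxB
  rw [singOp, ContinuousLinearMap.comp_apply, hx]
  exact convInt_singKernel hAm hA g f (hB hxB)

/-! ### Polar coordinates and radial kernels -/

/-- Integration in polar coordinates in `ℝ³`. -/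
theorem integral_polar {f : E3 → ℂ} (hf : Integrable f volume) :
    ∫ x, f x = ∫ θ : Metric.sphere (0 : E3) 1, (∫ r in Set.Ioi (0 : ℝ), (r ^ 2) • f (r • θ.1))
      ∂(volume : Measure E3).toSphere := by
  have hmp := (volume : Measure E3).measurePreserving_homeomorphUnitSphereProd
  have hemb := (homeomorphUnitSphereProd E3).measurableEmbedding
  set F : Metric.sphere (0 : E3) 1 × Set.Ioi (0 : ℝ) → ℂ := fun p => f (p.2.1 • p.1.1) with hF
  have hdim : Module.finrank ℝ E3 - 1 = 2 := by simp
  rw [hdim] at hmp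
  have hcomp : ∀ x : ({(0 : E3)}ᶜ : Set E3), F (homeomorphUnitSphereProd E3 x) = f x.1 := by
    intro x
    have h := homeomorphUnitSphereProd_symm_apply_coe E3 (homeomorphUnitSphereProd E3 x)
    rw [Homeomorph.symm_apply_apply] at h
    rw [hF, h]
  have hint : Integrable F ((volume : Measure E3).toSphere.prod (Measure.volumeIoiPow 2)) := by
    rw [← hmp.integrable_comp_emb hemb]
    have : F ∘ (homeomorphUnitSphereProd E3) = f ∘ (↑) := funext hcomp
    rw [this, ← integrableOn_iff_comap_subtypeVal (measurableSet_singleton _).compl]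
    exact hf.integrableOn
  calc ∫ x, f x = ∫ x : ({(0)}ᶜ : Set E3), f x.1 ∂((volume : Measure E3).comap Subtype.val) := by
        rw [integral_subtype_comap (measurableSet_singleton _).compl f,
          restrict_compl_singleton]
    _ = ∫ p, F p ∂((volume : Measure E3).toSphere.prod (Measure.volumeIoiPow 2)) := by
        rw [← hmp.integral_comp hemb]
        simp_rw [hcomp]
    _ = _ := by
        rw [integral_prod _ hint]
        refine integral_congr_ae (Eventually.of_forall fun θ => ?_)
        simp only [Measure.volumeIoiPow, ENNReal.ofReal, hF]
        rw [integral_withDensity_eq_integral_smul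
          ((measurable_subtype_coe.pow_const _).real_toNNReal),
          integral_subtype_comap measurableSet_Ioi
            fun a : ℝ => Real.toNNReal (a ^ 2) • f (a • θ.1)]
        refine setIntegral_congr_fun measurableSet_Ioi fun r hr => ?_
        simp only [NNReal.smul_def, Real.coe_toNNReal _ (sq_nonneg r)]

theorem toSphere_real_univ : (volume : Measure E3).toSphere.real Set.univ = 4 * Real.pi := by
  rw [Measure.toSphere_real_apply_univ]
  simp [Measure.real, EuclideanSpace.volume_ball_fin_three]
  rw [ENNReal.toReal_ofReal (by positivity)]
  ring

/-- The partial derivative `∂ᵢ ψ`. -/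
def pd (i : Fin 3) (ψ : E3 → ℂ) (x : E3) : ℂ := fderiv ℝ ψ x (e3 i)

/-- The Laplacian of a function on `ℝ³`. -/
def lap (ψ : E3 → ℂ) (x : E3) : ℂ := ∑ i, pd i (pd i ψ) x

theorem contDiff_pd {ψ : E3 → ℂ} (h : ContDiff ℝ ((⊤ : ℕ∞) : WithTop ℕ∞) ψ) (i : Fin 3) :
    ContDiff ℝ ((⊤ : ℕ∞) : WithTop ℕ∞) (pd i ψ) :=
  (h.fderiv_right (m := ((⊤ : ℕ∞) : WithTop ℕ∞)) (by simp)).clm_apply contDiff_const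

theorem hasCompactSupport_pd {ψ : E3 → ℂ} (h : HasCompactSupport ψ) (i : Fin 3) :
    HasCompactSupport (pd i ψ) :=
  (h.fderiv ℝ).comp_left (g := fun L : E3 →L[ℝ] ℂ => L (e3 i)) (by simp)

theorem contDiff_lap {ψ : E3 → ℂ} (h : ContDiff ℝ ((⊤ : ℕ∞) : WithTop ℕ∞) ψ) :
    ContDiff ℝ ((⊤ : ℕ∞) : WithTop ℕ∞) (lap ψ) :=
  ContDiff.sum fun i _ => contDiff_pd (contDiff_pd h i) i

theorem hasCompactSupport_lap {ψ : E3 → ℂ} (h : HasCompactSupport ψ) :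
    HasCompactSupport (lap ψ) := by
  refine HasCompactSupport.intro h.isCompact fun x hx => ?_
  refine Finset.sum_eq_zero fun i _ => ?_
  refine image_eq_zero_of_notMem_tsupport fun hx' => hx ?_
  have h1 : ∀ φ : E3 → ℂ, tsupport (pd i φ) ⊆ tsupport φ := fun φ =>
    (closure_mono fun y hy => by
      intro h0
      apply hy
      simp [pd, h0]).trans (tsupport_fderiv_subset ℝ)
  exact h1 _ (h1 _ hx')

theorem sum_coord_smul (x : E3) : ∑ i, x i • e3 i = x := by
  ext j
  simp [e3, Pi.single_apply]

theorem exists_bound_ball {G : Type*} [NormedAddCommGroup G] {ψ : E3 → G} (hc : Continuous ψ)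
    (hs : HasCompactSupport ψ) :
    ∃ C R : ℝ, 0 ≤ C ∧ 0 < R ∧ (∀ x, ‖ψ x‖ ≤ C) ∧ ∀ x, R ≤ ‖x‖ → ψ x = 0 := by
  obtain ⟨C, hC⟩ := hc.bounded_above_of_compact_support hs
  obtain ⟨R, hR⟩ := hs.isCompact.isBounded.subset_ball 0
  refine ⟨C, max R 1, (norm_nonneg _).trans (hC 0), by positivity, hC, fun x hx => ?_⟩
  refine image_eq_zero_of_notMem_tsupport fun h => ?_
  have := hR h
  rw [mem_ball_zero_iff] at this
  exact absurd (le_max_left R 1) (by linarith)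

/-- A continuous function with compact support times a kernel that is `O(|x|⁻²)` is integrable. -/
theorem integrable_dominant (C R : ℝ) :
    Integrable ((Metric.ball (0 : E3) R).indicator fun x => C * (1 + (‖x‖⁻¹) ^ 2)) volume := by
  rw [integrable_indicator_iff Metric.isOpen_ball.measurableSet]
  refine Integrable.const_mul (Integrable.add ?_ (integrableOn_norm_inv_sq_ball R)) C
  exact integrableOn_const (hs := measure_ball_lt_top.ne)

theorem integrable_of_le_dominant {F : E3 → ℂ} (hm : AEStronglyMeasurable F volume) {C R : ℝ}
    (h1 : ∀ x, x ≠ 0 → ‖F x‖ ≤ C * (1 + (‖x‖⁻¹) ^ 2)) (h2 : ∀ x, R ≤ ‖x‖ → F x = 0) :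
    Integrable F volume := by
  refine (integrable_dominant C R).mono' hm ?_
  have h0 : ∀ᵐ x : E3, x ≠ 0 := by simp [ae_iff]
  filter_upwards [h0] with x hx
  by_cases hR : R ≤ ‖x‖
  · rw [h2 x hR, norm_zero, Set.indicator_of_notMem (by simpa using hR)]
  · rw [Set.indicator_of_mem (by simpa using hR)]
    exact h1 x hx

/-- Along each ray, r² times the integrand is the derivative of H(r) = (g'(r) r - g(r)) ψ(rθ). It
integrates to -H(0) = g(0) ψ(0) for every direction θ, and the sphere has area 4π. -/
theorem radial_polar {g : ℝ → ℂ} (hg : ContDiff ℝ ((⊤ : ℕ∞) : WithTop ℕ∞) g) {ψ : E3 → ℂ}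
    (hψ : ContDiff ℝ ((⊤ : ℕ∞) : WithTop ℕ∞) ψ) (hs : HasCompactSupport ψ)
    (hint : Integrable (fun x : E3 =>
      (deriv g ‖x‖ * (‖x‖ : ℂ) - g ‖x‖) / (‖x‖ : ℂ) ^ 3 * fderiv ℝ ψ x x
      + deriv (deriv g) ‖x‖ / (‖x‖ : ℂ) * ψ x) volume) :
    ∫ x : E3, ((deriv g ‖x‖ * (‖x‖ : ℂ) - g ‖x‖) / (‖x‖ : ℂ) ^ 3 * fderiv ℝ ψ x x
      + deriv (deriv g) ‖x‖ / (‖x‖ : ℂ) * ψ x) = 4 * (Real.pi : ℂ) * (g 0 * ψ 0) := by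
  obtain ⟨C, R, -, hR, -, hψR⟩ := exists_bound_ball hψ.continuous hs
  have hg' : ContDiff ℝ ((⊤ : ℕ∞) : WithTop ℕ∞) (deriv g) := hg.deriv'
  have hg'' : ContDiff ℝ ((⊤ : ℕ∞) : WithTop ℕ∞) (deriv (deriv g)) := hg'.deriv'
  rw [integral_polar hint]
  have key : ∀ θ : Metric.sphere (0 : E3) 1, ∫ r in Set.Ioi (0 : ℝ), (r ^ 2) •
      ((deriv g ‖r • θ.1‖ * (‖r • θ.1‖ : ℂ) - g ‖r • θ.1‖) / (‖r • θ.1‖ : ℂ) ^ 3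
        * fderiv ℝ ψ (r • θ.1) (r • θ.1)
      + deriv (deriv g) ‖r • θ.1‖ / (‖r • θ.1‖ : ℂ) * ψ (r • θ.1)) = g 0 * ψ 0 := by
    intro θ
    have hθ : ‖θ.1‖ = 1 := by simp
    set H : ℝ → ℂ := fun r => (deriv g r * (r : ℂ) - g r) * ψ (r • θ.1) with hH
    set H' : ℝ → ℂ := fun r => (deriv (deriv g) r * (r : ℂ)) * ψ (r • θ.1)
      + (deriv g r * (r : ℂ) - g r) * fderiv ℝ ψ (r • θ.1) θ.1 with hH'
    have hd : ∀ r, HasDerivAt H (H' r) r := by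
      intro r
      have h1 : HasDerivAt g (deriv g r) r := (hg.differentiable (by simp) r).hasDerivAt
      have h2 : HasDerivAt (deriv g) (deriv (deriv g) r) r :=
        (hg'.differentiable (by simp) r).hasDerivAt
      have h3 : HasDerivAt (fun r : ℝ => (r : ℂ)) 1 r := by
        simpa using (hasDerivAt_id r).ofReal_comp
      have h4 : HasDerivAt (fun r : ℝ => ψ (r • θ.1)) (fderiv ℝ ψ (r • θ.1) θ.1) r := by
        have h5 : HasDerivAt (fun r : ℝ => r • θ.1) θ.1 r := by
          simpa using (hasDerivAt_id r).smul_const θ.1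
        exact ((hψ.differentiable (by simp) (r • θ.1)).hasFDerivAt).comp_hasDerivAt r h5
      have h6 := ((h2.mul h3).sub h1).mul h4
      refine h6.congr_deriv ?_
      simp only [hH', Pi.mul_apply, Pi.sub_apply]
      ring
    have hz : ∀ r : ℝ, R ≤ |r| → ψ (r • θ.1) = 0 := fun r hr =>
      hψR _ (by rwa [norm_smul, hθ, mul_one])
    have hHs : HasCompactSupport H := by
      refine HasCompactSupport.intro (isCompact_Icc (a := -R) (b := R)) fun r hr => ?_
      have : R ≤ |r| := by
        by_contra h
        push Not at h
        exact hr ⟨(abs_lt.1 h).1.le, (abs_lt.1 h).2.le⟩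
      simp only [hH, hz r this, mul_zero]
    have hH'e : H' = deriv H := funext fun r => (hd r).deriv.symm
    have hcont : Continuous H' := by
      have : Continuous fun r : ℝ => fderiv ℝ ψ (r • θ.1) θ.1 :=
        ((hψ.continuous_fderiv (by simp)).comp (by fun_prop)).clm_apply continuous_const
      have h1 := hg.continuous
      have h2 := hg'.continuous
      have h3 := hg''.continuous
      have h4 := hψ.continuous
      simp only [hH']
      fun_prop
    have hint' : IntegrableOn H' (Set.Ioi 0) volume :=
      (hcont.integrable_of_hasCompactSupport (hH'e ▸ hHs.deriv)).integrableOn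
    have hlim : Tendsto H atTop (𝓝 0) :=
      tendsto_const_nhds.congr' (by
        filter_upwards [eventually_ge_atTop R] with r hr
        simp only [hH, hz r (hr.trans (le_abs_self r)), mul_zero])
    have := integral_Ioi_of_hasDerivAt_of_tendsto' (fun r _ => hd r) hint' hlim
    have h0 : g 0 * ψ 0 = 0 - H 0 := by simp [hH]
    rw [h0, ← this]
    refine setIntegral_congr_fun measurableSet_Ioi fun r hr => ?_
    have hr' : (0 : ℝ) < r := hr
    have hrc : (r : ℂ) ≠ 0 := by exact_mod_cast hr'.ne'
    have hn : ‖r • θ.1‖ = r := by rw [norm_smul, hθ, mul_one, Real.norm_of_nonneg hr'.le]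
    simp only [hn, hH', map_smul, Complex.real_smul]
    push_cast
    field_simp
    ring
  simp_rw [key]
  rw [integral_const, toSphere_real_univ, Complex.real_smul]
  push_cast
  ring

/-- Here t is |x| and s is |x| or its regularisation. Since s ≥ t, the bound does not depend on the
regularisation, as dominated convergence requires. -/
theorem norm_div_le_dominant {M t s : ℝ} (ht : 0 < t) (hts : t ≤ s) {a : ℂ} (ha : ‖a‖ ≤ M) :
    ‖a / (s : ℂ)‖ ≤ M * (1 + (t⁻¹) ^ 2) := by
  have hs : 0 < s := ht.trans_le hts
  have hM : 0 ≤ M := (norm_nonneg a).trans ha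
  rw [norm_div, Complex.norm_real, Real.norm_of_nonneg hs.le, div_eq_mul_inv]
  have h1 : s⁻¹ ≤ t⁻¹ := inv_anti₀ ht hts
  have h2 : t⁻¹ ≤ 1 + (t⁻¹) ^ 2 := by nlinarith [sq_nonneg (t⁻¹ - 1), inv_pos.2 ht]
  gcongr
  exact h1.trans h2

theorem norm_radialDeriv_le_dominant {M t s : ℝ} (ht : 0 < t) (hts : t ≤ s) {a b : ℂ}
    (ha : ‖a‖ ≤ M) (hb : ‖b‖ ≤ M) :
    ‖(b * (s : ℂ) - a) / (s : ℂ) ^ 3‖ * t ≤ 2 * M * (1 + (t⁻¹) ^ 2) := by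
  have hs : 0 < s := ht.trans_le hts
  have hM : 0 ≤ M := (norm_nonneg a).trans ha
  have h1 : s⁻¹ ≤ t⁻¹ := inv_anti₀ ht hts
  have hsi : 0 < s⁻¹ := inv_pos.2 hs
  have hst : s⁻¹ * t ≤ 1 := by
    rw [inv_mul_le_iff₀ hs]; linarith
  have hn : ‖b * (s : ℂ) - a‖ ≤ M * s + M := by
    refine (norm_sub_le _ _).trans ?_
    rw [norm_mul, Complex.norm_real, Real.norm_of_nonneg hs.le]
    gcongr
  rw [norm_div, norm_pow, Complex.norm_real, Real.norm_of_nonneg hs.le]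
  calc ‖b * (s : ℂ) - a‖ / s ^ 3 * t ≤ (M * s + M) / s ^ 3 * t := by gcongr
    _ = M * (s⁻¹ + s⁻¹ ^ 2) * (s⁻¹ * t) := by field_simp
    _ ≤ M * (t⁻¹ + t⁻¹ ^ 2) * 1 := by gcongr
    _ ≤ 2 * M * (1 + (t⁻¹) ^ 2) := by nlinarith [sq_nonneg (t⁻¹ - 1), inv_pos.2 ht]

/-! ### Distributional Laplacian of a radial kernel, by regularisation -/

/-- The regularised distance `√(|x|² + η²)` to the origin. -/
def regNorm (η : ℝ) (x : E3) : ℝ := √(‖x‖ ^ 2 + η ^ 2)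

theorem le_regNorm (η : ℝ) (x : E3) : ‖x‖ ≤ regNorm η x :=
  Real.le_sqrt_of_sq_le (by nlinarith [sq_nonneg η])

theorem regNorm_pos {η : ℝ} (hη : 0 < η) (x : E3) : 0 < regNorm η x :=
  Real.sqrt_pos.2 (by positivity)

theorem regNorm_le {η : ℝ} (hη : |η| ≤ 1) (x : E3) : regNorm η x ≤ ‖x‖ + 1 := by
  refine Real.sqrt_le_iff.2 ⟨by positivity, ?_⟩
  have : η ^ 2 ≤ 1 := by rw [← sq_abs]; exact pow_le_one₀ (abs_nonneg _) hη
  nlinarith [norm_nonneg x]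

theorem regNorm_zero (x : E3) : regNorm 0 x = ‖x‖ := by
  simp [regNorm]

theorem continuous_regNorm (η : ℝ) : Continuous (regNorm η) := by
  unfold regNorm; fun_prop

theorem continuous_regNorm_left (x : E3) : Continuous fun η => regNorm η x := by
  unfold regNorm; fun_prop

theorem hasFDerivAt_regKernel {g : ℝ → ℂ} (hg : ContDiff ℝ ((⊤ : ℕ∞) : WithTop ℕ∞) g) {η : ℝ}
    (hη : 0 < η) (x : E3) :
    HasFDerivAt (fun x => g (regNorm η x) / (regNorm η x : ℂ))
      ((innerSL ℝ x).smulRight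
        ((deriv g (regNorm η x) * (regNorm η x : ℂ) - g (regNorm η x)) / (regNorm η x : ℂ) ^ 3)) x := by
  have hs := regNorm_pos hη x
  have hsc : (regNorm η x : ℂ) ≠ 0 := by exact_mod_cast hs.ne'
  have h1 : HasFDerivAt (fun x : E3 => ‖x‖ ^ 2 + η ^ 2) (2 • innerSL ℝ x) x :=
    ((hasStrictFDerivAt_norm_sq x).hasFDerivAt).add_const _
  have h2 : HasFDerivAt (regNorm η) ((1 / (2 * regNorm η x)) • (2 • innerSL ℝ x)) x :=
    h1.sqrt (by positivity)
  have h3 : HasDerivAt g (deriv g (regNorm η x)) (regNorm η x) :=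
    (hg.differentiable (by simp) _).hasDerivAt
  have h4 : HasDerivAt (fun r : ℝ => (r : ℂ)) 1 (regNorm η x) := by
    simpa using (hasDerivAt_id (regNorm η x)).ofReal_comp
  have h5 : HasDerivAt (fun r : ℝ => g r / (r : ℂ)) _ (regNorm η x) := h3.div h4 hsc
  refine (h5.hasFDerivAt.comp x h2).congr_fderiv ?_
  ext v
  simp only [ContinuousLinearMap.comp_apply, ContinuousLinearMap.toSpanSingleton_apply,
    ContinuousLinearMap.smulRight_apply, _root_.smul_apply,
    innerSL_apply_apply, Complex.real_smul, smul_eq_mul, nsmul_eq_mul]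
  push_cast
  field_simp

theorem sum_inner_mul_pd (ψ : E3 → ℂ) (x : E3) :
    ∑ i, ((inner ℝ x (e3 i) : ℝ) : ℂ) * pd i ψ x = fderiv ℝ ψ x x := by
  conv_rhs => rw [← sum_coord_smul x]
  rw [map_sum]
  refine Finset.sum_congr rfl fun i _ => ?_
  rw [sum_coord_smul, map_smul, Complex.real_smul, pd]
  congr 2
  simp [e3, EuclideanSpace.inner_single_right]

/-- The regularised kernel is smooth at the origin, so integration by parts leaves no boundary term.
Its gradient is a scalar multiple of x, so only the derivative of ψ along x survives, the form
integrated in `radial_polar`. -/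
theorem integral_regKernel_mul_lap {g : ℝ → ℂ} (hg : ContDiff ℝ ((⊤ : ℕ∞) : WithTop ℕ∞) g)
    {ψ : E3 → ℂ} (hψ : ContDiff ℝ ((⊤ : ℕ∞) : WithTop ℕ∞) ψ) (hs : HasCompactSupport ψ)
    {η : ℝ} (hη : 0 < η) :
    ∫ x : E3, g (regNorm η x) / (regNorm η x : ℂ) * lap ψ x =
      -∫ x : E3, (deriv g (regNorm η x) * (regNorm η x : ℂ) - g (regNorm η x))
        / (regNorm η x : ℂ) ^ 3 * fderiv ℝ ψ x x := by
  have hne : ∀ x, (regNorm η x : ℂ) ≠ 0 := fun x => by exact_mod_cast (regNorm_pos hη x).ne'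
  have hc0 := continuous_regNorm η
  have hc1 := hg.continuous
  have hc2 : Continuous (deriv g) := hg.continuous_deriv (by simp)
  set k : E3 → ℂ := fun x => g (regNorm η x) / (regNorm η x : ℂ) with hk
  have hkc : Continuous k := (hc1.comp hc0).div (Complex.continuous_ofReal.comp hc0) hne
  set w : E3 → ℂ := fun x => (deriv g (regNorm η x) * (regNorm η x : ℂ) - g (regNorm η x))
        / (regNorm η x : ℂ) ^ 3 with hw
  have hwc : Continuous w := by
    refine Continuous.div (by fun_prop) (by fun_prop) fun x => pow_ne_zero _ (hne x)
  have hfd : ∀ x v, fderiv ℝ k x v = ((inner ℝ x v : ℝ) : ℂ) * w x := fun x v => by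
    rw [(hasFDerivAt_regKernel hg hη x).fderiv]
    simp [hw]
  have hinner : ∀ i : Fin 3, Continuous fun x : E3 => ((inner ℝ x (e3 i) : ℝ) : ℂ) := fun i => by
    fun_prop
  have hI : ∀ {a b : E3 → ℂ}, Continuous a → Continuous b → HasCompactSupport b →
      Integrable (fun x => a x * b x) volume := fun ha hb hbs =>
    (ha.mul hb).integrable_of_hasCompactSupport hbs.mul_left
  have hpdc := fun i => (contDiff_pd hψ i).continuous
  have hpds := fun i => hasCompactSupport_pd hs i
  have hibp : ∀ i, ∫ x, k x * pd i (pd i ψ) x =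
      -∫ x, (((inner ℝ x (e3 i) : ℝ) : ℂ) * w x) * pd i ψ x := by
    intro i
    have := integral_mul_fderiv_eq_neg_fderiv_mul_of_integrable (μ := (volume : Measure E3))
      (f := k) (g := pd i ψ) (v := e3 i) ?_ ?_ ?_ ?_ ?_
    · simp only [hfd] at this
      exact this
    · simp only [hfd]
      exact hI ((hinner i).mul hwc) (hpdc i) (hpds i)
    · exact hI hkc (contDiff_pd (contDiff_pd hψ i) i).continuous
        (hasCompactSupport_pd (hpds i) i)
    · exact hI hkc (hpdc i) (hpds i)
    · exact fun x _ => (hasFDerivAt_regKernel hg hη x).differentiableAt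
    · exact fun x _ => (contDiff_pd hψ i).differentiable (by simp) x
  simp only [lap, Finset.mul_sum]
  rw [integral_finsetSum _ fun i _ => hI hkc (contDiff_pd (contDiff_pd hψ i) i).continuous
        (hasCompactSupport_pd (hpds i) i)]
  simp only [hibp]
  have hsum : ∀ i ∈ (Finset.univ : Finset (Fin 3)), Integrable
      (fun x => (((inner ℝ x (e3 i) : ℝ) : ℂ) * w x) * pd i ψ x) volume := fun i _ =>
    hI ((hinner i).mul hwc) (hpdc i) (hpds i)
  rw [Finset.sum_neg_distrib, ← integral_finsetSum _ hsum]
  congr 2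
  funext x
  rw [← sum_inner_mul_pd, Finset.mul_sum]
  exact Finset.sum_congr rfl fun i _ => by ring

theorem exists_bound_Icc {g : ℝ → ℂ} (hg : Continuous g) (R : ℝ) :
    ∃ M, ∀ r, 0 ≤ r → r ≤ R → ‖g r‖ ≤ M := by
  obtain ⟨M, hM⟩ := isCompact_Icc.exists_bound_of_continuousOn (s := Set.Icc 0 R) hg.continuousOn
  exact ⟨M, fun r h1 h2 => hM r ⟨h1, h2⟩⟩

/-- The distributional Laplacian of the radial kernel `g(|x|) / |x|`. -/
theorem integral_radial_mul_lap {g : ℝ → ℂ} (hg : ContDiff ℝ ((⊤ : ℕ∞) : WithTop ℕ∞) g)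
    {ψ : E3 → ℂ} (hψ : ContDiff ℝ ((⊤ : ℕ∞) : WithTop ℕ∞) ψ) (hs : HasCompactSupport ψ) :
    ∫ x : E3, g ‖x‖ / (‖x‖ : ℂ) * lap ψ x =
      -(4 * (Real.pi : ℂ) * (g 0 * ψ 0)) + ∫ x : E3, deriv (deriv g) ‖x‖ / (‖x‖ : ℂ) * ψ x := by
  have hg' : ContDiff ℝ ((⊤ : ℕ∞) : WithTop ℕ∞) (deriv g) := hg.deriv'
  have hg'' : ContDiff ℝ ((⊤ : ℕ∞) : WithTop ℕ∞) (deriv (deriv g)) := hg'.deriv'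
  obtain ⟨C, R, hC0, hR, hψC, hψR⟩ := exists_bound_ball hψ.continuous hs
  obtain ⟨C1, R1, hC10, hR1, hψC1, hψR1⟩ :=
    exists_bound_ball (contDiff_lap hψ).continuous (hasCompactSupport_lap hs)
  obtain ⟨C2, R2, hC20, hR2, hψC2, hψR2⟩ :=
    exists_bound_ball (hψ.continuous_fderiv (by simp)) (hs.fderiv ℝ)
  obtain ⟨M, hM⟩ := exists_bound_Icc hg.continuous (max R (max R1 R2) + 1)
  obtain ⟨M', hM'⟩ := exists_bound_Icc hg'.continuous (max R (max R1 R2) + 1)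
  obtain ⟨M'', hM''⟩ := exists_bound_Icc hg''.continuous (max R (max R1 R2) + 1)
  have hmeas1 : ∀ η, AEStronglyMeasurable
      (fun x : E3 => g (regNorm η x) / (regNorm η x : ℂ) * lap ψ x) volume := fun η => by
    have h0 := (continuous_regNorm η).measurable
    have h1 := hg.continuous.measurable
    have h2 := (contDiff_lap hψ).continuous.measurable
    exact (by fun_prop : Measurable _).aestronglyMeasurable
  have hfx : Continuous fun x : E3 => fderiv ℝ ψ x x :=
    (hψ.continuous_fderiv (by simp)).clm_apply continuous_id
  have hmeas2 : ∀ η, AEStronglyMeasurable (fun x : E3 => (deriv g (regNorm η x)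
      * (regNorm η x : ℂ) - g (regNorm η x)) / (regNorm η x : ℂ) ^ 3 * fderiv ℝ ψ x x)
      volume := fun η => by
    have h0 := (continuous_regNorm η).measurable
    have h1 := hg.continuous.measurable
    have h2 := hg'.continuous.measurable
    have h3 := hfx.measurable
    exact (by fun_prop : Measurable _).aestronglyMeasurable
  have hb1 : ∀ η, |η| ≤ 1 → ∀ x : E3, x ≠ 0 →
      ‖g (regNorm η x) / (regNorm η x : ℂ) * lap ψ x‖ ≤
        (Metric.ball (0 : E3) R1).indicator (fun x => M * C1 * (1 + (‖x‖⁻¹) ^ 2)) x := by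
    intro η hη x hx
    by_cases hxR : R1 ≤ ‖x‖
    · rw [hψR1 x hxR, Set.indicator_of_notMem (by simpa using hxR)]; simp
    · rw [Set.indicator_of_mem (by simpa using hxR), norm_mul, mul_right_comm]
      push Not at hxR
      have hx' := norm_pos_iff.2 hx
      have h1 := le_regNorm η x
      have h2 := regNorm_le hη x
      have h3 : ‖g (regNorm η x)‖ ≤ M := hM _ (hx'.le.trans h1) (by
        have := (le_max_left R1 R2).trans (le_max_right R _); linarith)
      gcongr
      · exact (norm_nonneg _).trans (norm_div_le_dominant hx' h1 h3)
      · exact norm_div_le_dominant hx' h1 h3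
      · exact hψC1 x
  have hb2 : ∀ η, |η| ≤ 1 → ∀ x : E3, x ≠ 0 →
      ‖(deriv g (regNorm η x) * (regNorm η x : ℂ) - g (regNorm η x)) / (regNorm η x : ℂ) ^ 3
        * fderiv ℝ ψ x x‖ ≤ (Metric.ball (0 : E3) R2).indicator
          (fun x => 2 * max M M' * C2 * (1 + (‖x‖⁻¹) ^ 2)) x := by
    intro η hη x hx
    by_cases hxR : R2 ≤ ‖x‖
    · rw [hψR2 x hxR, Set.indicator_of_notMem (by simpa using hxR)]; simp
    · rw [Set.indicator_of_mem (by simpa using hxR), norm_mul]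
      push Not at hxR
      have hx' := norm_pos_iff.2 hx
      have h1 := le_regNorm η x
      have h2 := regNorm_le hη x
      have h5 : regNorm η x ≤ max R (max R1 R2) + 1 := by
        have := (le_max_right R1 R2).trans (le_max_right R _); linarith
      have h3 : ‖g (regNorm η x)‖ ≤ max M M' :=
        (hM _ (hx'.le.trans h1) h5).trans (le_max_left _ _)
      have h4 : ‖deriv g (regNorm η x)‖ ≤ max M M' :=
        (hM' _ (hx'.le.trans h1) h5).trans (le_max_right _ _)
      have h6 : ‖fderiv ℝ ψ x x‖ ≤ C2 * ‖x‖ :=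
        ((fderiv ℝ ψ x).le_opNorm x).trans (by gcongr; exact hψC2 x)
      have h7 := norm_radialDeriv_le_dominant hx' h1 h3 h4
      calc _ ≤ ‖(deriv g (regNorm η x) * (regNorm η x : ℂ) - g (regNorm η x))
              / (regNorm η x : ℂ) ^ 3‖ * (C2 * ‖x‖) := by gcongr
        _ = ‖(deriv g (regNorm η x) * (regNorm η x : ℂ) - g (regNorm η x))
              / (regNorm η x : ℂ) ^ 3‖ * ‖x‖ * C2 := by ring
        _ ≤ 2 * max M M' * (1 + (‖x‖⁻¹) ^ 2) * C2 := by gcongr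
        _ = _ := by ring
  have h0 : ∀ᵐ x : E3, x ≠ 0 := by simp [ae_iff]
  have hη1 : ∀ n : ℕ, |1 / ((n : ℝ) + 1)| ≤ 1 := fun n => by
    rw [abs_of_pos (by positivity), div_le_one (by positivity)]
    linarith [n.cast_nonneg (α := ℝ)]
  have hlimη : Tendsto (fun n : ℕ => 1 / ((n : ℝ) + 1)) atTop (𝓝 0) :=
    tendsto_one_div_add_atTop_nhds_zero_nat
  have hreg : ∀ x : E3, Tendsto (fun n : ℕ => regNorm (1 / ((n : ℝ) + 1)) x) atTop (𝓝 ‖x‖) := by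
    intro x
    have := ((continuous_regNorm_left x).tendsto 0).comp hlimη
    rwa [regNorm_zero] at this
  -- Let η = 1/(n + 1) tend to 0 on both sides of the regularised identity; `hb1` and `hb2` dominate
  -- uniformly for |η| ≤ 1.
  have hL1 : Tendsto (fun n : ℕ => ∫ x : E3, g (regNorm (1 / ((n : ℝ) + 1)) x)
      / (regNorm (1 / ((n : ℝ) + 1)) x : ℂ) * lap ψ x) atTop
      (𝓝 (∫ x : E3, g ‖x‖ / (‖x‖ : ℂ) * lap ψ x)) := by
    refine tendsto_integral_of_dominated_convergence _ (fun n => hmeas1 _)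
      (integrable_dominant (M * C1) R1) (fun n => h0.mono fun x hx => hb1 _ (hη1 n) x hx)
      (h0.mono fun x hx => ?_)
    refine Tendsto.mul_const _ (Tendsto.div ((hg.continuous.tendsto _).comp (hreg x))
      ((Complex.continuous_ofReal.tendsto _).comp (hreg x)) ?_)
    exact_mod_cast norm_ne_zero_iff.2 hx
  have hL2 : Tendsto (fun n : ℕ => ∫ x : E3, (deriv g (regNorm (1 / ((n : ℝ) + 1)) x)
      * (regNorm (1 / ((n : ℝ) + 1)) x : ℂ) - g (regNorm (1 / ((n : ℝ) + 1)) x))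
      / (regNorm (1 / ((n : ℝ) + 1)) x : ℂ) ^ 3 * fderiv ℝ ψ x x) atTop
      (𝓝 (∫ x : E3, (deriv g ‖x‖ * (‖x‖ : ℂ) - g ‖x‖) / (‖x‖ : ℂ) ^ 3 * fderiv ℝ ψ x x)) := by
    refine tendsto_integral_of_dominated_convergence _ (fun n => hmeas2 _)
      (integrable_dominant (2 * max M M' * C2) R2)
      (fun n => h0.mono fun x hx => hb2 _ (hη1 n) x hx) (h0.mono fun x hx => ?_)
    have hc := (Complex.continuous_ofReal.tendsto _).comp (hreg x)
    refine Tendsto.mul_const _ (Tendsto.div ((((hg'.continuous.tendsto _).comp (hreg x)).mul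
      hc).sub ((hg.continuous.tendsto _).comp (hreg x))) (hc.pow 3) ?_)
    exact pow_ne_zero _ (by exact_mod_cast norm_ne_zero_iff.2 hx)
  have hE : ∫ x : E3, g ‖x‖ / (‖x‖ : ℂ) * lap ψ x =
      -∫ x : E3, (deriv g ‖x‖ * (‖x‖ : ℂ) - g ‖x‖) / (‖x‖ : ℂ) ^ 3 * fderiv ℝ ψ x x := by
    refine tendsto_nhds_unique hL1 (hL2.neg.congr fun n => ?_)
    rw [integral_regKernel_mul_lap hg hψ hs (by positivity)]
  have hi1 : Integrable (fun x : E3 => (deriv g ‖x‖ * (‖x‖ : ℂ) - g ‖x‖) / (‖x‖ : ℂ) ^ 3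
      * fderiv ℝ ψ x x) volume := by
    have hm := hmeas2 0
    have hb := hb2 0 (by simp)
    simp only [regNorm_zero] at hm hb
    exact (integrable_dominant (2 * max M M' * C2) R2).mono' hm (h0.mono hb)
  have hi2 : Integrable (fun x : E3 => deriv (deriv g) ‖x‖ / (‖x‖ : ℂ) * ψ x) volume := by
    refine integrable_of_le_dominant (C := M'' * C) (R := R) ?_ (fun x hx => ?_)
      (fun x hx => by rw [hψR x hx, mul_zero])
    · have h1 := hg''.continuous.measurable
      have h2 := hψ.continuous.measurable
      exact (by fun_prop : Measurable _).aestronglyMeasurable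
    · have hx' := norm_pos_iff.2 hx
      by_cases hxR : R ≤ ‖x‖
      · have hM0 : 0 ≤ M'' := (norm_nonneg _).trans (hM'' 0 le_rfl (by positivity))
        rw [hψR x hxR, mul_zero, norm_zero]
        positivity
      · push Not at hxR
        have h3 : ‖deriv (deriv g) ‖x‖‖ ≤ M'' := hM'' _ hx'.le (by
          have := le_max_left R (max R1 R2); linarith)
        rw [norm_mul, mul_right_comm]
        gcongr
        · exact (norm_nonneg _).trans (norm_div_le_dominant hx' le_rfl h3)
        · exact norm_div_le_dominant hx' le_rfl h3
        · exact hψC x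
  have hP := radial_polar hg hψ hs (hi1.add hi2)
  rw [integral_add hi1 hi2] at hP
  rw [hE, ← hP]
  ring

/-! ### L² control of all derivatives of order at most two by w and Δw -/

/-- A smooth complex-valued function with compact support on `ℝ³`. -/
structure IsBump (f : E3 → ℂ) : Prop where
  contDiff : ContDiff ℝ ∞ f
  hasCompactSupport : HasCompactSupport f

theorem IsBump.pd {f : E3 → ℂ} (hf : IsBump f) (i : Fin 3) : IsBump (pd i f) :=
  ⟨contDiff_pd hf.1 i, hasCompactSupport_pd hf.2 i⟩

theorem IsBump.lap {f : E3 → ℂ} (hf : IsBump f) : IsBump (lap f) :=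
  ⟨contDiff_lap hf.1, hasCompactSupport_lap hf.2⟩

theorem IsBump.conj {f : E3 → ℂ} (hf : IsBump f) : IsBump (fun x => star (f x)) :=
  ⟨Complex.conjCLE.contDiff.comp hf.1, HasCompactSupport.intro hf.2.isCompact fun x hx => by
    rw [image_eq_zero_of_notMem_tsupport hx, star_zero]⟩

theorem IsBump.memLp {f : E3 → ℂ} (hf : IsBump f) : MemLp f 2 volume :=
  hf.1.continuous.memLp_of_hasCompactSupport hf.2

theorem IsBump.add {f g : E3 → ℂ} (hf : IsBump f) (hg : IsBump g) :
    IsBump (fun x => f x + g x) :=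
  ⟨hf.1.add hg.1, hf.2.add hg.2⟩

theorem IsBump.const_mul {f : E3 → ℂ} (hf : IsBump f) (c : ℂ) : IsBump (fun x => c * f x) :=
  ⟨contDiff_const.mul hf.1, hf.2.mul_left⟩

theorem IsBump.differentiable {f : E3 → ℂ} (hf : IsBump f) : Differentiable ℝ f :=
  hf.1.differentiable (by simp)

theorem IsBump.integrable_mul {f g : E3 → ℂ} (hf : Continuous f) (hg : IsBump g) :
    Integrable (fun x => f x * g x) volume :=
  (hf.mul hg.1.continuous).integrable_of_hasCompactSupport hg.2.mul_left

theorem integral_mul_pd {f g : E3 → ℂ} (hf : ContDiff ℝ ∞ f) (hg : IsBump g) (i : Fin 3) :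
    ∫ x, f x * pd i g x = -∫ x, pd i f x * g x :=
  integral_mul_fderiv_eq_neg_fderiv_mul_of_integrable (μ := (volume : Measure E3)) (v := e3 i)
    (IsBump.integrable_mul (contDiff_pd hf i).continuous hg)
    (IsBump.integrable_mul hf.continuous (hg.pd i))
    (IsBump.integrable_mul hf.continuous hg)
    (fun x _ => hf.differentiable (by simp) x) (fun x _ => hg.differentiable x)

theorem pd_star {f : E3 → ℂ} (hf : Differentiable ℝ f) (i : Fin 3) :
    pd i (fun x => star (f x)) = fun x => star (pd i f x) := by
  funext x
  have h := (Complex.conjCLE.toContinuousLinearMap.hasFDerivAt (x := f x)).comp x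
    (hf x).hasFDerivAt
  have h' : HasFDerivAt (fun x => star (f x)) _ x := h
  rw [pd, h'.fderiv]
  rfl

theorem pd_comm {f : E3 → ℂ} (hf : ContDiff ℝ ∞ f) (i j : Fin 3) :
    pd i (pd j f) = pd j (pd i f) := by
  funext x
  have hs : IsSymmSndFDerivAt ℝ f x := hf.contDiffAt.isSymmSndFDerivAt (by
    rw [minSmoothness_of_isRCLikeNormedField]; exact WithTop.coe_le_coe.2 le_top)
  have h : ∀ a b : Fin 3, pd a (pd b f) x = fderiv ℝ (fderiv ℝ f) x (e3 a) (e3 b) := by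
    intro a b
    have hd : HasFDerivAt (fderiv ℝ f) (fderiv ℝ (fderiv ℝ f) x) x :=
      ((hf.fderiv_right (m := ∞) (by simp)).differentiable (by simp) x).hasFDerivAt
    have := hd.clm_apply (hasFDerivAt_const (e3 b) x)
    rw [pd]
    change fderiv ℝ (fun y => fderiv ℝ f y (e3 b)) x (e3 a) = _
    rw [this.fderiv]
    simp
  rw [h, h, hs.eq]

theorem integral_norm_sq_eq {f : E3 → ℂ} :
    ((∫ x, ‖f x‖ ^ 2 : ℝ) : ℂ) = ∫ x, star (f x) * f x := by
  rw [← integral_complex_ofReal]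
  refine integral_congr_ae (Eventually.of_forall fun x => ?_)
  simp only [Complex.star_def, Complex.conj_mul']
  push_cast
  rfl

theorem IsBump.integrable_norm_sq {f : E3 → ℂ} (hf : IsBump f) :
    Integrable (fun x => ‖f x‖ ^ 2) volume :=
  (memLp_two_iff_integrable_sq_norm hf.1.continuous.aestronglyMeasurable).1 hf.memLp

/-- After one integration by parts both sides are minus the integral of conj(∂ᵢ∂ᵢ∂ⱼw) ∂ⱼw, because
partial derivatives commute. -/
theorem integral_star_mul_pd_pd {w : E3 → ℂ} (hw : IsBump w) (i j : Fin 3) :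
    ∫ x, star (pd i (pd j w) x) * pd i (pd j w) x =
      ∫ x, star (pd i (pd i w) x) * pd j (pd j w) x := by
  have h1 := integral_mul_pd ((hw.pd j).pd i).conj.1 (hw.pd j) i
  have h2 := integral_mul_pd ((hw.pd i).pd i).conj.1 (hw.pd j) j
  rw [h1, h2]
  congr 2
  funext x
  rw [pd_star ((hw.pd j).pd i).differentiable, pd_star ((hw.pd i).pd i).differentiable]
  rw [pd_comm hw.1 i j, pd_comm (hw.pd i).1 i j]

/-- Summing the previous identity over i and j completes the square |Δw|². This is the elliptic
estimate behind the H² bound. -/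
theorem sum_integral_norm_pd_pd {w : E3 → ℂ} (hw : IsBump w) :
    ∑ i, ∑ j, ∫ x, ‖pd i (pd j w) x‖ ^ 2 = ∫ x, ‖lap w x‖ ^ 2 := by
  apply Complex.ofReal_injective
  push_cast
  simp only [integral_norm_sq_eq, integral_star_mul_pd_pd hw]
  have hI : ∀ i j, Integrable (fun x => star (pd i (pd i w) x) * pd j (pd j w) x) volume :=
    fun i j => IsBump.integrable_mul ((hw.pd i).pd i).conj.1.continuous ((hw.pd j).pd j)
  rw [Finset.sum_congr rfl fun i _ => (integral_finsetSum _ fun j _ => hI i j).symm,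
    ← integral_finsetSum _ fun i _ => integrable_finsetSum _ fun j _ => hI i j]
  refine integral_congr_ae (Eventually.of_forall fun x => ?_)
  simp only [lap, star_sum, Finset.sum_mul, Finset.mul_sum]
  exact Finset.sum_comm

theorem integral_norm_pd_pd_le {w : E3 → ℂ} (hw : IsBump w) (i j : Fin 3) :
    ∫ x, ‖pd i (pd j w) x‖ ^ 2 ≤ ∫ x, ‖lap w x‖ ^ 2 := by
  have h0 : ∀ i j, 0 ≤ ∫ x, ‖pd i (pd j w) x‖ ^ 2 := fun i j =>
    integral_nonneg fun x => sq_nonneg _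
  rw [← sum_integral_norm_pd_pd hw]
  refine (Finset.single_le_sum (f := fun j => ∫ x, ‖pd i (pd j w) x‖ ^ 2)
    (fun j _ => h0 i j) (Finset.mem_univ j)).trans ?_
  exact Finset.single_le_sum (f := fun i => ∑ j, ∫ x, ‖pd i (pd j w) x‖ ^ 2)
    (fun i _ => Finset.sum_nonneg fun j _ => h0 i j) (Finset.mem_univ i)

/-- Integration by parts turns ‖∂ᵢw‖² into -⟨∂ᵢ∂ᵢw, w⟩, and |xy| ≤ |x|² + |y|² splits the product.
-/
theorem integral_norm_pd_le {w : E3 → ℂ} (hw : IsBump w) (i : Fin 3) :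
    ∫ x, ‖pd i w x‖ ^ 2 ≤ (∫ x, ‖w x‖ ^ 2) + ∫ x, ‖lap w x‖ ^ 2 := by
  have h1 := integral_mul_pd (hw.pd i).conj.1 hw i
  rw [pd_star (hw.pd i).differentiable, ← integral_norm_sq_eq] at h1
  have h2 : ∫ x, ‖pd i w x‖ ^ 2 ≤ ‖∫ x, star (pd i (pd i w) x) * w x‖ := by
    have := congrArg norm h1
    rw [norm_neg, Complex.norm_real, Real.norm_of_nonneg (integral_nonneg fun x => sq_nonneg _)]
      at this
    exact this.le
  have h3 : ‖∫ x, star (pd i (pd i w) x) * w x‖ ≤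
      ∫ x, (‖w x‖ ^ 2 + ‖pd i (pd i w) x‖ ^ 2) := by
    refine norm_integral_le_of_norm_le
      (hw.integrable_norm_sq.add ((hw.pd i).pd i).integrable_norm_sq)
      (Eventually.of_forall fun x => ?_)
    rw [norm_mul, norm_star]
    nlinarith [sq_nonneg (‖pd i (pd i w) x‖ - ‖w x‖), sq_nonneg ‖w x‖,
      sq_nonneg ‖pd i (pd i w) x‖]
  rw [integral_add hw.integrable_norm_sq ((hw.pd i).pd i).integrable_norm_sq] at h3
  linarith [integral_norm_pd_pd_le hw i i]

/-! ### Convolution with radial kernels -/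

/-- Convolution `k * f` of functions on `ℝ³`. -/
def conv (k f : E3 → ℂ) (x : E3) : ℂ := ∫ t, k t * f (x - t)

theorem conv_eq (k f : E3 → ℂ) : conv k f = k ⋆[ContinuousLinearMap.mul ℝ ℂ, volume] f := rfl

theorem conv_eq_convInt {k f : E3 → ℂ} {D : Set E3}
    (hf : ∀ x, x ∉ D → f x = 0) (x : E3) : conv k f x = convInt D k f x := by
  rw [conv, ← integral_sub_left_eq_self _ volume x, convInt]
  simp only [sub_sub_cancel]
  rw [setIntegral_eq_integral_of_forall_compl_eq_zero fun y hy => by rw [hf y hy, mul_zero]]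

theorem isBump_conv {k f : E3 → ℂ} (hk : LocallyIntegrable k volume) (hks : HasCompactSupport k)
    (hf : IsBump f) : IsBump (conv k f) :=
  ⟨hf.2.contDiff_convolution_right (n := ⊤) (ContinuousLinearMap.mul ℝ ℂ) hk hf.1,
    HasCompactSupport.convolution (ContinuousLinearMap.mul ℝ ℂ) hks hf.2⟩

theorem pd_conv {k f : E3 → ℂ} (hk : LocallyIntegrable k volume) (hf : IsBump f) (i : Fin 3) :
    pd i (conv k f) = conv k (pd i f) := by
  funext x
  rw [pd, conv_eq, (hf.2.hasFDerivAt_convolution_right _ hk (hf.1.of_le (by simp)) x).fderiv,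
    convolution_precompR_apply _ hk (hf.2.fderiv ℝ) (hf.1.continuous_fderiv (by simp))]
  rfl

theorem integrable_conv {k f : E3 → ℂ} (hk : LocallyIntegrable k volume) (hf : IsBump f) (x : E3) :
    Integrable (fun t => k t * f (x - t)) volume :=
  hf.2.convolutionExists_right (ContinuousLinearMap.mul ℝ ℂ) hk hf.1.continuous x

theorem lap_conv {k f : E3 → ℂ} (hk : LocallyIntegrable k volume) (hf : IsBump f) :
    lap (conv k f) = conv k (lap f) := by
  funext x
  simp only [lap, pd_conv hk hf, pd_conv hk (hf.pd _)]
  simp only [conv]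
  rw [← integral_finsetSum _ fun i _ => integrable_conv hk ((hf.pd i).pd i) x]
  simp only [lap, Finset.mul_sum]

/-- The radial kernel `g(|x|) / |x|`. -/
def radialKernel (g : ℝ → ℂ) (x : E3) : ℂ := g ‖x‖ / (‖x‖ : ℂ)

theorem IsBump.comp_sub_left {f : E3 → ℂ} (hf : IsBump f) (x : E3) :
    IsBump (fun t => f (x - t)) :=
  ⟨hf.1.comp (contDiff_const.sub contDiff_id),
    hf.2.comp_homeomorph (Homeomorph.subLeft x)⟩

theorem pd_comp_sub_left {f : E3 → ℂ} (hf : Differentiable ℝ f) (x : E3) (i : Fin 3) :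
    pd i (fun t => f (x - t)) = fun t => -pd i f (x - t) := by
  funext t
  have h := ((hf (x - t)).hasFDerivAt).comp t ((hasFDerivAt_id t).const_sub x)
  have h' : HasFDerivAt (fun t => f (x - t)) _ t := h
  rw [pd, h'.fderiv]
  simp [pd]

theorem lap_comp_sub_left {f : E3 → ℂ} (hf : IsBump f) (x : E3) :
    lap (fun t => f (x - t)) = fun t => lap f (x - t) := by
  funext t
  simp only [lap]
  refine Finset.sum_congr rfl fun i _ => ?_
  rw [pd_comp_sub_left hf.differentiable]
  have h := pd_comp_sub_left (hf.pd i).differentiable x i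
  have h2 : pd i (fun t => -pd i f (x - t)) t = -pd i (fun t => pd i f (x - t)) t := by
    rw [pd, pd, fderiv_fun_neg]; rfl
  rw [h2, h]
  simp

/-- `Δ (k * f) = -4π g(0) f + m * f` for the radial kernels `k = g(|x|)/|x|`, `m = g''(|x|)/|x|`. -/
theorem conv_radialKernel_lap {g : ℝ → ℂ} (hg : ContDiff ℝ ∞ g) {f : E3 → ℂ} (hf : IsBump f)
    (x : E3) : conv (radialKernel g) (lap f) x =
      -(4 * (Real.pi : ℂ) * g 0) * f x + conv (radialKernel (deriv (deriv g))) f x := by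
  have h := integral_radial_mul_lap hg (hf.comp_sub_left x).1 (hf.comp_sub_left x).2
  rw [lap_comp_sub_left hf] at h
  simp only [conv, radialKernel]
  rw [h, sub_zero]
  ring

theorem measurable_radialKernel {g : ℝ → ℂ} (hg : Continuous g) : Measurable (radialKernel g) := by
  have := hg.measurable
  unfold radialKernel
  fun_prop

theorem radialKernel_trunc {g : ℝ → ℂ} (hg : Continuous g) (R : ℝ) :
    ∃ C, ∀ x : E3, ‖x‖ < R → ‖radialKernel g x‖ ≤ C * ‖invNormTrunc R x‖ := by
  obtain ⟨M, hM⟩ := exists_bound_Icc hg R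
  refine ⟨M, fun x hx => ?_⟩
  have hx' : x ∈ Metric.ball (0 : E3) R := by simpa using hx
  rw [radialKernel, norm_div, invNormTrunc, Set.indicator_of_mem hx', div_eq_mul_inv]
  simp only [Complex.norm_real, norm_inv, norm_norm]
  gcongr
  exact hM _ (norm_nonneg x) hx.le

theorem memLp_radialKernel {g : ℝ → ℂ} (hg : Continuous g) {R : ℝ} (hR : ∀ r, R ≤ r → g r = 0) :
    MemLp (radialKernel g) 2 volume := by
  obtain ⟨C, hC⟩ := radialKernel_trunc hg R
  refine MemLp.of_le_mul (c := C) (memLp_invNormTrunc R)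
    (measurable_radialKernel hg).aestronglyMeasurable (Eventually.of_forall fun x => ?_)
  by_cases hx : ‖x‖ < R
  · exact hC x hx
  · push Not at hx
    rw [radialKernel, hR _ hx, zero_div, norm_zero, invNormTrunc,
      Set.indicator_of_notMem (by simpa using hx), norm_zero, mul_zero]

theorem locallyIntegrable_radialKernel {g : ℝ → ℂ} (hg : Continuous g) :
    LocallyIntegrable (radialKernel g) volume := by
  refine (locallyIntegrable_iff (X := E3)).2 fun K hK => ?_
  obtain ⟨R, hR⟩ := hK.isBounded.subset_ball 0
  obtain ⟨C, hC⟩ := radialKernel_trunc hg R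
  have h1 : IntegrableOn (fun x => C * ‖invNormTrunc R x‖) (Metric.ball 0 R) volume := by
    refine Integrable.const_mul ?_ C
    have : IsFiniteMeasure ((volume : Measure E3).restrict (Metric.ball 0 R)) :=
      ⟨by simpa using (measure_ball_lt_top (μ := (volume : Measure E3)) (x := 0) (r := R))⟩
    exact (((memLp_invNormTrunc R).restrict (Metric.ball 0 R)).integrable (by norm_num)).norm
  refine IntegrableOn.mono_set ?_ hR
  refine h1.mono' (measurable_radialKernel hg).aestronglyMeasurable ?_
  filter_upwards [ae_restrict_mem Metric.isOpen_ball.measurableSet] with x hx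
  exact hC x (by simpa using hx)

theorem hasCompactSupport_radialKernel {g : ℝ → ℂ} {R : ℝ} (hR : ∀ r, R ≤ r → g r = 0) :
    HasCompactSupport (radialKernel g) := by
  refine HasCompactSupport.intro (isCompact_closedBall (0 : E3) R) fun x hx => ?_
  have : R < ‖x‖ := by simpa using hx
  rw [radialKernel, hR _ this.le, zero_div]

theorem conv_eq_zero_of_le {k f : E3 → ℂ} {r R : ℝ} (hk : ∀ x, R ≤ ‖x‖ → k x = 0)
    (hf : ∀ x, r ≤ ‖x‖ → f x = 0) {x : E3} (hx : r + R ≤ ‖x‖) : conv k f x = 0 := by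
  refine integral_eq_zero_of_ae (Eventually.of_forall fun t => ?_)
  by_cases ht : R ≤ ‖t‖
  · simp [hk t ht]
  · have : r ≤ ‖x - t‖ := by
      push Not at ht
      have := norm_le_norm_sub_add x t
      linarith
    simp [hf _ this]

/-- The convolution is bounded pointwise by Cauchy–Schwarz and vanishes outside the ball of radius r
+ R, so its L² norm costs only the volume of that ball. -/
theorem integral_norm_sq_conv_le {k f : E3 → ℂ} {r R : ℝ} (hkm : MemLp k 2 volume)
    (hk : ∀ x, R ≤ ‖x‖ → k x = 0) (hf : ∀ x, r ≤ ‖x‖ → f x = 0) (hfm : MemLp f 2 volume) :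
    ∫ x, ‖conv k f x‖ ^ 2 ≤ (volume.real (Metric.ball (0 : E3) (r + R))
      * (eLpNorm k 2 volume).toReal ^ 2) * ∫ x, ‖f x‖ ^ 2 := by
  have hf2 : ∫ x, ‖f x‖ ^ 2 = (eLpNorm f 2 volume).toReal ^ 2 := by
    have h := hfm.eLpNorm_eq_integral_rpow_norm (by norm_num) (by norm_num)
    rw [h, ENNReal.toReal_ofReal (by positivity)]
    rw [← Real.rpow_natCast, ← Real.rpow_mul (integral_nonneg fun x => by positivity)]
    simp
  have hb : ∀ x, ‖conv k f x‖ ≤ (eLpNorm k 2 volume).toReal * (eLpNorm f 2 volume).toReal := by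
    intro x
    rw [conv_eq_convInt (D := Set.univ) (fun x hx => absurd (Set.mem_univ x) hx)]
    have := norm_convInt_le (A := Set.univ) hkm (by simpa using hfm) x
    simpa using this
  rw [← setIntegral_eq_integral_of_forall_compl_eq_zero (s := Metric.ball (0 : E3) (r + R))
    fun x hx => by
      rw [conv_eq_zero_of_le hk hf (by simpa using hx)]; simp]
  have h := norm_setIntegral_le_of_norm_le_const (μ := (volume : Measure E3))
    (s := Metric.ball (0 : E3) (r + R)) (f := fun x => ‖conv k f x‖ ^ 2)
    (C := ((eLpNorm k 2 volume).toReal * (eLpNorm f 2 volume).toReal) ^ 2)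
    measure_ball_lt_top fun x _ => by
      rw [norm_pow, norm_norm]
      exact pow_le_pow_left₀ (norm_nonneg _) (hb x) 2
  refine ((Real.le_norm_self _).trans h).trans_eq ?_
  rw [hf2]; ring

/-! ### Volume potentials on L²(D) and their dependence on the wavenumber -/

theorem isFiniteMeasure_restrict_of_subset_ball {D : Set E3} {r : ℝ} (hD : D ⊆ Metric.ball 0 r) :
    IsFiniteMeasure ((volume : Measure E3).restrict D) :=
  ⟨by simpa using (measure_mono hD).trans_lt measure_ball_lt_top⟩

/-- The inclusion `L^∞(D) → L²(D)` for `D` of finite measure. -/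
def infToL2 (D : Set E3) [IsFiniteMeasure ((volume : Measure E3).restrict D)] :
    LInf D →L[ℂ] L2 D :=
  ((ContinuousLinearMap.mul ℂ ℂ).holderL (volume.restrict D) ⊤ 2 2).flip
    ((memLp_const (1 : ℂ)).toLp (fun _ => (1 : ℂ)))

theorem coeFn_infToL2 (D : Set E3) [IsFiniteMeasure ((volume : Measure E3).restrict D)]
    (v : LInf D) : infToL2 D v =ᵐ[volume.restrict D] v := by
  have h1 := (ContinuousLinearMap.mul ℂ ℂ).coeFn_holder (r := 2) v
    ((memLp_const (μ := (volume : Measure E3).restrict D) (p := 2) (1 : ℂ)).toLp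
      (fun _ => (1 : ℂ)))
  have h2 := (memLp_const (μ := (volume : Measure E3).restrict D) (p := 2) (1 : ℂ)).coeFn_toLp
  filter_upwards [h1, h2] with x h1 h2
  refine h1.trans ?_
  rw [h2]
  simp

/-- The truncated distance `min |z| R`. -/
def distTrunc (R : ℝ) : E3 →ᵇ ℂ :=
  BoundedContinuousFunction.ofNormedAddCommGroup (fun z => ((min ‖z‖ |R| : ℝ) : ℂ)) (by fun_prop)
    |R| (fun z => by
      rw [Complex.norm_real, Real.norm_of_nonneg (le_min (norm_nonneg z) (abs_nonneg R))]
      exact min_le_right _ _)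

theorem distTrunc_apply {R : ℝ} {z : E3} (hz : ‖z‖ ≤ R) : distTrunc R z = (‖z‖ : ℂ) := by
  have : min ‖z‖ |R| = ‖z‖ := min_eq_left (hz.trans (le_abs_self R))
  simp [distTrunc, this]

/-- Evaluation at z is a continuous ring homomorphism, so it commutes with the exponential series.
-/
theorem exp_apply (X : E3 →ᵇ ℂ) (z : E3) : NormedSpace.exp X z = Complex.exp (X z) := by
  let ev : (E3 →ᵇ ℂ) →+* ℂ :=
    { toFun := fun f => f z, map_one' := rfl, map_mul' := fun _ _ => rfl, map_zero' := rfl,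
      map_add' := fun _ _ => rfl }
  have hev : Continuous ev :=
    (BoundedContinuousFunction.lipschitz_eval_const z).continuous
  have := NormedSpace.map_exp_of_mem_ball (𝕂 := ℂ) ev hev X
    (by rw [NormedSpace.expSeries_radius_eq_top]; simp)
  rw [Complex.exp_eq_exp_ℂ]
  exact this

/-- The bounded factor `exp(i κ min(|z|, R)) / 4π` of the Green's function. -/
def expKernel (R : ℝ) (κ : ℂ) : E3 →ᵇ ℂ :=
  (4 * (Real.pi : ℂ))⁻¹ • NormedSpace.exp (κ • (Complex.I • distTrunc R))

theorem expKernel_apply {R : ℝ} {z : E3} (hz : ‖z‖ ≤ R) (κ : ℂ) :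
    expKernel R κ z = (4 * (Real.pi : ℂ))⁻¹ * Complex.exp (Complex.I * κ * (‖z‖ : ℂ)) := by
  rw [expKernel, BoundedContinuousFunction.smul_apply, exp_apply,
    BoundedContinuousFunction.smul_apply, BoundedContinuousFunction.smul_apply, distTrunc_apply hz]
  simp only [smul_eq_mul]
  congr 2
  ring

/-- The exponential is analytic on the Banach algebra of bounded continuous functions. As kernels
act linearly and boundedly, smoothness of the potentials in κ, in operator norm, follows from this
alone. -/
theorem contDiff_expKernel (R : ℝ) : ContDiff ℂ ∞ (expKernel R) := by
  have h : ContDiff ℂ ∞ (NormedSpace.exp : (E3 →ᵇ ℂ) → (E3 →ᵇ ℂ)) :=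
    contDiff_iff_contDiffAt.2 fun x => (NormedSpace.exp_analytic (𝕂 := ℂ) x).contDiffAt
  exact (h.comp (contDiff_id.smul contDiff_const)).const_smul _

/-- The volume potential `K_D^κ : L²(D) → L^∞(D)`, for `D ⊆ ball 0 r`. -/
def potInf (r : ℝ) (D : Set E3) (κ : ℂ) : L2 D →L[ℂ] LInf D :=
  singOp r D D (expKernel (2 * r) κ)

theorem expKernel_mul_eq_green {r : ℝ} {x y : E3} (hx : x ∈ Metric.ball (0 : E3) r)
    (hy : y ∈ Metric.ball (0 : E3) r) (κ : ℂ) :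
    expKernel (2 * r) κ (x - y) * (((‖x - y‖)⁻¹ : ℝ) : ℂ) = green κ (x - y) := by
  have h : ‖x - y‖ ≤ 2 * r := by
    rw [mem_ball_zero_iff] at hx hy
    linarith [norm_sub_le x y]
  rw [expKernel_apply h, green]
  push_cast
  rw [div_eq_mul_inv, mul_inv]
  ring

theorem coeFn_potInf {r : ℝ} {D : Set E3} (hDm : MeasurableSet D) (hD : D ⊆ Metric.ball 0 r)
    (κ : ℂ) (f : L2 D) : potInf r D κ f =ᵐ[volume.restrict D] volumePotential D κ f := by
  filter_upwards [coeFn_singOp hDm hDm hD hD (expKernel (2 * r) κ) f, ae_restrict_mem hDm]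
    with x hx hxD
  rw [potInf, hx, volumePotential]
  refine setIntegral_congr_fun hDm fun y hy => ?_
  rw [expKernel_mul_eq_green (hD hxD) (hD hy)]

theorem contDiff_potInf (r : ℝ) (D : Set E3) : ContDiff ℂ ∞ (potInf r D) :=
  (singOp r D D).contDiff.comp (contDiff_expKernel (2 * r))

/-- The volume potential `K_D^κ : L²(D) → L²(D)`. -/
def potL2 (r : ℝ) (D : Set E3) [IsFiniteMeasure ((volume : Measure E3).restrict D)] (κ : ℂ) :
    L2 D →L[ℂ] L2 D :=
  (infToL2 D).comp (potInf r D κ)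

theorem coeFn_potL2 {r : ℝ} {D : Set E3} [IsFiniteMeasure ((volume : Measure E3).restrict D)]
    (hDm : MeasurableSet D) (hD : D ⊆ Metric.ball 0 r) (κ : ℂ) (f : L2 D) :
    potL2 r D κ f =ᵐ[volume.restrict D] volumePotential D κ f :=
  (coeFn_infToL2 D _).trans (coeFn_potInf hDm hD κ f)

/-! ### The cut-off profile of the Green's function -/

/-- The cut-off radial profile `χ(s) exp(i κ s) / 4π`, with `χ = 1` on `[0, R]`. -/
def profile (χ : ContDiffBump (0 : ℝ)) (κ : ℂ) (s : ℝ) : ℂ :=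
  (4 * (Real.pi : ℂ))⁻¹ * ((χ s : ℂ) * Complex.exp (Complex.I * κ * (s : ℂ)))

theorem contDiff_ofReal' : ContDiff ℝ ∞ (fun s : ℝ => (s : ℂ)) := Complex.ofRealCLM.contDiff

theorem contDiff_profile (χ : ContDiffBump (0 : ℝ)) (κ : ℂ) : ContDiff ℝ ∞ (profile χ κ) := by
  have h1 : ContDiff ℝ ∞ fun s : ℝ => ((χ s : ℝ) : ℂ) := contDiff_ofReal'.comp χ.contDiff
  have h2 := contDiff_ofReal'
  have h3 : ContDiff ℝ ∞ fun s : ℝ => Complex.exp (Complex.I * κ * (s : ℂ)) :=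
    (contDiff_const.mul h2).cexp
  exact contDiff_const.mul (h1.mul h3)

theorem profile_of_le {χ : ContDiffBump (0 : ℝ)} {s : ℝ} (h0 : 0 ≤ s) (hs : s ≤ χ.rIn) (κ : ℂ) :
    profile χ κ s = (4 * (Real.pi : ℂ))⁻¹ * Complex.exp (Complex.I * κ * (s : ℂ)) := by
  rw [profile, χ.one_of_mem_closedBall (by simpa [abs_of_nonneg h0] using hs)]
  simp

/-- The normalisation that makes the singular part of the Laplacian of the kernel exactly minus the
Dirac mass. -/
theorem profile_zero (χ : ContDiffBump (0 : ℝ)) (κ : ℂ) :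
    4 * (Real.pi : ℂ) * profile χ κ 0 = 1 := by
  rw [profile_of_le le_rfl χ.rIn_pos.le]
  have : (Real.pi : ℂ) ≠ 0 := by exact_mod_cast Real.pi_ne_zero
  simp
  field_simp

theorem profile_eq_zero {χ : ContDiffBump (0 : ℝ)} {s : ℝ} (hs : χ.rOut ≤ s) (κ : ℂ) :
    profile χ κ s = 0 := by
  rw [profile, χ.zero_of_le_dist (by
    rw [dist_zero_right]; exact hs.trans (Real.le_norm_self s))]
  simp

theorem deriv_eq_zero_of_forall_le {g : ℝ → ℂ} (hg : ContDiff ℝ ∞ g) {R : ℝ}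
    (h : ∀ s, R ≤ s → g s = 0) : ∀ s, R ≤ s → deriv g s = 0 := by
  have hd : Set.EqOn (deriv g) 0 (Set.Ioi R) := by
    intro s hs
    have : g =ᶠ[𝓝 s] fun _ => 0 := by
      filter_upwards [Ioi_mem_nhds hs] with t ht using h t (le_of_lt ht)
    rw [this.deriv_eq]; simp
  have hc : Continuous (deriv g) := hg.continuous_deriv (by simp)
  intro s hs
  have := hd.closure hc continuous_const
  rw [closure_Ioi] at this
  exact this hs

/-! ### Test functions and their density in L²(D) -/

/-- Complex-valued test functions on `D`. -/
def testSpace (D : Set E3) : Submodule ℂ (E3 → ℂ) where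
  carrier := {f | IsBump f ∧ tsupport f ⊆ D}
  zero_mem' := ⟨⟨contDiff_const, HasCompactSupport.zero⟩, by simp [tsupport]⟩
  add_mem' := fun {f g} hf hg => ⟨hf.1.add hg.1,
    (tsupport_add f g).trans (Set.union_subset hf.2 hg.2)⟩
  smul_mem' := fun c f hf => ⟨hf.1.const_mul c,
    (closure_mono (Function.support_const_smul_subset c f)).trans hf.2⟩

/-- Inclusion of test functions into `L²(D)`. -/
def testToL2 (D : Set E3) : testSpace D →ₗ[ℂ] L2 D where
  toFun f := (f.2.1.memLp.restrict D).toLp f.1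
  map_add' f g := by rw [← MemLp.toLp_add]; rfl
  map_smul' c f := by rw [RingHom.id_apply, ← MemLp.toLp_const_smul]; rfl

theorem coeFn_testToL2 {D : Set E3} (f : testSpace D) :
    testToL2 D f =ᵐ[volume.restrict D] f.1 :=
  MemLp.coeFn_toLp (f.2.1.memLp.restrict D)

theorem IsTest.isBump {D : Set E3} {ψ : E3 → ℝ} (hψ : IsTest D ψ) :
    IsBump (fun x => (ψ x : ℂ)) :=
  ⟨Complex.ofRealCLM.contDiff.comp hψ.contDiff,
    hψ.hasCompactSupport.comp_left (g := fun t : ℝ => (t : ℂ)) (by simp)⟩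

theorem IsTest.mem_testSpace {D : Set E3} {ψ : E3 → ℝ} (hψ : IsTest D ψ) :
    (fun x => (ψ x : ℂ)) ∈ testSpace D := by
  refine ⟨hψ.isBump, (closure_mono fun x hx => ?_).trans hψ.tsupport_subset⟩
  simpa using hx

/-- A locally integrable function that annihilates all test functions vanishes. -/
theorem ae_eq_zero_of_forall_test {D : Set E3} (hDo : IsOpen D) {f : E3 → ℂ}
    (hf : LocallyIntegrableOn f D volume)
    (h : ∀ ψ : E3 → ℝ, IsTest D ψ → ∫ x in D, f x * (ψ x : ℂ) = 0) :
    f =ᵐ[volume.restrict D] 0 := by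
  refine (ae_restrict_iff' hDo.measurableSet).2 ?_
  refine hDo.ae_eq_zero_of_integral_contDiff_smul_eq_zero hf fun ψ h1 h2 h3 => ?_
  rw [← h ψ ⟨h1, h2, h3⟩, setIntegral_eq_integral_of_forall_compl_eq_zero]
  · refine integral_congr_ae (Eventually.of_forall fun x => ?_)
    simp only [Complex.real_smul, mul_comm]
  · intro x hx
    rw [image_eq_zero_of_notMem_tsupport fun hx' => hx (h3 hx')]
    simp

theorem locallyIntegrableOn_of_memLp {D : Set E3} {f : E3 → ℂ}
    (hf : MemLp f 2 (volume.restrict D)) : LocallyIntegrableOn f D volume :=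
  locallyIntegrableOn_of_locallyIntegrable_restrict (hf.locallyIntegrable (by norm_num))

theorem denseRange_testToL2 {D : Set E3} (hDo : IsOpen D) : DenseRange (testToL2 D) := by
  have h : (LinearMap.range (testToL2 D)).topologicalClosure = ⊤ := by
    rw [Submodule.topologicalClosure_eq_top_iff, Submodule.eq_bot_iff]
    intro g hg
    have hz : (g : E3 → ℂ) =ᵐ[volume.restrict D] 0 := by
      refine ae_eq_zero_of_forall_test hDo (locallyIntegrableOn_of_memLp (Lp.memLp g))
        fun ψ hψ => ?_
      have h1 := (Submodule.mem_orthogonal _ _).1 hg _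
        (LinearMap.mem_range_self (testToL2 D) ⟨_, hψ.mem_testSpace⟩)
      rw [L2.inner_def] at h1
      rw [← h1]
      refine integral_congr_ae ?_
      filter_upwards [coeFn_testToL2 ⟨_, hψ.mem_testSpace⟩] with x hx
      rw [hx]
      simp
    exact (Lp.eq_zero_iff_ae_eq_zero).2 hz
  have := (Submodule.dense_iff_topologicalClosure_eq_top).2 h
  rwa [LinearMap.coe_range] at this

/-! ### Jets of cut-off potentials and the H² bound for the Newtonian potential -/

/-- The partial derivatives of order at most two of a function. -/
def jet (w : E3 → ℂ) : JetIndex → E3 → ℂ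
  | Sum.inl _ => w
  | Sum.inr (Sum.inl i) => pd i w
  | Sum.inr (Sum.inr ij) => pd ij.2 (pd ij.1 w)

theorem IsBump.jet {w : E3 → ℂ} (hw : IsBump w) : ∀ a, IsBump (jet w a)
  | Sum.inl _ => hw
  | Sum.inr (Sum.inl i) => hw.pd i
  | Sum.inr (Sum.inr ij) => (hw.pd ij.1).pd ij.2

theorem pd_add {f g : E3 → ℂ} (hf : IsBump f) (hg : IsBump g) (i : Fin 3) :
    pd i (f + g) = pd i f + pd i g := by
  funext x
  rw [pd, fderiv_add (hf.differentiable x) (hg.differentiable x)]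
  rfl

theorem pd_smul {f : E3 → ℂ} (hf : IsBump f) (c : ℂ) (i : Fin 3) :
    pd i (c • f) = c • pd i f := by
  funext x
  rw [pd, fderiv_const_smul (hf.differentiable x) c]
  rfl

theorem jet_add {f g : E3 → ℂ} (hf : IsBump f) (hg : IsBump g) :
    ∀ a, jet (f + g) a = jet f a + jet g a
  | Sum.inl _ => rfl
  | Sum.inr (Sum.inl i) => pd_add hf hg i
  | Sum.inr (Sum.inr ij) => by
    simp only [jet, pd_add hf hg, pd_add (hf.pd _) (hg.pd _)]

theorem jet_smul {f : E3 → ℂ} (hf : IsBump f) (c : ℂ) : ∀ a, jet (c • f) a = c • jet f a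
  | Sum.inl _ => rfl
  | Sum.inr (Sum.inl i) => pd_smul hf c i
  | Sum.inr (Sum.inr ij) => by
    simp only [jet, pd_smul hf, pd_smul (hf.pd _)]

theorem integral_norm_jet_le {w : E3 → ℂ} (hw : IsBump w) (a : JetIndex) :
    ∫ x, ‖jet w a x‖ ^ 2 ≤ (∫ x, ‖w x‖ ^ 2) + ∫ x, ‖lap w x‖ ^ 2 := by
  have h1 : 0 ≤ ∫ x, ‖w x‖ ^ 2 := integral_nonneg fun x => sq_nonneg _
  have h2 : 0 ≤ ∫ x, ‖lap w x‖ ^ 2 := integral_nonneg fun x => sq_nonneg _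
  match a with
  | Sum.inl _ => simp only [jet]; linarith
  | Sum.inr (Sum.inl i) => exact integral_norm_pd_le hw i
  | Sum.inr (Sum.inr ij) =>
    have := integral_norm_pd_pd_le hw ij.2 ij.1
    simp only [jet]; linarith

theorem norm_toLp_sq {D : Set E3} {f : E3 → ℂ} (hf : MemLp f 2 (volume.restrict D)) :
    ‖hf.toLp f‖ ^ 2 = ∫ x in D, ‖f x‖ ^ 2 := by
  rw [Lp.norm_toLp, hf.eLpNorm_eq_integral_rpow_norm (by norm_num) (by norm_num),
    ENNReal.toReal_ofReal (by positivity), ← Real.rpow_natCast,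
    ← Real.rpow_mul (integral_nonneg fun x => by positivity)]
  simp

theorem conv_add {k f g : E3 → ℂ} (hk : LocallyIntegrable k volume) (hf : IsBump f)
    (hg : IsBump g) : conv k (f + g) = conv k f + conv k g := by
  funext x
  rw [Pi.add_apply, conv, conv, conv,
    ← integral_add (integrable_conv hk hf x) (integrable_conv hk hg x)]
  simp only [Pi.add_apply, mul_add]

theorem conv_smul (k f : E3 → ℂ) (c : ℂ) : conv k (c • f) = c • conv k f := by
  funext x
  rw [Pi.smul_apply, conv, conv, ← integral_smul]
  simp only [Pi.smul_apply, smul_eq_mul, mul_left_comm]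

theorem contDiff_deriv_deriv_profile (χ : ContDiffBump (0 : ℝ)) (κ : ℂ) :
    ContDiff ℝ ∞ (deriv (deriv (profile χ κ))) := by
  have h : ContDiff ℝ ∞ (deriv (profile χ κ)) := (contDiff_profile χ κ).deriv'
  exact h.deriv'

/-- The cut-off Green's function. -/
def cutGreen (χ : ContDiffBump (0 : ℝ)) (κ : ℂ) : E3 → ℂ := radialKernel (profile χ κ)

/-- The regular part of the Laplacian of the cut-off Green's function. -/
def cutRemainder (χ : ContDiffBump (0 : ℝ)) (κ : ℂ) : E3 → ℂ :=
  radialKernel (deriv (deriv (profile χ κ)))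

theorem locallyIntegrable_cutGreen (χ : ContDiffBump (0 : ℝ)) (κ : ℂ) :
    LocallyIntegrable (cutGreen χ κ) volume :=
  locallyIntegrable_radialKernel (contDiff_profile χ κ).continuous

theorem isBump_conv_cutGreen (χ : ContDiffBump (0 : ℝ)) (κ : ℂ) {f : E3 → ℂ} (hf : IsBump f) :
    IsBump (conv (cutGreen χ κ) f) :=
  isBump_conv (locallyIntegrable_cutGreen χ κ)
    (hasCompactSupport_radialKernel fun _ hs => profile_eq_zero hs κ) hf

theorem lap_conv_cutGreen (χ : ContDiffBump (0 : ℝ)) (κ : ℂ) {f : E3 → ℂ} (hf : IsBump f)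
    (x : E3) : lap (conv (cutGreen χ κ) f) x = -f x + conv (cutRemainder χ κ) f x := by
  rw [lap_conv (locallyIntegrable_cutGreen χ κ) hf, cutGreen,
    conv_radialKernel_lap (contDiff_profile χ κ) hf, profile_zero, neg_one_mul]
  rfl

theorem cutGreen_eq_zero {χ : ContDiffBump (0 : ℝ)} {x : E3} (hx : χ.rOut ≤ ‖x‖) (κ : ℂ) :
    cutGreen χ κ x = 0 := by
  rw [cutGreen, radialKernel, profile_eq_zero hx, zero_div]

theorem deriv_deriv_profile_eq_zero {χ : ContDiffBump (0 : ℝ)} {s : ℝ} (hs : χ.rOut ≤ s) (κ : ℂ) :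
    deriv (deriv (profile χ κ)) s = 0 :=
  deriv_eq_zero_of_forall_le (contDiff_profile χ κ).deriv'
    (deriv_eq_zero_of_forall_le (contDiff_profile χ κ) fun _ h => profile_eq_zero h κ) s hs

theorem cutRemainder_eq_zero {χ : ContDiffBump (0 : ℝ)} {x : E3} (hx : χ.rOut ≤ ‖x‖) (κ : ℂ) :
    cutRemainder χ κ x = 0 := by
  rw [cutRemainder, radialKernel, deriv_deriv_profile_eq_zero hx, zero_div]

theorem memLp_cutGreen (χ : ContDiffBump (0 : ℝ)) (κ : ℂ) : MemLp (cutGreen χ κ) 2 volume :=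
  memLp_radialKernel (contDiff_profile χ κ).continuous fun _ h => profile_eq_zero h κ

theorem memLp_cutRemainder (χ : ContDiffBump (0 : ℝ)) (κ : ℂ) :
    MemLp (cutRemainder χ κ) 2 volume :=
  memLp_radialKernel (contDiff_deriv_deriv_profile χ κ).continuous
    fun _ h => deriv_deriv_profile_eq_zero h κ

theorem testSpace_eq_zero {D : Set E3} (f : testSpace D) {x : E3} (hx : x ∉ D) : f.1 x = 0 :=
  image_eq_zero_of_notMem_tsupport fun h => hx (f.2.2 h)

theorem testSpace_eq_zero_of_le {D : Set E3} {r : ℝ} (hD : D ⊆ Metric.ball 0 r) (f : testSpace D)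
    {x : E3} (hx : r ≤ ‖x‖) : f.1 x = 0 :=
  testSpace_eq_zero f fun h => absurd (mem_ball_zero_iff.1 (hD h)) (not_lt.2 hx)

theorem norm_testToL2_sq {D : Set E3} (f : testSpace D) :
    ‖testToL2 D f‖ ^ 2 = ∫ x, ‖f.1 x‖ ^ 2 := by
  have h := norm_toLp_sq (f.2.1.memLp.restrict D)
  rw [setIntegral_eq_integral_of_forall_compl_eq_zero fun x hx => by
    rw [testSpace_eq_zero f hx]; simp] at h
  exact h

/-- The cut-off potential w of f is smooth with compact support, so its jet is controlled by w and
Δw. Both are controlled by f, because Δw = -f + `cutRemainder` * f and the two kernels are square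
integrable. -/
theorem exists_bound_jet_conv {D : Set E3} {r : ℝ} (hD : D ⊆ Metric.ball 0 r)
    (χ : ContDiffBump (0 : ℝ)) (κ : ℂ) : ∃ C, 0 ≤ C ∧ ∀ (f : testSpace D) (a : JetIndex),
      ∫ x, ‖jet (conv (cutGreen χ κ) f.1) a x‖ ^ 2 ≤ C * ∫ x, ‖f.1 x‖ ^ 2 := by
  set C1 := volume.real (Metric.ball (0 : E3) (r + χ.rOut))
      * (eLpNorm (cutGreen χ κ) 2 volume).toReal ^ 2
  set C2 := volume.real (Metric.ball (0 : E3) (r + χ.rOut))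
      * (eLpNorm (cutRemainder χ κ) 2 volume).toReal ^ 2
  refine ⟨C1 + (2 + 2 * C2), by positivity, fun f a => ?_⟩
  have hf := f.2.1
  have h1 : ∫ x, ‖conv (cutGreen χ κ) f.1 x‖ ^ 2 ≤ C1 * ∫ x, ‖f.1 x‖ ^ 2 :=
    integral_norm_sq_conv_le (memLp_cutGreen χ κ) (fun x hx => cutGreen_eq_zero hx κ)
      (fun x hx => testSpace_eq_zero_of_le hD f hx) hf.memLp
  have h2 : ∫ x, ‖conv (cutRemainder χ κ) f.1 x‖ ^ 2 ≤ C2 * ∫ x, ‖f.1 x‖ ^ 2 :=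
    integral_norm_sq_conv_le (memLp_cutRemainder χ κ) (fun x hx => cutRemainder_eq_zero hx κ)
      (fun x hx => testSpace_eq_zero_of_le hD f hx) hf.memLp
  have hB : IsBump (conv (cutRemainder χ κ) f.1) :=
    isBump_conv (locallyIntegrable_radialKernel (contDiff_deriv_deriv_profile χ κ).continuous)
      (hasCompactSupport_radialKernel fun _ h => deriv_deriv_profile_eq_zero h κ) hf
  have h3 : ∫ x, ‖lap (conv (cutGreen χ κ) f.1) x‖ ^ 2 ≤
      ∫ x, (2 * ‖f.1 x‖ ^ 2 + 2 * ‖conv (cutRemainder χ κ) f.1 x‖ ^ 2) := by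
    refine integral_mono (isBump_conv_cutGreen χ κ hf).lap.integrable_norm_sq
      ((hf.integrable_norm_sq.const_mul 2).add (hB.integrable_norm_sq.const_mul 2)) fun x => ?_
    rw [lap_conv_cutGreen χ κ hf]
    have h := norm_add_le (-f.1 x) (conv (cutRemainder χ κ) f.1 x)
    rw [norm_neg] at h
    have h' := pow_le_pow_left₀ (norm_nonneg _) h 2
    nlinarith [sq_nonneg (‖f.1 x‖ - ‖conv (cutRemainder χ κ) f.1 x‖)]
  rw [integral_add (hf.integrable_norm_sq.const_mul 2) (hB.integrable_norm_sq.const_mul 2),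
    integral_const_mul, integral_const_mul] at h3
  have h4 := integral_norm_jet_le (isBump_conv_cutGreen χ κ hf) a
  calc _ ≤ _ := h4
    _ ≤ C1 * (∫ x, ‖f.1 x‖ ^ 2) + (2 * (∫ x, ‖f.1 x‖ ^ 2) + 2 * (C2 * ∫ x, ‖f.1 x‖ ^ 2)) := by
        linarith
    _ = _ := by ring

/-- The jet of the cut-off potential of a test function, as an element of `L²(D)`. -/
def jetOp (D : Set E3) (χ : ContDiffBump (0 : ℝ)) (κ : ℂ) (a : JetIndex) :
    testSpace D →ₗ[ℂ] L2 D where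
  toFun f := (((isBump_conv_cutGreen χ κ f.2.1).jet a).memLp.restrict D).toLp _
  map_add' f g := by
    rw [← MemLp.toLp_add]
    congr 1
    rw [Submodule.coe_add, conv_add (locallyIntegrable_cutGreen χ κ) f.2.1 g.2.1,
      jet_add (isBump_conv_cutGreen χ κ f.2.1) (isBump_conv_cutGreen χ κ g.2.1)]
  map_smul' c f := by
    rw [RingHom.id_apply, ← MemLp.toLp_const_smul]
    congr 1
    rw [Submodule.coe_smul, conv_smul, jet_smul (isBump_conv_cutGreen χ κ f.2.1)]

theorem coeFn_jetOp {D : Set E3} (χ : ContDiffBump (0 : ℝ)) (κ : ℂ) (a : JetIndex)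
    (f : testSpace D) :
    jetOp D χ κ a f =ᵐ[volume.restrict D] jet (conv (cutGreen χ κ) f.1) a :=
  MemLp.coeFn_toLp (((isBump_conv_cutGreen χ κ f.2.1).jet a).memLp.restrict D)

theorem exists_norm_jetOp_le {D : Set E3} {r : ℝ} (hD : D ⊆ Metric.ball 0 r)
    (χ : ContDiffBump (0 : ℝ)) (κ : ℂ) (a : JetIndex) :
    ∃ C, ∀ f : testSpace D, ‖jetOp D χ κ a f‖ ≤ C * ‖testToL2 D f‖ := by
  obtain ⟨C, hC, h⟩ := exists_bound_jet_conv hD χ κ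
  refine ⟨√C, fun f => ?_⟩
  refine (pow_le_pow_iff_left₀ (norm_nonneg _) (by positivity) two_ne_zero).1 ?_
  rw [mul_pow, Real.sq_sqrt hC, norm_testToL2_sq]
  have hb := (isBump_conv_cutGreen χ κ f.2.1).jet a
  refine (norm_toLp_sq (hb.memLp.restrict D)).trans_le (le_trans ?_ (h f a))
  exact setIntegral_le_integral hb.integrable_norm_sq (Eventually.of_forall fun x => sq_nonneg _)

/-- The pairing of `f ∈ L²(D)` with a fixed function in `L²(D)`. -/
def pairing {D : Set E3} {k : E3 → ℂ} (hk : MemLp k 2 (volume.restrict D)) : L2 D →L[ℂ] ℂ :=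
  ((ContinuousLinearMap.mul ℂ ℂ).lpPairing (volume.restrict D) 2 2).flip (hk.toLp k)

theorem pairing_apply {D : Set E3} {k : E3 → ℂ} (hk : MemLp k 2 (volume.restrict D)) (f : L2 D) :
    pairing hk f = ∫ x in D, f x * k x := by
  rw [pairing, ContinuousLinearMap.flip_apply, ContinuousLinearMap.lpPairing_eq_integral]
  refine integral_congr_ae ?_
  filter_upwards [hk.coeFn_toLp] with x hx
  rw [hx]; rfl

theorem isWeakDeriv_iff {D : Set E3} {i : Fin 3} {f g : L2 D} :
    IsWeakDeriv D i f g ↔ ∀ (ψ : E3 → ℝ) (hψ : IsTest D ψ),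
      pairing (hψ.memLp_fderiv (e3 i)) f = -pairing hψ.memLp g := by
  simp only [pairing_apply]; rfl

theorem isWeakDeriv_of_isBump {D : Set E3} {a : E3 → ℂ} (ha : IsBump a) (i : Fin 3) {f g : L2 D}
    (hf : f =ᵐ[volume.restrict D] a) (hg : g =ᵐ[volume.restrict D] pd i a) :
    IsWeakDeriv D i f g := by
  intro ψ hψ
  have hpd : ∀ x, pd i (fun x => (ψ x : ℂ)) x = ((fderiv ℝ ψ x (e3 i) : ℝ) : ℂ) := by
    intro x
    have h := (Complex.ofRealCLM.hasFDerivAt (x := ψ x)).comp x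
      ((hψ.contDiff.differentiable (by simp) x).hasFDerivAt)
    have h' : HasFDerivAt (fun x => (ψ x : ℂ)) _ x := h
    rw [pd, h'.fderiv]
    rfl
  have h1 : ∫ x in D, f x * ((fderiv ℝ ψ x (e3 i) : ℝ) : ℂ) =
      ∫ x in D, a x * pd i (fun x => (ψ x : ℂ)) x := by
    refine integral_congr_ae (hf.mono fun x hx => ?_)
    simp only [hx, hpd]
  have h2 : ∫ x in D, g x * (ψ x : ℂ) = ∫ x in D, pd i a x * (ψ x : ℂ) :=
    integral_congr_ae (hg.mono fun x hx => by simp only [hx])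
  have hz : ∀ x, x ∉ D → x ∉ tsupport ψ := fun x hx h => hx (hψ.tsupport_subset h)
  rw [h1, h2, setIntegral_eq_integral_of_forall_compl_eq_zero,
    setIntegral_eq_integral_of_forall_compl_eq_zero, integral_mul_pd ha.1 hψ.isBump i]
  · intro x hx
    rw [image_eq_zero_of_notMem_tsupport (hz x hx)]; simp
  · intro x hx
    rw [hpd, image_eq_zero_of_notMem_tsupport fun h => hz x hx (tsupport_fderiv_subset ℝ h)]
    simp

/-- The underlying `L²` function as a continuous linear map on `H²(D)`. -/
def toL2L (D : Set E3) : H2 D →L[ℂ] L2 D :=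
  (PiLp.proj 2 (fun _ : JetIndex => L2 D) (Sum.inl ())).comp (H2 D).subtypeL

/-- Assembling an operator into `H²(D)` from its components. -/
theorem exists_H2_of_components {D : Set E3} {V : Type*} [NormedAddCommGroup V] [NormedSpace ℂ V]
    (S : JetIndex → V →L[ℂ] L2 D)
    (h1 : ∀ f i, IsWeakDeriv D i (S (Sum.inl ()) f) (S (Sum.inr (Sum.inl i)) f))
    (h2 : ∀ f i j, IsWeakDeriv D j (S (Sum.inr (Sum.inl i)) f) (S (Sum.inr (Sum.inr (i, j))) f)) :
    ∃ E : V →L[ℂ] H2 D, ∀ f, toL2 (E f) = S (Sum.inl ()) f := by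
  let E0 : V →L[ℂ] PiLp 2 (fun _ : JetIndex => L2 D) :=
    ((PiLp.continuousLinearEquiv 2 ℂ (fun _ : JetIndex => L2 D)).symm :
      (JetIndex → L2 D) →L[ℂ] PiLp 2 (fun _ : JetIndex => L2 D)).comp (ContinuousLinearMap.pi S)
  exact ⟨E0.codRestrict (H2 D) fun f => ⟨fun i => h1 f i, fun i j => h2 f i j⟩, fun f => rfl⟩

/-- For fixed ψ the defining relation equates two continuous functionals of f, so it passes from the
dense test functions to L²(D). -/
theorem isWeakDeriv_of_dense {D : Set E3} (hDo : IsOpen D) {S T : L2 D →L[ℂ] L2 D} {i : Fin 3}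
    (h : ∀ f : testSpace D, IsWeakDeriv D i (S (testToL2 D f)) (T (testToL2 D f))) (f : L2 D) :
    IsWeakDeriv D i (S f) (T f) := by
  rw [isWeakDeriv_iff]
  intro ψ hψ
  have := (denseRange_testToL2 hDo).equalizer
    (g := fun f => pairing (hψ.memLp_fderiv (e3 i)) (S f)) (h := fun f => -pairing hψ.memLp (T f))
    (by fun_prop) (by fun_prop) (funext fun f => isWeakDeriv_iff.1 (h f) ψ hψ)
  exact congrFun this f

/-- For x, y ∈ D only distances |x - y| ≤ 2r occur, and there the cut-off is 1. -/
theorem conv_cutGreen_eq {D : Set E3} {r : ℝ} (hDm : MeasurableSet D) (hD : D ⊆ Metric.ball 0 r)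
    {χ : ContDiffBump (0 : ℝ)} (hχ : 2 * r ≤ χ.rIn) (κ : ℂ) (f : testSpace D) {x : E3}
    (hx : x ∈ D) : conv (cutGreen χ κ) f.1 x = volumePotential D κ f.1 x := by
  rw [conv_eq_convInt (fun y hy => testSpace_eq_zero f hy), convInt, volumePotential]
  refine setIntegral_congr_fun hDm fun y hy => ?_
  have h1 := mem_ball_zero_iff.1 (hD hx)
  have h2 := mem_ball_zero_iff.1 (hD hy)
  have h3 := norm_sub_le x y
  simp only [cutGreen, radialKernel, profile_of_le (norm_nonneg (x - y)) (by linarith), green]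
  rw [← div_div, div_eq_mul_inv (Complex.exp _) (4 * (Real.pi : ℂ)),
    mul_comm (Complex.exp _)]

theorem volumePotential_congr {D : Set E3} {κ : ℂ} {f g : E3 → ℂ}
    (h : f =ᵐ[volume.restrict D] g) : volumePotential D κ f = volumePotential D κ g := by
  funext x
  exact integral_congr_ae (h.mono fun y hy => by simp only [hy])

/-- A radial cut-off which equals one on `[-R, R]`. -/
theorem exists_bump (R : ℝ) : ∃ χ : ContDiffBump (0 : ℝ), R ≤ χ.rIn :=
  ⟨⟨max R 1, max R 1 + 1, by positivity, by linarith⟩, le_max_left _ _⟩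

/-- The Newtonian potential maps `L²(D)` boundedly into `H²(D)`. -/
theorem exists_newtonian_H2 {D : Set E3} {r : ℝ} (hDo : IsOpen D) (hD : D ⊆ Metric.ball 0 r)
    [IsFiniteMeasure ((volume : Measure E3).restrict D)] :
    ∃ E : L2 D →L[ℂ] H2 D, ∀ f, toL2 (E f) = potL2 r D 0 f := by
  obtain ⟨χ, hχ⟩ := exists_bump (2 * r)
  -- Each component of the jet is bounded in the L² norm of the source, hence extends by density to
  -- all of L²(D).
  set S : JetIndex → L2 D →L[ℂ] L2 D := fun a => (jetOp D χ 0 a).extendOfNorm (testToL2 D) with hS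
  have hSe : ∀ a f, S a (testToL2 D f) = jetOp D χ 0 a f := fun a f =>
    LinearMap.extendOfNorm_eq (denseRange_testToL2 hDo) (exists_norm_jetOp_le hD χ 0 a) f
  obtain ⟨E, hE⟩ := exists_H2_of_components S
    (fun f i => isWeakDeriv_of_dense hDo (fun f => by
      rw [hSe, hSe]
      exact isWeakDeriv_of_isBump (isBump_conv_cutGreen χ 0 f.2.1) i
        (coeFn_jetOp χ 0 _ f) (coeFn_jetOp χ 0 _ f)) f)
    (fun f i j => isWeakDeriv_of_dense hDo (fun f => by
      rw [hSe, hSe]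
      exact isWeakDeriv_of_isBump ((isBump_conv_cutGreen χ 0 f.2.1).pd i) j
        (coeFn_jetOp χ 0 _ f) (coeFn_jetOp χ 0 _ f)) f)
  refine ⟨E, fun f => ?_⟩
  rw [hE]
  refine congrFun ((denseRange_testToL2 hDo).equalizer (g := fun f => S (Sum.inl ()) f)
    (h := fun f => potL2 r D 0 f) (by fun_prop) (by fun_prop) (funext fun f => ?_)) f
  simp only [Function.comp_apply, hSe]
  refine Lp.ext ?_
  filter_upwards [coeFn_jetOp χ 0 (Sum.inl ()) f, coeFn_potL2 hDo.measurableSet hD 0 (testToL2 D f),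
    ae_restrict_mem hDo.measurableSet] with x h1 h2 hx
  rw [h1, h2, volumePotential_congr (coeFn_testToL2 f)]
  exact conv_cutGreen_eq hDo.measurableSet hD hχ 0 f hx

/-! ### From the Newtonian potential to all wavenumbers in H²(D) -/

/-- Restriction `L²(B) → L²(D)` for `D ⊆ B`. -/
def restrL2 {D B : Set E3} (h : D ⊆ B) : L2 B →L[ℂ] L2 D :=
  LinearMap.mkContinuous
    { toFun := fun f => ((Lp.memLp f).mono_measure (Measure.restrict_mono h le_rfl)).toLp f
      map_add' := fun f g => by
        rw [← MemLp.toLp_add]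
        exact MemLp.toLp_congr _ _
          (ae_mono (Measure.restrict_mono h le_rfl) (Lp.coeFn_add f g))
      map_smul' := fun c f => by
        rw [RingHom.id_apply, ← MemLp.toLp_const_smul]
        exact MemLp.toLp_congr _ _
          (ae_mono (Measure.restrict_mono h le_rfl) (Lp.coeFn_smul c f)) } 1
    (fun f => by
      rw [one_mul, LinearMap.coe_mk, AddHom.coe_mk, Lp.norm_toLp, Lp.norm_def]
      exact ENNReal.toReal_mono (Lp.memLp f).eLpNorm_ne_top
        (eLpNorm_mono_measure _ (Measure.restrict_mono h le_rfl)))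

theorem coeFn_restrL2 {D B : Set E3} (h : D ⊆ B) (f : L2 B) :
    restrL2 h f =ᵐ[volume.restrict D] f :=
  MemLp.coeFn_toLp ((Lp.memLp f).mono_measure (Measure.restrict_mono h le_rfl))

theorem isWeakDeriv_restrL2 {D B : Set E3} (h : D ⊆ B) {i : Fin 3}
    {f g : L2 B} (hfg : IsWeakDeriv B i f g) : IsWeakDeriv D i (restrL2 h f) (restrL2 h g) := by
  intro ψ hψ
  have hψB : IsTest B ψ := ⟨hψ.1, hψ.2, hψ.3.trans h⟩
  have key : ∀ (u : L2 B) (k : E3 → ℂ), (∀ x, x ∉ D → k x = 0) →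
      ∫ x in D, restrL2 h u x * k x = ∫ x in B, u x * k x := by
    intro u k hk
    have h1 : ∫ x in D, restrL2 h u x * k x = ∫ x in D, u x * k x :=
      integral_congr_ae ((coeFn_restrL2 h u).mono fun x hx => by simp only [hx])
    rw [h1, setIntegral_eq_integral_of_forall_compl_eq_zero,
      setIntegral_eq_integral_of_forall_compl_eq_zero]
    · intro x hx
      rw [hk x fun hxD => hx (h hxD), mul_zero]
    · intro x hx
      rw [hk x hx, mul_zero]
  have hz : ∀ x, x ∉ D → x ∉ tsupport ψ := fun x hx hx' => hx (hψ.tsupport_subset hx')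
  rw [key f _ fun x hx => by
      rw [image_eq_zero_of_notMem_tsupport fun h => hz x hx (tsupport_fderiv_subset ℝ h)]; simp,
    key g _ fun x hx => by rw [image_eq_zero_of_notMem_tsupport (hz x hx)]; simp]
  exact hfg ψ hψB

/-- Restriction `H²(B) → H²(D)` for `D ⊆ B`. -/
theorem exists_restrH2 {D B : Set E3} (h : D ⊆ B) :
    ∃ R : H2 B →L[ℂ] H2 D, ∀ u, toL2 (R u) = restrL2 h (toL2 u) :=
  exists_H2_of_components
    (fun a => (restrL2 h).comp ((PiLp.proj 2 (fun _ : JetIndex => L2 B) a).comp (H2 B).subtypeL))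
    (fun u i => isWeakDeriv_restrL2 h (u.2.1 i))
    (fun u i j => isWeakDeriv_restrL2 h (u.2.2 i j))

theorem memLp_indicator_L2 {D B : Set E3} (hDm : MeasurableSet D) (f : L2 D) :
    MemLp (D.indicator f) 2 (volume.restrict B) :=
  ((memLp_indicator_iff_restrict hDm).2 (Lp.memLp f)).restrict B

/-- Extension by zero `L²(D) → L²(B)`. -/
def extendZero {D : Set E3} (hDm : MeasurableSet D) (B : Set E3) : L2 D →L[ℂ] L2 B :=
  LinearMap.mkContinuous
    { toFun := fun f => (memLp_indicator_L2 hDm f).toLp _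
      map_add' := fun f g => by
        rw [← MemLp.toLp_add]
        refine MemLp.toLp_congr _ _ (ae_restrict_of_ae ?_)
        filter_upwards [(ae_restrict_iff' hDm).1 (Lp.coeFn_add f g)] with x hx
        by_cases hxD : x ∈ D
        · rw [Set.indicator_of_mem hxD, hx hxD]; simp [hxD]
        · simp [hxD]
      map_smul' := fun c f => by
        rw [RingHom.id_apply, ← MemLp.toLp_const_smul]
        refine MemLp.toLp_congr _ _ (ae_restrict_of_ae ?_)
        filter_upwards [(ae_restrict_iff' hDm).1 (Lp.coeFn_smul c f)] with x hx
        by_cases hxD : x ∈ D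
        · rw [Set.indicator_of_mem hxD, hx hxD]; simp [hxD]
        · simp [hxD] } 1
    (fun f => by
      rw [one_mul, LinearMap.coe_mk, AddHom.coe_mk, Lp.norm_toLp, Lp.norm_def]
      refine ENNReal.toReal_mono (Lp.memLp f).eLpNorm_ne_top ?_
      refine (eLpNorm_mono_measure _ Measure.restrict_le_self).trans_eq ?_
      exact eLpNorm_indicator_eq_eLpNorm_restrict hDm)

theorem coeFn_extendZero {D : Set E3} (hDm : MeasurableSet D) (B : Set E3) (f : L2 D) :
    extendZero hDm B f =ᵐ[volume.restrict B] D.indicator f :=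
  MemLp.coeFn_toLp (memLp_indicator_L2 hDm f)

/-- A continuous compactly supported function of the norm, as a bounded continuous function. -/
def radialBCF (g : ℝ → ℝ) (hg : Continuous g) (hs : HasCompactSupport g) : E3 →ᵇ ℂ :=
  BoundedContinuousFunction.ofNormedAddCommGroup (fun z : E3 => ((g ‖z‖ : ℝ) : ℂ)) (by fun_prop)
    (Classical.choose (hg.bounded_above_of_compact_support hs))
    (fun z => by
      rw [Complex.norm_real]
      exact Classical.choose_spec (hg.bounded_above_of_compact_support hs) ‖z‖)

theorem contDiff_deriv_bump (χ : ContDiffBump (0 : ℝ)) : ContDiff ℝ ∞ (deriv χ) := by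
  have h : ContDiff ℝ ∞ χ := χ.contDiff
  exact h.deriv'

theorem contDiff_deriv_deriv_bump (χ : ContDiffBump (0 : ℝ)) :
    ContDiff ℝ ∞ (deriv (deriv χ)) := by
  exact (contDiff_deriv_bump χ).deriv'

/-- Separates the dependence on κ: a quadratic polynomial in κ with fixed radial coefficients, times
the exponential factor already known to be smooth in κ. -/
theorem deriv_deriv_profile (χ : ContDiffBump (0 : ℝ)) (κ : ℂ) (s : ℝ) :
    deriv (deriv (profile χ κ)) s = (4 * (Real.pi : ℂ))⁻¹ *
      (((deriv (deriv χ) s : ℝ) : ℂ) + 2 * (Complex.I * κ) * ((deriv χ s : ℝ) : ℂ)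
        + (Complex.I * κ) ^ 2 * ((χ s : ℝ) : ℂ)) * Complex.exp (Complex.I * κ * (s : ℂ)) := by
  have hexp : ∀ s : ℝ, HasDerivAt (fun s : ℝ => Complex.exp (Complex.I * κ * (s : ℂ)))
      (Complex.exp (Complex.I * κ * (s : ℂ)) * (Complex.I * κ)) s := by
    intro s
    have h1 : HasDerivAt (fun s : ℝ => Complex.I * κ * (s : ℂ)) (Complex.I * κ) s := by
      simpa using ((hasDerivAt_id s).ofReal_comp).const_mul (Complex.I * κ)
    exact h1.cexp
  have hc : ContDiff ℝ ∞ χ := χ.contDiff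
  have hχ0 : ∀ s : ℝ, HasDerivAt (fun s : ℝ => ((χ s : ℝ) : ℂ)) ((deriv χ s : ℝ) : ℂ) s :=
    fun s => ((hc.differentiable (by simp) s).hasDerivAt).ofReal_comp
  have hχ1 : ∀ s : ℝ, HasDerivAt (fun s : ℝ => ((deriv χ s : ℝ) : ℂ))
      ((deriv (deriv χ) s : ℝ) : ℂ) s :=
    fun s => (((contDiff_deriv_bump χ).differentiable (by simp) s).hasDerivAt).ofReal_comp
  have h1 : deriv (profile χ κ) = fun s => (4 * (Real.pi : ℂ))⁻¹ *
      (((deriv χ s : ℝ) : ℂ) * Complex.exp (Complex.I * κ * (s : ℂ)) +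
        ((χ s : ℝ) : ℂ) * (Complex.exp (Complex.I * κ * (s : ℂ)) * (Complex.I * κ))) := by
    funext s
    exact (((hχ0 s).mul (hexp s)).const_mul _).deriv
  rw [h1]
  have h2 := (((hχ1 s).mul (hexp s)).add ((hχ0 s).mul ((hexp s).mul_const (Complex.I * κ))))
  refine ((h2.const_mul (4 * (Real.pi : ℂ))⁻¹).deriv).trans ?_
  ring

/-- The bounded factor of the kernel `cutRemainder χ κ`. -/
def remainderBCF (χ : ContDiffBump (0 : ℝ)) (R : ℝ) (κ : ℂ) : E3 →ᵇ ℂ :=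
  (radialBCF (deriv (deriv χ)) (contDiff_deriv_deriv_bump χ).continuous
      χ.hasCompactSupport.deriv.deriv
    + (2 * (Complex.I * κ)) • radialBCF (deriv χ) (contDiff_deriv_bump χ).continuous
      χ.hasCompactSupport.deriv
    + ((Complex.I * κ) ^ 2) • radialBCF χ χ.continuous χ.hasCompactSupport) * expKernel R κ

theorem remainderBCF_mul {χ : ContDiffBump (0 : ℝ)} {R : ℝ} {z : E3} (hz : ‖z‖ ≤ R) (κ : ℂ) :
    remainderBCF χ R κ z * (((‖z‖)⁻¹ : ℝ) : ℂ) = cutRemainder χ κ z := by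
  rw [cutRemainder, radialKernel, deriv_deriv_profile, remainderBCF,
    BoundedContinuousFunction.mul_apply, expKernel_apply hz]
  simp only [BoundedContinuousFunction.add_apply, BoundedContinuousFunction.smul_apply,
    radialBCF, BoundedContinuousFunction.coe_ofNormedAddCommGroup, smul_eq_mul]
  push_cast
  rw [div_eq_mul_inv]
  ring

theorem contDiff_remainderBCF (χ : ContDiffBump (0 : ℝ)) (R : ℝ) :
    ContDiff ℂ ∞ (remainderBCF χ R) := by
  have h := contDiff_expKernel R
  unfold remainderBCF
  exact ContDiff.mul (by fun_prop) h

/-- The Newtonian kernel has the constant profile 1/(4π), whose second derivative vanishes, so no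
remainder appears. Integrating over B alone loses nothing, since Δw vanishes outside B. -/
theorem volumePotential_neg_lap {B : Set E3} {w : E3 → ℂ} (hw : IsBump w)
    (hB' : ∀ x, x ∉ B → lap w x = 0) (x : E3) :
    volumePotential B 0 (fun y => -lap w y) x = w x := by
  have hg : ContDiff ℝ ∞ (fun _ : ℝ => (4 * (Real.pi : ℂ))⁻¹) := contDiff_const
  have h := conv_radialKernel_lap hg hw x
  have hpi : (Real.pi : ℂ) ≠ 0 := by exact_mod_cast Real.pi_ne_zero
  have h0 : conv (radialKernel (deriv (deriv fun _ : ℝ => (4 * (Real.pi : ℂ))⁻¹))) w x = 0 := by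
    simp [conv, radialKernel]
  rw [h0, add_zero, mul_inv_cancel₀ (by simp), neg_one_mul,
    conv_eq_convInt (D := B) hB'] at h
  have h1 : volumePotential B 0 (fun y => -lap w y) x =
      -convInt B (radialKernel fun _ : ℝ => (4 * (Real.pi : ℂ))⁻¹) (lap w) x := by
    rw [volumePotential, convInt, ← integral_neg]
    congr 1
    funext y
    rw [green, radialKernel, ← div_div]
    simp
  rw [h1, h, neg_neg]

/-- The volume potentials `K_D^κ` map `L²(D)` into `H²(D)`, smoothly in `κ`. -/
theorem exists_potential_H2 {D : Set E3} {r : ℝ} (hDo : IsOpen D) (hD : D ⊆ Metric.ball 0 r)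
    [IsFiniteMeasure ((volume : Measure E3).restrict D)] :
    ∃ E : ℂ → L2 D →L[ℂ] H2 D, ContDiff ℂ ∞ E ∧ ∀ κ f, toL2 (E κ f) = potL2 r D κ f := by
  obtain ⟨χ, hχ⟩ := exists_bump (2 * r)
  -- Convolving a function supported in the ball of radius r with the cut-off kernels stays in the
  -- ball of radius r'.
  set r' := r + χ.rOut with hr'
  set B := Metric.ball (0 : E3) r' with hB
  have hDm := hDo.measurableSet
  have hBo : IsOpen B := Metric.isOpen_ball
  have hBm := hBo.measurableSet
  have hrr' : r ≤ r' := by linarith [χ.rOut_pos]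
  have hDB : D ⊆ B := hD.trans (Metric.ball_subset_ball hrr')
  have : IsFiniteMeasure ((volume : Measure E3).restrict B) :=
    isFiniteMeasure_restrict_of_subset_ball subset_rfl
  obtain ⟨E0, hE0⟩ := exists_newtonian_H2 hBo (subset_refl B)
  obtain ⟨R, hR⟩ := exists_restrH2 hDB
  -- `M κ` convolves with `cutRemainder χ κ`. The cut-off potential w of f satisfies -Δw = f - `M κ`
  -- f, a source carried by B, so K^κ f is the restriction to D of the Newtonian potential over B of
  -- that source. The dependence on κ sits in `M κ` only, and there no derivatives need control.
  set M : ℂ → L2 D →L[ℂ] L2 B := fun κ =>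
    (infToL2 B).comp (singOp r' D B (remainderBCF χ (2 * r') κ)) with hM
  have hMs : ContDiff ℂ ∞ M :=
    contDiff_const.clm_comp ((singOp r' D B).contDiff.comp (contDiff_remainderBCF χ (2 * r')))
  refine ⟨fun κ => (R.comp E0).comp (extendZero hDm B - M κ),
    contDiff_const.clm_comp (contDiff_const.sub hMs), fun κ f => ?_⟩
  have hform : ∀ f, toL2 (((R.comp E0).comp (extendZero hDm B - M κ)) f) =
      restrL2 hDB (potL2 r' B 0 ((extendZero hDm B - M κ) f)) := fun f => by
    rw [ContinuousLinearMap.comp_apply, ContinuousLinearMap.comp_apply, hR, hE0]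
  rw [hform]
  refine congrFun ((denseRange_testToL2 hDo).equalizer
    (g := fun f => restrL2 hDB (potL2 r' B 0 ((extendZero hDm B - M κ) f)))
    (h := fun f => potL2 r D κ f) (by fun_prop) (by fun_prop) (funext fun f => ?_)) f
  have hf := f.2.1
  set w := conv (cutGreen χ κ) f.1 with hw
  have hwb : IsBump w := isBump_conv_cutGreen χ κ hf
  have hlz : ∀ x, x ∉ B → lap w x = 0 := fun x hx => by
    have hx' : r' ≤ ‖x‖ := by simpa [hB] using hx
    rw [hw, lap_conv_cutGreen χ κ hf, testSpace_eq_zero_of_le hD f (hrr'.trans hx'),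
      conv_eq_zero_of_le (fun y hy => cutRemainder_eq_zero hy κ)
        (fun y hy => testSpace_eq_zero_of_le hD f hy) (by simpa [hr'] using hx')]
    simp
  have hsrc : (extendZero hDm B - M κ) (testToL2 D f) =ᵐ[volume.restrict B] fun y => -lap w y := by
    have hae : D.indicator (testToL2 D f) =ᵐ[volume.restrict B] f.1 := by
      refine ae_restrict_of_ae ?_
      filter_upwards [(ae_restrict_iff' hDm).1 (coeFn_testToL2 f)] with x hx
      by_cases hxD : x ∈ D
      · rw [Set.indicator_of_mem hxD, hx hxD]
      · rw [Set.indicator_of_notMem hxD, testSpace_eq_zero f hxD]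
    filter_upwards [Lp.coeFn_sub (extendZero hDm B (testToL2 D f)) (M κ (testToL2 D f)),
      coeFn_extendZero hDm B (testToL2 D f), hae,
      coeFn_infToL2 B (singOp r' D B (remainderBCF χ (2 * r') κ) (testToL2 D f)),
      coeFn_singOp hDm hBm hDB (subset_refl B) (remainderBCF χ (2 * r') κ) (testToL2 D f),
      ae_restrict_mem hBm] with x h1 h2 h3 h4 h5 hx
    have h6 : M κ (testToL2 D f) x = conv (cutRemainder χ κ) f.1 x := by
      rw [conv_eq_convInt fun y hy => testSpace_eq_zero f hy]
      refine h4.trans (h5.trans ?_)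
      rw [convInt_congr (ae_eq_refl _) (coeFn_testToL2 f).symm]
      refine setIntegral_congr_fun hDm fun y hy => ?_
      have h7 : ‖x - y‖ ≤ 2 * r' := by
        have h8 := mem_ball_zero_iff.1 hx
        have h9 := mem_ball_zero_iff.1 (hDB hy)
        linarith [norm_sub_le x y]
      simp only [remainderBCF_mul h7]
    refine h1.trans ?_
    rw [Pi.sub_apply, h2, h3, h6, hw, lap_conv_cutGreen χ κ hf]
    ring
  refine Lp.ext ?_
  filter_upwards [coeFn_restrL2 hDB (potL2 r' B 0 ((extendZero hDm B - M κ) (testToL2 D f))),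
    ae_mono (Measure.restrict_mono hDB le_rfl)
      (coeFn_potL2 hBm (subset_refl B) 0 ((extendZero hDm B - M κ) (testToL2 D f))),
    coeFn_potL2 hDm hD κ (testToL2 D f), ae_restrict_mem hDm] with x h1 h2 h3 hx
  simp only [Function.comp_apply]
  rw [h1, h2, h3, volumePotential_congr hsrc, volumePotential_neg_lap hwb hlz,
    volumePotential_congr (coeFn_testToL2 f)]
  exact conv_cutGreen_eq hDm hD hχ κ f hx

/-! ### Compactness of the potentials -/

theorem isCompactOperator_smulRight {H : Type*} [NormedAddCommGroup H] [NormedSpace ℂ H]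
    (ℓ : H →L[ℂ] ℂ) (v : H) : IsCompactOperator (ℓ.smulRight v) := by
  have h : IsCompactOperator (ContinuousLinearMap.toSpanSingleton ℂ v) :=
    isCompactOperator_of_locallyCompactSpace_rng _
  have h2 := h.comp_clm ℓ
  exact h2

theorem isCompactOperator_sum {H ι : Type*} [NormedAddCommGroup H] [NormedSpace ℂ H]
    (T : ι → H →L[ℂ] H) (hT : ∀ i, IsCompactOperator (T i)) (s : Finset ι) :
    IsCompactOperator (∑ i ∈ s, T i : H →L[ℂ] H) := by
  classical
  induction s using Finset.induction_on with
  | empty => simpa using isCompactOperator_zero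
  | insert a s ha ih =>
    rw [Finset.sum_insert ha]
    exact (hT a).add ih

/-- Hilbert–Schmidt operators are compact. -/
theorem isCompactOperator_of_summable {H ι : Type*} [NormedAddCommGroup H] [InnerProductSpace ℂ H]
    [CompleteSpace H] (b : HilbertBasis ι ℂ H) (T : H →L[ℂ] H)
    (hT : Summable fun i => ‖T (b i)‖ ^ 2) : IsCompactOperator T := by
  classical
  set F : Finset ι → H →L[ℂ] H := fun s =>
    ∑ i ∈ s, (innerSL ℂ (b i)).smulRight (T (b i)) with hF
  have hFx : ∀ s x, F s x = ∑ i ∈ s, inner ℂ (b i) x • T (b i) := fun s x => by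
    simp [hF]
  have hlim : ∀ x, Tendsto (fun t => F t x) atTop (𝓝 (T x)) := fun x => by
    have h := (b.hasSum_repr x).mapL T
    simp only [map_smul, b.repr_apply_apply] at h
    simp only [hFx]
    exact h
  refine isCompactOperator_of_tendsto (l := atTop) (F := F) ?_
    (Eventually.of_forall fun s => isCompactOperator_sum _
      (fun i => isCompactOperator_smulRight _ _) s)
  rw [Metric.tendsto_atTop]
  intro ε hε
  -- Finite-rank truncations converge in operator norm: Cauchy–Schwarz and Bessel bound the tail by
  -- ‖x‖ times the root of the tail of ∑ ‖T bᵢ‖².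
  obtain ⟨s, hs⟩ := summable_iff_vanishing_norm.1 hT ((ε / 2) ^ 2) (by positivity)
  refine ⟨s, fun t ht => ?_⟩
  rw [dist_comm, dist_eq_norm]
  refine lt_of_le_of_lt (ContinuousLinearMap.opNorm_le_bound _ (by positivity : 0 ≤ ε / 2)
    fun x => ?_) (by linarith)
  have hl : Tendsto (fun t' => ‖F t' x - F t x‖) atTop (𝓝 ‖(T - F t) x‖) :=
    ((hlim x).sub_const _).norm
  refine le_of_tendsto hl ?_
  filter_upwards [eventually_ge_atTop t] with t' ht'
  have hsub : t ⊆ t' := ht'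
  rw [hFx, hFx, ← Finset.sum_sdiff hsub, add_sub_cancel_right]
  have hdisj : Disjoint (t' \ t) s := by
    refine Finset.disjoint_of_subset_right ht Finset.sdiff_disjoint
  have h1 := hs _ hdisj
  rw [Real.norm_of_nonneg (Finset.sum_nonneg fun i _ => sq_nonneg _)] at h1
  have h2 : ∑ i ∈ t' \ t, ‖inner ℂ (b i) x‖ ^ 2 ≤ ‖x‖ ^ 2 := b.orthonormal.sum_inner_products_le x
  have h3 := Finset.sum_mul_sq_le_sq_mul_sq (t' \ t) (fun i => ‖inner ℂ (b i) x‖)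
    (fun i => ‖T (b i)‖)
  refine (norm_sum_le _ _).trans ?_
  simp only [norm_smul]
  refine abs_le_of_sq_le_sq' ?_ (by positivity) |>.2
  calc _ ≤ _ := h3
    _ ≤ ‖x‖ ^ 2 * (ε / 2) ^ 2 := by
      gcongr
    _ = _ := by ring

theorem convInt_eq_inner {D : Set E3} (q : Lp ℂ 2 (volume : Measure E3)) (f : L2 D) (x : E3) :
    convInt D q f x =
      inner ℂ ((memLp_comp_sub_left (Lp.memLp q) D x).star.toLp _) f := by
  rw [L2.inner_def, convInt]
  refine integral_congr_ae ?_
  filter_upwards [(memLp_comp_sub_left (Lp.memLp q) D x).star.coeFn_toLp] with y hy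
  rw [hy]
  simp [mul_comm]

theorem norm_conj_kernel_le {D : Set E3} (q : Lp ℂ 2 (volume : Measure E3)) (x : E3) :
    ‖(memLp_comp_sub_left (Lp.memLp q) D x).star.toLp _‖ ≤ ‖q‖ := by
  rw [Lp.norm_toLp, Lp.norm_def, eLpNorm_star]
  exact ENNReal.toReal_mono (Lp.memLp q).eLpNorm_ne_top (eLpNorm_comp_sub_left_le (Lp.memLp q) D x)

theorem norm_L2_sq {D : Set E3} (f : L2 D) : ‖f‖ ^ 2 = ∫ x in D, ‖f x‖ ^ 2 := by
  rw [← norm_toLp_sq (Lp.memLp f), Lp.toLp_coeFn]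

theorem integrable_norm_sq_L2 {D : Set E3} (f : L2 D) :
    Integrable (fun x => ‖f x‖ ^ 2) (volume.restrict D) :=
  (memLp_two_iff_integrable_sq_norm (Lp.memLp f).1).1 (Lp.memLp f)

/-- Convolution-type operators on a set of finite measure are compact on `L²`. -/
theorem isCompactOperator_convOp (D : Set E3)
    [IsFiniteMeasure ((volume : Measure E3).restrict D)] (q : Lp ℂ 2 (volume : Measure E3)) :
    IsCompactOperator ((infToL2 D).comp (convOp D D q)) := by
  obtain ⟨w, b, -⟩ := exists_hilbertBasis ℂ (L2 D)
  set T := (infToL2 D).comp (convOp D D q) with hT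
  have hTx : ∀ f, T f =ᵐ[volume.restrict D] convInt D q f := fun f =>
    (coeFn_infToL2 D _).trans (coeFn_convOp D D q f)
  refine isCompactOperator_of_summable b T ?_
  refine summable_of_sum_le (c := ∫ _x in D, ‖q‖ ^ 2) (fun i => sq_nonneg _) fun s => ?_
  simp only [norm_L2_sq]
  rw [← integral_finsetSum _ fun i _ => integrable_norm_sq_L2 _]
  refine integral_mono_ae (integrable_finsetSum _ fun i _ => integrable_norm_sq_L2 _)
    (integrable_const _) ?_
  have hae : ∀ᵐ x ∂(volume.restrict D), ∀ i ∈ s, T (b i) x = convInt D q (b i) x :=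
    (Finset.eventually_all s).2 fun i _ => hTx (b i)
  filter_upwards [hae] with x hx
  -- At fixed x the values T bᵢ(x) are, up to conjugation, the coefficients of the kernel conj q(x -
  -- ·). Bessel bounds their square sum by ‖q‖², which is integrable over D.
  have h1 : ∑ i ∈ s, ‖T (b i) x‖ ^ 2 = ∑ i ∈ s, ‖inner ℂ (b i)
      ((memLp_comp_sub_left (Lp.memLp q) D x).star.toLp _)‖ ^ 2 := by
    refine Finset.sum_congr rfl fun i hi => ?_
    rw [hx i hi, convInt_eq_inner, ← inner_conj_symm, RCLike.norm_conj]
  rw [h1]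
  refine (b.orthonormal.sum_inner_products_le _).trans ?_
  exact pow_le_pow_left₀ (norm_nonneg _) (norm_conj_kernel_le q x) 2

theorem isCompactOperator_potL2 (r : ℝ) (D : Set E3)
    [IsFiniteMeasure ((volume : Measure E3).restrict D)] (κ : ℂ) :
    IsCompactOperator (potL2 r D κ) :=
  isCompactOperator_convOp D (singKernel (2 * r) (expKernel (2 * r) κ))

/-! ### Symmetry of the potentials -/

/-- Fubini's theorem for the pairing of a potential with a square integrable function. -/
theorem integral_convInt_mul {A B : Set E3} {q f ψ : E3 → ℂ} (hqm : StronglyMeasurable q)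
    (hq : MemLp q 2 volume) (hf : Integrable f (volume.restrict A))
    (hψ : MemLp ψ 2 (volume.restrict B)) :
    ∫ x in B, convInt A q f x * ψ x = ∫ y in A, f y * ∫ x in B, q (x - y) * ψ x := by
  have hsub : ∀ y, MemLp (fun x => q (x - y)) 2 (volume.restrict B) := fun y =>
    (hq.comp_measurePreserving (measurePreserving_sub_right volume y)).restrict B
  have hm : AEStronglyMeasurable (fun p : E3 × E3 => f p.1 * (q (p.2 - p.1) * ψ p.2))
      (((volume : Measure E3).restrict A).prod (volume.restrict B)) :=
    hf.1.comp_fst.mul ((hqm.comp_measurable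
      (measurable_snd.sub measurable_fst)).aestronglyMeasurable.mul hψ.1.comp_snd)
  have hI : Integrable (fun p : E3 × E3 => f p.1 * (q (p.2 - p.1) * ψ p.2))
      (((volume : Measure E3).restrict A).prod (volume.restrict B)) := by
    rw [integrable_prod_iff hm]
    refine ⟨Eventually.of_forall fun y => ((hsub y).integrable_mul hψ).const_mul (f y), ?_⟩
    refine Integrable.mono' (hf.norm.mul_const
      ((eLpNorm q 2 volume).toReal * (eLpNorm ψ 2 (volume.restrict B)).toReal))
      hm.norm.integral_prod_right' (Eventually.of_forall fun y => ?_)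
    have h1 : ∫ x in B, ‖f y * (q (x - y) * ψ x)‖ =
        ‖f y‖ * ∫ x in B, ‖q (x - y)‖ * ‖ψ x‖ := by
      simp only [norm_mul, integral_const_mul]
    have h2 : ‖∫ x in B, ((‖q (x - y)‖ : ℝ) : ℂ) * ((‖ψ x‖ : ℝ) : ℂ)‖ ≤
        (eLpNorm q 2 volume).toReal * (eLpNorm ψ 2 (volume.restrict B)).toReal := by
      have hn : ∀ {g : E3 → ℂ} {ν : Measure E3}, MemLp g 2 ν →
          MemLp (fun x => ((‖g x‖ : ℝ) : ℂ)) 2 ν ∧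
            eLpNorm (fun x => ((‖g x‖ : ℝ) : ℂ)) 2 ν = eLpNorm g 2 ν := fun {g ν} hg =>
        ⟨hg.norm.ofReal, eLpNorm_congr_norm_ae (Eventually.of_forall fun x => by simp)⟩
      refine (norm_integral_mul_le (hn (hsub y)).1 (hn hψ).1).trans ?_
      rw [(hn (hsub y)).2, (hn hψ).2]
      gcongr
      · exact hq.eLpNorm_ne_top
      · refine (eLpNorm_mono_measure _ Measure.restrict_le_self).trans ?_
        exact (eLpNorm_comp_measurePreserving hq.1 (measurePreserving_sub_right volume y)).le
    have h3 : ∫ x in B, ((‖q (x - y)‖ : ℝ) : ℂ) * ((‖ψ x‖ : ℝ) : ℂ) =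
        ((∫ x in B, ‖q (x - y)‖ * ‖ψ x‖ : ℝ) : ℂ) := by
      rw [← integral_complex_ofReal]
      congr 1
      funext x
      push_cast
      rfl
    have h4 : 0 ≤ ∫ x in B, ‖q (x - y)‖ * ‖ψ x‖ := integral_nonneg fun x => by positivity
    rw [h3, Complex.norm_real, Real.norm_of_nonneg h4] at h2
    rw [Real.norm_of_nonneg (integral_nonneg fun x => norm_nonneg _)]
    change ∫ x in B, ‖f y * (q (x - y) * ψ x)‖ ≤ _
    rw [h1]
    gcongr
  have h := integral_integral_swap (f := fun y x => f y * (q (x - y) * ψ x)) hI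
  simp only [convInt, ← integral_mul_const, ← integral_const_mul]
  rw [h]
  congr 1
  funext x
  congr 1
  funext y
  ring

theorem green_sub_comm (κ : ℂ) (x y : E3) : green κ (x - y) = green κ (y - x) := by
  rw [green, green, norm_sub_rev]

/-- The kernel of `K_D^κ` truncated to a square integrable function on `ℝ³`. -/
def truncGreen (r : ℝ) (κ : ℂ) : Lp ℂ 2 (volume : Measure E3) :=
  singKernel (2 * r) (expKernel (2 * r) κ)

theorem convInt_truncGreen {r : ℝ} {D : Set E3} (hDm : MeasurableSet D)
    (hD : D ⊆ Metric.ball 0 r) (κ : ℂ) (f : E3 → ℂ) {x : E3} (hx : x ∈ D) :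
    convInt D (truncGreen r κ) f x = volumePotential D κ f x := by
  rw [truncGreen, convInt_singKernel hDm hD _ _ (hD hx), volumePotential]
  refine setIntegral_congr_fun hDm fun y hy => ?_
  simp only [expKernel_mul_eq_green (hD hx) (hD hy)]

theorem integral_truncGreen_mul {r : ℝ} {D : Set E3} (hDm : MeasurableSet D)
    (hD : D ⊆ Metric.ball 0 r) (κ : ℂ) (ψ : E3 → ℂ) {y : E3} (hy : y ∈ D) :
    ∫ x in D, truncGreen r κ (x - y) * ψ x = volumePotential D κ ψ y := by
  rw [volumePotential]
  have h : (fun x => truncGreen r κ (x - y)) =ᵐ[volume.restrict D]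
      fun x => expKernel (2 * r) κ (x - y) * invNormTrunc (2 * r) (x - y) :=
    ae_restrict_of_ae ((measurePreserving_sub_right volume y).quasiMeasurePreserving.ae_eq
      (coeFn_singKernel (2 * r) (expKernel (2 * r) κ)))
  refine integral_congr_ae ?_
  filter_upwards [h, ae_restrict_mem hDm] with x hx hxD
  have hm : x - y ∈ Metric.ball (0 : E3) (2 * r) := by
    have h1 := mem_ball_zero_iff.1 (hD hxD)
    have h2 := mem_ball_zero_iff.1 (hD hy)
    rw [mem_ball_zero_iff]
    linarith [norm_sub_le x y]
  rw [hx, invNormTrunc, Set.indicator_of_mem hm, expKernel_mul_eq_green (hD hxD) (hD hy),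
    green_sub_comm]

/-- The volume potential is symmetric for the bilinear pairing. -/
theorem integral_volumePotential_mul {r : ℝ} {D : Set E3} (hDm : MeasurableSet D)
    (hD : D ⊆ Metric.ball 0 r) (κ : ℂ) {f ψ : E3 → ℂ} (hf : Integrable f (volume.restrict D))
    (hψ : MemLp ψ 2 (volume.restrict D)) :
    ∫ x in D, volumePotential D κ f x * ψ x = ∫ y in D, f y * volumePotential D κ ψ y := by
  have h := integral_convInt_mul (A := D) (B := D) (Lp.stronglyMeasurable (truncGreen r κ))
    (Lp.memLp _) hf hψ
  have h0 : ∫ x in D, volumePotential D κ f x * ψ x =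
      ∫ x in D, convInt D (truncGreen r κ) f x * ψ x :=
    setIntegral_congr_fun hDm fun x hx => by simp only [convInt_truncGreen hDm hD κ f hx]
  rw [h0, h]
  refine setIntegral_congr_fun hDm fun y hy => ?_
  simp only [integral_truncGreen_mul hDm hD κ ψ hy]

theorem star_green_zero (x : E3) : star (green 0 x) = green 0 x := by
  simp [green]

theorem star_volumePotential_zero (D : Set E3) (f : E3 → ℂ) (x : E3) :
    star (volumePotential D 0 f x) = volumePotential D 0 (fun y => star (f y)) x := by
  have h := (integral_conj (μ := volume.restrict D) (f := fun y => green 0 (x - y) * f y))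
  rw [volumePotential, volumePotential]
  refine h.symm.trans ?_
  congr 1
  funext y
  rw [map_mul]
  congr 1
  exact star_green_zero _

/-- The kernel is symmetric for every κ, but real in general only at κ = 0. There bilinear symmetry
becomes self-adjointness. -/
theorem inner_potL2_zero {r : ℝ} {D : Set E3} [IsFiniteMeasure ((volume : Measure E3).restrict D)]
    (hDm : MeasurableSet D) (hD : D ⊆ Metric.ball 0 r) (f g : L2 D) :
    inner ℂ g (potL2 r D 0 f) = inner ℂ (potL2 r D 0 g) f := by
  rw [L2.inner_def, L2.inner_def]
  have h := integral_volumePotential_mul hDm hD 0 ((Lp.memLp f).integrable (by norm_num))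
    (Lp.memLp g).star
  calc ∫ x in D, inner ℂ (g x) (potL2 r D 0 f x)
      = ∫ x in D, volumePotential D 0 f x * star (g x) := by
        refine integral_congr_ae ?_
        filter_upwards [coeFn_potL2 hDm hD 0 f] with x hx
        rw [hx]; rfl
    _ = ∫ y in D, f y * volumePotential D 0 (fun y => star (g y)) y := h
    _ = _ := by
        refine integral_congr_ae ?_
        filter_upwards [coeFn_potL2 hDm hD 0 g] with x hx
        rw [hx, ← star_volumePotential_zero]; rfl

/-! ### The eigenvalue equation and the bordered operator -/

theorem newtonianPotential_eq (D : Set E3) (f : E3 → ℂ) :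
    newtonianPotential D f = volumePotential D 0 f := by
  funext x
  simp [newtonianPotential, volumePotential, green]

theorem newtonianEigenEq_iff {r : ℝ} {D : Set E3}
    [IsFiniteMeasure ((volume : Measure E3).restrict D)] (hDm : MeasurableSet D)
    (hD : D ⊆ Metric.ball 0 r) (μ : ℝ) (f : L2 D) :
    NewtonianEigenEq D μ f ↔ potL2 r D 0 f = (μ : ℂ) • f := by
  rw [NewtonianEigenEq, newtonianPotential_eq]
  constructor
  · intro h
    refine Lp.ext ((coeFn_potL2 hDm hD 0 f).trans (h.trans ?_))
    filter_upwards [Lp.coeFn_smul (μ : ℂ) f] with x hx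
    rw [hx]; rfl
  · intro h
    refine (coeFn_potL2 hDm hD 0 f).symm.trans ?_
    rw [h]
    filter_upwards [Lp.coeFn_smul (μ : ℂ) f] with x hx
    rw [hx]; rfl

/-- The operator `1 - μ⁻¹ K_D + ⟨φ, ·⟩ φ`. -/
def bordered (r : ℝ) (D : Set E3) [IsFiniteMeasure ((volume : Measure E3).restrict D)] (μ : ℝ)
    (φ : L2 D) : L2 D →L[ℂ] L2 D :=
  1 - (((μ : ℂ)⁻¹) • potL2 r D 0 - (innerSL ℂ φ).smulRight φ)

theorem bordered_apply {r : ℝ} {D : Set E3} [IsFiniteMeasure ((volume : Measure E3).restrict D)]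
    {μ : ℝ} {φ : L2 D} (f : L2 D) :
    bordered r D μ φ f = f - (μ : ℂ)⁻¹ • potL2 r D 0 f + inner ℂ φ f • φ := by
  simp [bordered]
  abel

/-- By the Fredholm alternative a trivial kernel suffices. If v lies in the kernel, pairing with φ
and self-adjointness cancel the part 1 - μ⁻¹K and leave ⟨φ, v⟩ = 0. Then Kv = μv, so v is a multiple
of φ by simplicity, and orthogonality forces v = 0. -/
theorem isUnit_bordered {r : ℝ} {D : Set E3} [IsFiniteMeasure ((volume : Measure E3).restrict D)]
    (hDm : MeasurableSet D) (hD : D ⊆ Metric.ball 0 r) {μ : ℝ} (hμ : 0 < μ) {φ : L2 D}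
    (hφ : IsSimpleEigenpair D μ φ) : IsUnit (bordered r D μ φ) := by
  have hμc : (μ : ℂ) ≠ 0 := by exact_mod_cast hμ.ne'
  set T : L2 D →L[ℂ] L2 D := ((μ : ℂ)⁻¹) • potL2 r D 0 - (innerSL ℂ φ).smulRight φ with hT
  have hc : IsCompactOperator T :=
    ((isCompactOperator_potL2 r D 0).smul _).sub (isCompactOperator_smulRight _ _)
  have hKφ := (newtonianEigenEq_iff hDm hD μ φ).1 hφ.eigen_eq
  have hφφ : inner ℂ φ φ = (1 : ℂ) := by
    rw [inner_self_eq_norm_sq_to_K, hφ.norm_eq_one]; simp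
  rcases hc.hasEigenvalue_or_mem_resolventSet (one_ne_zero (α := ℂ)) with h | h
  · exfalso
    obtain ⟨v, hv⟩ := h.exists_hasEigenvector
    have hv1 : T v = v := by
      have := hv.apply_eq_smul
      simpa using this
    have hv2 : ((μ : ℂ)⁻¹) • potL2 r D 0 v - inner ℂ φ v • φ = v := hv1
    have h1 : inner ℂ φ v = (0 : ℂ) := by
      have h2 := congrArg (inner ℂ φ) hv2
      rw [inner_sub_right, inner_smul_right, inner_smul_right, inner_potL2_zero hDm hD, hKφ,
        inner_smul_left, hφφ, Complex.conj_ofReal, inv_mul_cancel_left₀ hμc] at h2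
      linear_combination -h2
    rw [h1, zero_smul, sub_zero] at hv2
    have h3 : potL2 r D 0 v = (μ : ℂ) • v := by
      exact (inv_smul_eq_iff₀ hμc).1 hv2
    obtain ⟨c, rfl⟩ := hφ.simple v ((newtonianEigenEq_iff hDm hD μ v).2 h3)
    rw [inner_smul_right, hφφ, mul_one] at h1
    exact hv.2 (by rw [h1, zero_smul])
  · have h2 := (spectrum.mem_resolventSet_iff).1 h
    simpa [bordered, hT] using h2

/-! ### The Kerr nonlinearity with L^∞ coefficients -/

/-- Complex conjugation on `L^∞(D)`. -/
def conjInf (D : Set E3) : LInf D →L[ℝ] LInf D :=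
  (Complex.conjCLE : ℂ →L[ℝ] ℂ).compLpL ⊤ (volume.restrict D)

/-- Multiplication on `L^∞(D)`. -/
def mulInf (D : Set E3) : LInf D →L[ℂ] LInf D →L[ℂ] LInf D :=
  (ContinuousLinearMap.mul ℂ ℂ).holderL (volume.restrict D) ⊤ ⊤ ⊤

/-- Multiplication `L^∞(D) × L²(D) → L²(D)`. -/
def mulInfL2 (D : Set E3) : LInf D →L[ℂ] L2 D →L[ℂ] L2 D :=
  (ContinuousLinearMap.mul ℂ ℂ).holderL (volume.restrict D) ⊤ 2 2

theorem norm_mulInf_le (D : Set E3) (v w : LInf D) : ‖mulInf D v w‖ ≤ ‖v‖ * ‖w‖ := by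
  refine ((mulInf D).le_opNorm₂ v w).trans ?_
  have h : ‖mulInf D‖ ≤ 1 :=
    (ContinuousLinearMap.norm_holderL_le _).trans (ContinuousLinearMap.opNorm_mul_le ℂ ℂ)
  have := mul_le_mul_of_nonneg_right h (mul_nonneg (norm_nonneg v) (norm_nonneg w))
  linarith

theorem norm_mulInfL2_le (D : Set E3) (v : LInf D) (w : L2 D) :
    ‖mulInfL2 D v w‖ ≤ ‖v‖ * ‖w‖ := by
  refine ((mulInfL2 D).le_opNorm₂ v w).trans ?_
  have h : ‖mulInfL2 D‖ ≤ 1 :=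
    (ContinuousLinearMap.norm_holderL_le _).trans (ContinuousLinearMap.opNorm_mul_le ℂ ℂ)
  have := mul_le_mul_of_nonneg_right h (mul_nonneg (norm_nonneg v) (norm_nonneg w))
  linarith

theorem coeFn_conjInf (D : Set E3) (v : LInf D) :
    conjInf D v =ᵐ[volume.restrict D] fun x => (starRingEnd ℂ) (v x) :=
  (Complex.conjCLE : ℂ →L[ℝ] ℂ).coeFn_compLpL v

theorem norm_conjInf (D : Set E3) (v : LInf D) : ‖conjInf D v‖ = ‖v‖ := by
  rw [Lp.norm_def, Lp.norm_def]
  congr 1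
  refine eLpNorm_congr_norm_ae ?_
  filter_upwards [coeFn_conjInf D v] with x hx
  rw [hx, RCLike.norm_conj]

/-- The map `(v, w) ↦ |v|² w` from `L^∞(D) × L²(D)` to `L²(D)`. -/
def absSqMul (D : Set E3) (v : LInf D) (w : L2 D) : L2 D := mulInfL2 D (mulInf D (conjInf D v) v) w

theorem coeFn_absSqMul (D : Set E3) (v : LInf D) (w : L2 D) :
    absSqMul D v w =ᵐ[volume.restrict D] fun x => ((‖v x‖ ^ 2 : ℝ) : ℂ) * w x := by
  have h1 := (ContinuousLinearMap.mul ℂ ℂ).coeFn_holder (r := 2) (mulInf D (conjInf D v) v) w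
  have h2 := (ContinuousLinearMap.mul ℂ ℂ).coeFn_holder (r := ⊤) (conjInf D v) v
  filter_upwards [h1, h2, coeFn_conjInf D v] with x h1 h2 h3
  refine h1.trans ?_
  have h4 : mulInf D (conjInf D v) v x = _ := h2
  rw [h4, h3]
  simp only [ContinuousLinearMap.mul_apply', Complex.conj_mul']
  push_cast
  rfl

theorem norm_absSqMul_le (D : Set E3) (v : LInf D) (w : L2 D) :
    ‖absSqMul D v w‖ ≤ ‖v‖ ^ 2 * ‖w‖ := by
  refine (norm_mulInfL2_le D _ w).trans ?_
  gcongr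
  refine (norm_mulInf_le D _ v).trans ?_
  rw [norm_conjInf, sq]

/-- Conjugation in the cubic term leaves only real smoothness, so complex bilinear maps have to be
composed with maps that are merely smooth over ℝ. -/
theorem contDiff_bilin_complex {E F G H : Type*} [NormedAddCommGroup E] [NormedSpace ℝ E]
    [NormedAddCommGroup F] [NormedSpace ℂ F] [NormedAddCommGroup G] [NormedSpace ℂ G]
    [NormedAddCommGroup H] [NormedSpace ℂ H] [NormedSpace ℝ F] [IsScalarTower ℝ ℂ F]
    [NormedSpace ℝ G] [IsScalarTower ℝ ℂ G] [NormedSpace ℝ H] [IsScalarTower ℝ ℂ H]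
    {n : WithTop ℕ∞} (B : F →L[ℂ] G →L[ℂ] H) {f : E → F} {g : E → G} (hf : ContDiff ℝ n f)
    (hg : ContDiff ℝ n g) : ContDiff ℝ n fun x => B (f x) (g x) := by
  have h : ContDiff ℂ n fun z : F × G => B z.1 z.2 := B.isBoundedBilinearMap.contDiff
  exact (h.restrict_scalars ℝ).comp (hf.prodMk hg)

theorem contDiff_absSqMul (D : Set E3) {E : Type*} [NormedAddCommGroup E] [NormedSpace ℝ E]
    {n : WithTop ℕ∞} {f : E → LInf D} {g : E → L2 D} (hf : ContDiff ℝ n f)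
    (hg : ContDiff ℝ n g) : ContDiff ℝ n fun x => absSqMul D (f x) (g x) :=
  contDiff_bilin_complex (mulInfL2 D)
    (contDiff_bilin_complex (mulInf D) ((conjInf D).contDiff.comp hf) hf) hg

/-! ### The rescaled equation and existence of a branch -/

/-- The family `(a, ε), (ω, f) ↦ ω² K_D^{ε ω} f` in `L^∞(D)`. -/
def scaledField (r : ℝ) (D : Set E3) (z : (ℝ × ℝ) × (ℂ × L2 D)) : LInf D :=
  z.2.1 ^ 2 • potInf r D ((z.1.2 : ℂ) * z.2.1) z.2.2

/-- The operator family whose zeros are the rescaled resonant states, with `f = N(u) / a`. -/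
def branchMap (r : ℝ) (D : Set E3) [IsFiniteMeasure ((volume : Measure E3).restrict D)]
    (φ : L2 D) (z : (ℝ × ℝ) × (ℂ × L2 D)) : L2 D × ℂ :=
  (z.2.2 - infToL2 D (scaledField r D z) -
      ((z.1.1 : ℂ) ^ 2) • absSqMul D (scaledField r D z) (infToL2 D (scaledField r D z)),
    inner ℂ φ (infToL2 D (scaledField r D z)) - 1)

theorem contDiff_scaledField (r : ℝ) (D : Set E3) : ContDiff ℝ ∞ (scaledField r D) := by
  have h1 : ContDiff ℝ ∞ fun z : (ℝ × ℝ) × (ℂ × L2 D) => (z.1.2 : ℂ) * z.2.1 :=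
    (Complex.ofRealCLM.contDiff.comp contDiff_fst.snd).mul contDiff_snd.fst
  have h2 : ContDiff ℝ ∞ (potInf r D) := (contDiff_potInf r D).restrict_scalars ℝ
  have h3 : ContDiff ℝ ∞ fun z : (ℝ × ℝ) × (ℂ × L2 D) => potInf r D ((z.1.2 : ℂ) * z.2.1) :=
    h2.comp h1
  have h4 : ContDiff ℝ ∞ fun z : (ℝ × ℝ) × (ℂ × L2 D) =>
      potInf r D ((z.1.2 : ℂ) * z.2.1) z.2.2 :=
    contDiff_bilin_complex (ContinuousLinearMap.id ℂ (L2 D →L[ℂ] LInf D)) h3 contDiff_snd.snd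
  have h5 : ContDiff ℝ ∞ fun z : (ℝ × ℝ) × (ℂ × L2 D) => z.2.1 ^ 2 := contDiff_snd.fst.pow 2
  exact h5.smul h4

theorem contDiff_branchMap (r : ℝ) (D : Set E3)
    [IsFiniteMeasure ((volume : Measure E3).restrict D)] (φ : L2 D) :
    ContDiff ℝ ∞ (branchMap r D φ) := by
  have h1 := contDiff_scaledField r D
  have h2 : ContDiff ℝ ∞ fun z => infToL2 D (scaledField r D z) :=
    (((infToL2 D).contDiff (n := ∞)).restrict_scalars ℝ).comp h1
  have h3 : ContDiff ℝ ∞ fun z : (ℝ × ℝ) × (ℂ × L2 D) => ((z.1.1 : ℂ) ^ 2) :=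
    (Complex.ofRealCLM.contDiff.comp contDiff_fst.fst).pow 2
  refine ContDiff.prodMk ((contDiff_snd.snd.sub h2).sub (h3.smul (contDiff_absSqMul D h1 h2))) ?_
  exact ((((innerSL ℂ φ).contDiff (n := ∞)).restrict_scalars ℝ).comp h2).sub contDiff_const

/-- The partial derivative of `branchMap` at the eigenpair. -/
def branchDeriv (r : ℝ) (D : Set E3) [IsFiniteMeasure ((volume : Measure E3).restrict D)]
    (φ : L2 D) (c : ℂ) : ℂ × L2 D →L[ℂ] L2 D × ℂ :=
  let T : ℂ × L2 D →L[ℂ] L2 D :=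
    c ^ 2 • (potL2 r D 0).comp (ContinuousLinearMap.snd ℂ ℂ (L2 D)) +
      (ContinuousLinearMap.fst ℂ ℂ (L2 D)).smulRight ((2 * c) • potL2 r D 0 φ)
  (ContinuousLinearMap.snd ℂ ℂ (L2 D) - T).prod ((innerSL ℂ φ).comp T)

theorem branchDeriv_apply {r : ℝ} {D : Set E3} [IsFiniteMeasure ((volume : Measure E3).restrict D)]
    {φ : L2 D} {c : ℂ} (x : ℂ × L2 D) :
    branchDeriv r D φ c x = (x.2 - (c ^ 2 • potL2 r D 0 x.2 + x.1 • (2 * c) • potL2 r D 0 φ),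
      inner ℂ φ (c ^ 2 • potL2 r D 0 x.2 + x.1 • (2 * c) • potL2 r D 0 φ)) := rfl

/-- At a = ε = 0 the cubic term disappears, so in (ω, f) the map is complex differentiable and its
derivative can be computed over ℂ. -/
theorem branchMap_zero {r : ℝ} {D : Set E3} [IsFiniteMeasure ((volume : Measure E3).restrict D)]
    {φ : L2 D} (x : ℂ × L2 D) : branchMap r D φ (0, x) =
      (x.2 - x.1 ^ 2 • potL2 r D 0 x.2, inner ℂ φ (x.1 ^ 2 • potL2 r D 0 x.2) - 1) := by
  simp [branchMap, scaledField, potL2]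

theorem hasFDerivAt_branchMap {r : ℝ} {D : Set E3}
    [IsFiniteMeasure ((volume : Measure E3).restrict D)] {φ : L2 D} (c : ℂ) :
    HasFDerivAt (fun x => branchMap r D φ (0, x)) (branchDeriv r D φ c) (c, φ) := by
  have h1 : HasFDerivAt (fun x : ℂ × L2 D => x.1 ^ 2 • potL2 r D 0 x.2)
      (c ^ 2 • (potL2 r D 0).comp (ContinuousLinearMap.snd ℂ ℂ (L2 D)) +
      (ContinuousLinearMap.fst ℂ ℂ (L2 D)).smulRight ((2 * c) • potL2 r D 0 φ)) (c, φ) := by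
    have h2 : HasFDerivAt (fun x : ℂ × L2 D => x.1 ^ 2)
        ((2 * c) • ContinuousLinearMap.fst ℂ ℂ (L2 D)) (c, φ) := by
      have := (hasFDerivAt_fst (𝕜 := ℂ) (E := ℂ) (F := L2 D) (p := (c, φ))).pow 2
      refine this.congr_fderiv ?_
      ext <;> simp
    have h3 : HasFDerivAt (fun x : ℂ × L2 D => potL2 r D 0 x.2)
        ((potL2 r D 0).comp (ContinuousLinearMap.snd ℂ ℂ (L2 D))) (c, φ) :=
      (potL2 r D 0).hasFDerivAt.comp _ hasFDerivAt_snd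
    refine (h2.smul h3).congr_fderiv ?_
    ext <;> simp [mul_comm, mul_left_comm]
  simp only [branchMap_zero]
  exact (hasFDerivAt_snd.sub h1).prodMk (((innerSL ℂ φ).hasFDerivAt.comp _ h1).sub_const 1)

/-- Let B be the bordered operator, (s, f) a direction, and τ = ⟨φ, f⟩ + 2cμs. The derivative is (Bf
- τφ, τ): the second component gives τ, then B⁻¹ gives f, and s is read off from τ because cμ ≠ 0.
-/
theorem bijective_branchDeriv {r : ℝ} {D : Set E3}
    [IsFiniteMeasure ((volume : Measure E3).restrict D)]
    (hDm : MeasurableSet D) (hD : D ⊆ Metric.ball 0 r) {μ : ℝ} (hμ : 0 < μ) {φ : L2 D}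
    (hφ : IsSimpleEigenpair D μ φ) {c : ℂ} (hc : c ^ 2 = (μ : ℂ)⁻¹) :
    Function.Bijective (branchDeriv r D φ c) := by
  have hμc : (μ : ℂ) ≠ 0 := by exact_mod_cast hμ.ne'
  have hc0 : c ≠ 0 := by
    rintro rfl
    exact inv_ne_zero hμc (by rw [← hc]; simp)
  have hKφ := (newtonianEigenEq_iff hDm hD μ φ).1 hφ.eigen_eq
  have hφφ : inner ℂ φ φ = (1 : ℂ) := by
    rw [inner_self_eq_norm_sq_to_K, hφ.norm_eq_one]; simp
  obtain ⟨A, hA⟩ := isUnit_bordered hDm hD hμ hφ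
  have hA1 : ∀ f, bordered r D μ φ ((↑A⁻¹ : L2 D →L[ℂ] L2 D) f) = f := fun f => by
    rw [← hA, ← mul_apply_eq_comp, Units.mul_inv, one_apply_eq_self]
  have hA2 : ∀ f, bordered r D μ φ f = 0 → f = 0 := fun f hf => by
    rw [← hA] at hf
    have := congrArg (↑A⁻¹ : L2 D →L[ℂ] L2 D) hf
    rwa [← mul_apply_eq_comp, Units.inv_mul, one_apply_eq_self,
      map_zero] at this
  have key : ∀ x : ℂ × L2 D, branchDeriv r D φ c x =
      (bordered r D μ φ x.2 - (inner ℂ φ x.2 + 2 * c * μ * x.1) • φ,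
        inner ℂ φ x.2 + 2 * c * μ * x.1) := by
    intro x
    rw [branchDeriv_apply, hKφ, hc, bordered_apply]
    ext1
    · simp only [smul_smul, add_smul, mul_comm x.1]
      abel
    · simp only [inner_add_right, inner_smul_right, inner_potL2_zero hDm hD, hKφ,
        inner_smul_left, hφφ, Complex.conj_ofReal]
      field_simp
  constructor
  · refine (injective_iff_map_eq_zero _).2 fun x hx => ?_
    rw [key, Prod.mk_eq_zero] at hx
    have h1 : x.2 = 0 := hA2 _ (by simpa [hx.2] using hx.1)
    have h2 := hx.2
    rw [h1, inner_zero_right, zero_add] at h2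
    have h3 : x.1 = 0 := by simpa [hc0, hμc] using h2
    exact Prod.ext h3 h1
  · rintro ⟨g, s⟩
    set f := (↑A⁻¹ : L2 D →L[ℂ] L2 D) (g + s • φ) with hf
    refine ⟨((s - inner ℂ φ f) / (2 * c * μ), f), ?_⟩
    have h1 : inner ℂ φ f + 2 * c * μ * ((s - inner ℂ φ f) / (2 * c * μ)) = s := by
      field_simp
      ring
    rw [key]
    simp only [h1]
    rw [hf, hA1, add_sub_cancel_right]

/-- The rescaled equation `f = v + a² |v|² v`, `v = ω² K_D^{ε ω} f`, `⟨φ, v⟩ = 1` has a smooth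
branch of solutions through the eigenpair. -/
theorem exists_scaled_branch {r : ℝ} {D : Set E3}
    [IsFiniteMeasure ((volume : Measure E3).restrict D)]
    (hDm : MeasurableSet D) (hD : D ⊆ Metric.ball 0 r) {μ : ℝ} (hμ : 0 < μ) {φ : L2 D}
    (hφ : IsSimpleEigenpair D μ φ) :
    ∃ g : ℝ × ℝ → ℂ × L2 D, g 0 = ((((√μ)⁻¹ : ℝ) : ℂ), φ) ∧ ContDiffAt ℝ 1 g 0 ∧
      ∀ᶠ p in 𝓝 (0 : ℝ × ℝ), branchMap r D φ (p, g p) = 0 := by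
  set c : ℂ := (((√μ)⁻¹ : ℝ) : ℂ) with hcdef
  have hμc : (μ : ℂ) ≠ 0 := by exact_mod_cast hμ.ne'
  have hc : c ^ 2 = (μ : ℂ)⁻¹ := by
    rw [hcdef, ← Complex.ofReal_pow, inv_pow, Real.sq_sqrt hμ.le, Complex.ofReal_inv]
  have hF : ContDiffAt ℝ 1 (branchMap r D φ) ((0 : ℝ × ℝ), (c, φ)) :=
    ((contDiff_branchMap r D φ).of_le (by norm_num)).contDiffAt
  have hbij := bijective_branchDeriv hDm hD hμ hφ hc
  let T : ℂ × L2 D →L[ℝ] L2 D × ℂ := (branchDeriv r D φ c).restrictScalars ℝ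
  let e : (ℂ × L2 D) ≃L[ℝ] (L2 D × ℂ) := ContinuousLinearEquiv.ofBijective T
    (LinearMap.ker_eq_bot.2 hbij.1) (LinearMap.range_eq_top.2 hbij.2)
  have hinv : (fderiv ℝ (branchMap r D φ) ((0 : ℝ × ℝ), (c, φ)) ∘L
      .inr ℝ (ℝ × ℝ) (ℂ × L2 D)).IsInvertible := by
    refine ⟨e, ?_⟩
    have h1 : HasFDerivAt (fun x => branchMap r D φ ((0 : ℝ × ℝ), x))
        (fderiv ℝ (branchMap r D φ) ((0 : ℝ × ℝ), (c, φ)) ∘L .inr ℝ (ℝ × ℝ) (ℂ × L2 D))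
        (c, φ) :=
      (hF.differentiableAt one_ne_zero).hasFDerivAt.comp (c, φ) (hasFDerivAt_prodMk_right 0 (c, φ))
    have h2 := (hasFDerivAt_branchMap (r := r) (D := D) (φ := φ) c).restrictScalars ℝ
    rw [h1.unique h2]
    rfl
  have hKφ := (newtonianEigenEq_iff hDm hD μ φ).1 hφ.eigen_eq
  have hφφ : inner ℂ φ φ = (1 : ℂ) := by
    rw [inner_self_eq_norm_sq_to_K, hφ.norm_eq_one]; simp
  have h0 : branchMap r D φ ((0 : ℝ × ℝ), (c, φ)) = 0 := by
    rw [branchMap_zero, hKφ, hc, inv_smul_smul₀ hμc, hφφ]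
    simp
  refine ⟨hF.implicitFunction one_ne_zero hinv, hF.implicitFunction_apply_self one_ne_zero hinv,
    hF.contDiffAt_implicitFunction one_ne_zero hinv, ?_⟩
  have := hF.eventually_apply_implicitFunction one_ne_zero hinv
  rwa [h0] at this

theorem volumePotential_const_mul (D : Set E3) (κ c : ℂ) (f : E3 → ℂ) (x : E3) :
    volumePotential D κ (fun y => c * f y) x = c * volumePotential D κ f x := by
  simp only [volumePotential, mul_left_comm _ c, integral_const_mul]

theorem paramSet_subset_ball (δ : ℝ) : paramSet δ ⊆ Metric.ball 0 δ := by
  rintro ⟨a, ε⟩ ⟨h1, h2⟩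
  simp only at h1 h2
  rw [mem_ball_zero_iff, Prod.norm_mk, max_lt_iff, Real.norm_eq_abs, Real.norm_eq_abs,
    abs_of_pos h1]
  constructor <;> linarith [abs_nonneg a]

/-- Undoes the scaling: u = aV, where V lifts the normalised field v to H²(D), and h = a(V - Φ). The
normalisation ⟨φ, v⟩ = 1 becomes orthogonality of h. -/
theorem exists_isResonanceBranch {D : Set E3} (hDo : IsOpen D) (hDb : Bornology.IsBounded D)
    {μ : ℝ} (hμ : 0 < μ) {φ : L2 D} (hφ : IsSimpleEigenpair D μ φ) :
    ∃ δ : ℝ, 0 < δ ∧ ∃ (w : ℝ × ℝ → ℂ) (u h : ℝ × ℝ → H2 D),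
      IsResonanceBranch D μ φ δ w u h := by
  obtain ⟨r, hD⟩ := hDb.subset_ball (0 : E3)
  have hDm := hDo.measurableSet
  have := isFiniteMeasure_restrict_of_subset_ball hD
  have hμc : (μ : ℂ) ≠ 0 := by exact_mod_cast hμ.ne'
  have hKφ := (newtonianEigenEq_iff hDm hD μ φ).1 hφ.eigen_eq
  have hφφ : inner ℂ φ φ = (1 : ℂ) := by
    rw [inner_self_eq_norm_sq_to_K, hφ.norm_eq_one]; simp
  obtain ⟨E, hE, hEK⟩ := exists_potential_H2 hDo hD
  obtain ⟨g, hg0, hg, hgF⟩ := exists_scaled_branch hDm hD hμ hφ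
  have hg' : ∀ᶠ p in 𝓝 (0 : ℝ × ℝ), ContDiffAt ℝ 1 g p := hg.eventually (by simp)
  obtain ⟨δ, hδ, hball⟩ := Metric.eventually_nhds_iff_ball.1 (hg'.and hgF)
  -- The eigenfunction is itself a potential, φ = K(μ⁻¹φ), hence lies in H²(D).
  set Φ : H2 D := E 0 ((μ : ℂ)⁻¹ • φ) with hΦ
  have hΦL : toL2 Φ = φ := by rw [hΦ, hEK, map_smul, hKφ, inv_smul_smul₀ hμc]
  set V : ℝ × ℝ → H2 D := fun p => (g p).1 ^ 2 • E ((p.2 : ℂ) * (g p).1) (g p).2 with hV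
  set u : ℝ × ℝ → H2 D := fun p => (p.1 : ℂ) • V p with hu
  have hVL : ∀ p, toL2 (V p) = infToL2 D (scaledField r D (p, g p)) := fun p => by
    have h1 : toL2 (V p) = (g p).1 ^ 2 • toL2 (E ((p.2 : ℂ) * (g p).1) (g p).2) := rfl
    rw [h1, hEK, scaledField, map_smul]
    rfl
  have hVc : ∀ p, ContDiffAt ℝ 1 g p → ContDiffAt ℝ 1 V p := fun p hp => by
    have h1 : ContDiffAt ℝ 1 (fun p : ℝ × ℝ => (p.2 : ℂ) * (g p).1) p :=
      (Complex.ofRealCLM.contDiff.comp contDiff_snd).contDiffAt.mul hp.fst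
    have h2 : ContDiff ℝ 1 E := (hE.restrict_scalars ℝ).of_le (by norm_num)
    have h3 : ContDiffAt ℝ 1 (fun p : ℝ × ℝ => E ((p.2 : ℂ) * (g p).1)) p :=
      h2.contDiffAt.comp p h1
    have h4 : ContDiff ℝ 1 fun z : (L2 D →L[ℂ] H2 D) × L2 D => z.1 z.2 :=
      contDiff_bilin_complex (F := L2 D →L[ℂ] H2 D) (G := L2 D) (H := H2 D)
        (ContinuousLinearMap.id ℂ (L2 D →L[ℂ] H2 D)) contDiff_fst contDiff_snd
    have h5 : ContDiffAt ℝ 1 (fun p : ℝ × ℝ => E ((p.2 : ℂ) * (g p).1) (g p).2) p :=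
      h4.contDiffAt.comp p (h3.prodMk hp.snd)
    exact (hp.fst.pow 2).smul h5
  have hac : ContDiff ℝ 1 fun p : ℝ × ℝ => (p.1 : ℂ) :=
    Complex.ofRealCLM.contDiff.comp contDiff_fst
  have huc : ∀ p, ContDiffAt ℝ 1 g p → ContDiffAt ℝ 1 (fun p => u p - (p.1 : ℂ) • Φ) p :=
    fun p hp => (hac.contDiffAt.smul (hVc p hp)).sub (hac.contDiffAt.smul contDiffAt_const)
  have hdom : ∀ p ∈ paramSet δ, ContDiffAt ℝ 1 g p ∧ branchMap r D φ (p, g p) = 0 :=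
    fun p hp => hball p (paramSet_subset_ball δ hp)
  refine ⟨δ, hδ, fun p => (g p).1, u, fun p => u p - (p.1 : ℂ) • Φ, ?_⟩
  constructor
  · exact fun p hp => (hdom p hp).1.fst.contDiffWithinAt
  · exact fun p hp => (huc p (hdom p hp).1).contDiffWithinAt
  · intro p hp
    have h1 := congrArg Prod.fst (hdom p hp).2
    set v := scaledField r D (p, g p) with hv
    have h2 : (g p).2 = infToL2 D v + ((p.1 : ℂ) ^ 2) • absSqMul D v (infToL2 D v) := by
      rw [← sub_eq_zero, ← sub_sub]
      exact h1
    have hLu : toL2 (u p) = (p.1 : ℂ) • infToL2 D v := by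
      have h3 : toL2 (u p) = (p.1 : ℂ) • toL2 (V p) := rfl
      rw [h3, hVL]
    -- As a is real, N(av) = a(v + a²|v|²v) = af. This needs no division, so a = 0 is included.
    have h4 : (fun y => kerr (toL2 (u p) y)) =ᵐ[volume.restrict D]
        fun y => (p.1 : ℂ) * (g p).2 y := by
      rw [hLu, h2]
      filter_upwards [Lp.coeFn_smul (p.1 : ℂ) (infToL2 D v), coeFn_absSqMul D v (infToL2 D v),
        Lp.coeFn_add (infToL2 D v) (((p.1 : ℂ) ^ 2) • absSqMul D v (infToL2 D v)),
        Lp.coeFn_smul ((p.1 : ℂ) ^ 2) (absSqMul D v (infToL2 D v)), coeFn_infToL2 D v]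
        with x h1 h2 h3 h4 h5
      rw [h1, h3, Pi.add_apply, h4, Pi.smul_apply, Pi.smul_apply, h2, ← h5, kerr]
      simp only [smul_eq_mul, norm_mul, Complex.norm_real, mul_pow, Real.norm_eq_abs, sq_abs]
      push_cast
      ring
    have h5 : volumePotential D ((p.2 : ℂ) * (g p).1) (fun y => kerr (toL2 (u p) y)) =
        fun x => (p.1 : ℂ) * volumePotential D ((p.2 : ℂ) * (g p).1) (g p).2 x := by
      rw [volumePotential_congr h4]
      exact funext fun x => volumePotential_const_mul _ _ _ _ _
    rw [SolvesLippmannSchwinger, h5, hLu, hv, scaledField]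
    have h6 := coeFn_infToL2 D ((g p).1 ^ 2 • potInf r D ((p.2 : ℂ) * (g p).1) (g p).2)
    filter_upwards [Lp.coeFn_smul (p.1 : ℂ)
        (infToL2 D ((g p).1 ^ 2 • potInf r D ((p.2 : ℂ) * (g p).1) (g p).2)), h6,
      Lp.coeFn_smul ((g p).1 ^ 2) (potInf r D ((p.2 : ℂ) * (g p).1) (g p).2),
      coeFn_potInf hDm hD ((p.2 : ℂ) * (g p).1) (g p).2] with x h1 h2 h3 h4
    rw [h1, Pi.smul_apply, h2, h3, Pi.smul_apply, h4]
    simp only [smul_eq_mul]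
    ring
  · intro p hp
    have h1 : toL2 (u p - (p.1 : ℂ) • Φ) = toL2 (u p) - (p.1 : ℂ) • toL2 Φ := rfl
    rw [h1, hΦL, add_sub_cancel]
  · intro p hp
    have h1 : toL2 (u p - (p.1 : ℂ) • Φ) = (p.1 : ℂ) • toL2 (V p) - (p.1 : ℂ) • toL2 Φ := rfl
    have h2 : inner ℂ φ (infToL2 D (scaledField r D (p, g p))) - 1 = 0 :=
      congrArg Prod.snd (hdom p hp).2
    rw [h1, hΦL, ← smul_sub, inner_smul_right, inner_sub_right, hφφ, hVL, h2, mul_zero]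
  · have h1 := hg.continuousAt.fst
    rw [ContinuousAt, hg0] at h1
    exact h1.mono_left nhdsWithin_le_nhds
  · have h1 := (huc 0 hg).continuousAt
    have h2 : u 0 - (((0 : ℝ × ℝ).1 : ℝ) : ℂ) • Φ = 0 := by
      simp only [hu, Prod.fst_zero, Complex.ofReal_zero]
      rw [zero_smul, zero_smul, sub_zero]
    rw [ContinuousAt, h2] at h1
    exact h1.mono_left nhdsWithin_le_nhds

/-! ### From the integral equation to the nonlinear Helmholtz equation -/

theorem volumePotential_add {r : ℝ} {D : Set E3} (hDm : MeasurableSet D)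
    (hD : D ⊆ Metric.ball 0 r) (κ : ℂ) {f g : E3 → ℂ} (hf : MemLp f 2 (volume.restrict D))
    (hg : MemLp g 2 (volume.restrict D)) {x : E3} (hx : x ∈ D) :
    volumePotential D κ (f + g) x = volumePotential D κ f x + volumePotential D κ g x := by
  rw [← convInt_truncGreen hDm hD κ _ hx, ← convInt_truncGreen hDm hD κ _ hx,
    ← convInt_truncGreen hDm hD κ _ hx, convInt, convInt, convInt,
    ← integral_add (integrable_convInt (Lp.memLp _) hf x) (integrable_convInt (Lp.memLp _) hg x)]
  simp only [Pi.add_apply, mul_add]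

/-- The profile of the Green's function. -/
def greenProfile (κ : ℂ) (s : ℝ) : ℂ := (4 * (Real.pi : ℂ))⁻¹ * Complex.exp (Complex.I * κ * s)

theorem contDiff_greenProfile (κ : ℂ) : ContDiff ℝ ∞ (greenProfile κ) :=
  contDiff_const.mul (contDiff_const.mul contDiff_ofReal').cexp

theorem deriv_greenProfile (κ : ℂ) :
    deriv (greenProfile κ) = fun s => Complex.I * κ * greenProfile κ s := by
  funext s
  have h1 : HasDerivAt (fun s : ℝ => Complex.I * κ * (s : ℂ)) (Complex.I * κ * 1) s :=
    (Complex.ofRealCLM.hasDerivAt (x := s)).const_mul (Complex.I * κ)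
  have h2 := (h1.cexp.const_mul ((4 * (Real.pi : ℂ))⁻¹)).deriv
  refine h2.trans ?_
  rw [greenProfile]
  ring

theorem deriv_deriv_greenProfile (κ : ℂ) :
    deriv (deriv (greenProfile κ)) = fun s => -κ ^ 2 * greenProfile κ s := by
  rw [deriv_greenProfile]
  funext s
  have h : DifferentiableAt ℝ (greenProfile κ) s :=
    (contDiff_greenProfile κ).differentiable (by simp) s
  have h2 := (h.hasDerivAt.const_mul (Complex.I * κ)).deriv
  refine h2.trans ?_
  rw [deriv_greenProfile]
  linear_combination (κ ^ 2 * greenProfile κ s) * Complex.I_sq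

theorem radialKernel_greenProfile (κ : ℂ) : radialKernel (greenProfile κ) = green κ := by
  funext x
  rw [radialKernel, greenProfile, green, div_eq_mul_inv, div_eq_mul_inv, mul_inv]
  ring

theorem lap_eq_zero_of_notMem_tsupport {f : E3 → ℂ} {x : E3} (hx : x ∉ tsupport f) :
    lap f x = 0 := by
  have h : ∀ (g : E3 → ℂ) (i : Fin 3), tsupport (pd i g) ⊆ tsupport g := fun g i =>
    closure_minimal (fun y hy => by
      by_contra hyt
      refine hy ?_
      have : fderiv ℝ g y = 0 := by
        have := tsupport_fderiv_subset ℝ (f := g)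
        exact image_eq_zero_of_notMem_tsupport fun h => hyt (this h)
      rw [pd, this]; rfl) (isClosed_tsupport g)
  rw [lap]
  exact Finset.sum_eq_zero fun i _ =>
    image_eq_zero_of_notMem_tsupport fun h' => hx (h f i (h _ i h'))

/-- The volume potential inverts `-(Δ + κ²)` on test functions. -/
theorem volumePotential_helmholtz {r : ℝ} {D : Set E3} (hDm : MeasurableSet D)
    (hD : D ⊆ Metric.ball 0 r) (κ : ℂ) (f : testSpace D) {x : E3} (hx : x ∈ D) :
    volumePotential D κ (lap f.1 + κ ^ 2 • f.1) x = -f.1 x := by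
  have hf := f.2.1
  have h1 := conv_radialKernel_lap (contDiff_greenProfile κ) hf x
  have hπ : (Real.pi : ℂ) ≠ 0 := by exact_mod_cast Real.pi_ne_zero
  have h0 : 4 * (Real.pi : ℂ) * greenProfile κ 0 = 1 := by
    rw [greenProfile, Complex.ofReal_zero, mul_zero, Complex.exp_zero]
    field_simp
  have hr : radialKernel (deriv (deriv (greenProfile κ))) = fun x => -κ ^ 2 * green κ x := by
    rw [deriv_deriv_greenProfile, ← radialKernel_greenProfile]
    funext x
    simp only [radialKernel]
    ring
  have hz : ∀ y, y ∉ D → f.1 y = 0 := fun y hy => testSpace_eq_zero f hy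
  have hz' : ∀ y, y ∉ D → lap f.1 y = 0 := fun y hy =>
    lap_eq_zero_of_notMem_tsupport fun h => hy (f.2.2 h)
  rw [h0, hr, conv_eq_convInt hz', conv_eq_convInt hz, radialKernel_greenProfile] at h1
  have h2 : convInt D (fun x => -κ ^ 2 * green κ x) f.1 x =
      -κ ^ 2 * volumePotential D κ f.1 x := by
    simp only [convInt, volumePotential, mul_assoc, integral_const_mul]
  have h3 : volumePotential D κ (κ ^ 2 • f.1) x = κ ^ 2 * volumePotential D κ f.1 x :=
    volumePotential_const_mul D κ (κ ^ 2) f.1 x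
  have h5 : MemLp (κ ^ 2 • f.1) 2 (volume.restrict D) := (hf.const_mul (κ ^ 2)).memLp.restrict D
  rw [volumePotential_add hDm hD κ (hf.lap.memLp.restrict D) h5 hx, h3]
  have h4 : convInt D (green κ) (lap f.1) x = volumePotential D κ (lap f.1) x := rfl
  rw [← h4, h1, h2]
  ring

/-- The distributional Laplacian on `H²(D)`. -/
def lapL2 (D : Set E3) : H2 D →L[ℂ] L2 D :=
  ∑ i : Fin 3, (PiLp.proj 2 (fun _ : JetIndex => L2 D) (Sum.inr (Sum.inr (i, i)))).comp
    (H2 D).subtypeL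

theorem pd_ofReal {ψ : E3 → ℝ} (hψ : ContDiff ℝ ∞ ψ) (i : Fin 3) :
    pd i (fun x => (ψ x : ℂ)) = fun x => ((fderiv ℝ ψ x (e3 i) : ℝ) : ℂ) := by
  funext x
  have h := (Complex.ofRealCLM.hasFDerivAt (x := ψ x)).comp x
    ((hψ.differentiable (by simp) x).hasFDerivAt)
  have h' : HasFDerivAt (fun x => (ψ x : ℂ)) _ x := h
  rw [pd, h'.fderiv]
  rfl

theorem IsTest.fderiv_apply {D : Set E3} {ψ : E3 → ℝ} (hψ : IsTest D ψ) (v : E3) :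
    IsTest D fun x => fderiv ℝ ψ x v where
  contDiff := (hψ.contDiff.fderiv_right (m := ∞) (by simp)).clm_apply contDiff_const
  hasCompactSupport :=
    (hψ.hasCompactSupport.fderiv ℝ).comp_left (g := fun L : E3 →L[ℝ] ℝ => L v) (by simp)
  tsupport_subset := by
    refine Set.Subset.trans (closure_minimal (fun y hy => ?_) (isClosed_tsupport ψ))
      hψ.tsupport_subset
    by_contra hyt
    have : fderiv ℝ ψ y = 0 :=
      image_eq_zero_of_notMem_tsupport fun h => hyt (tsupport_fderiv_subset ℝ h)
    exact hy (by simp [this])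

theorem integral_lapL2_mul {D : Set E3} (u : H2 D) {ψ : E3 → ℝ} (hψ : IsTest D ψ) :
    ∫ x in D, lapL2 D u x * (ψ x : ℂ) = ∫ x in D, toL2 u x * lap (fun x => (ψ x : ℂ)) x := by
  have h1 : ∀ i, pairing hψ.memLp ((u : PiLp 2 (fun _ : JetIndex => L2 D))
      (Sum.inr (Sum.inr (i, i)))) =
      ∫ x in D, toL2 u x * pd i (pd i (fun x => (ψ x : ℂ))) x := fun i => by
    have h2 := u.2.1 i _ (hψ.fderiv_apply (e3 i))
    have h3 := u.2.2 i i ψ hψ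
    rw [pairing_apply, pd_ofReal hψ.contDiff, pd_ofReal (hψ.fderiv_apply (e3 i)).contDiff]
    refine Eq.trans ?_ h2.symm
    rw [h3, neg_neg]
  rw [← pairing_apply hψ.memLp, lapL2, sum_apply, map_sum]
  simp only [lap, Finset.mul_sum]
  rw [integral_finsetSum]
  · exact Finset.sum_congr rfl fun i _ => h1 i
  · intro i _
    exact (Lp.memLp (toL2 u)).integrable_mul (((hψ.isBump.pd i).pd i).memLp.restrict D)

/-- If some potential of `F` does not vanish, then `F` is integrable. -/
theorem integrable_of_volumePotential_ne_zero {r : ℝ} {D : Set E3} (hDm : MeasurableSet D)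
    (hD : D ⊆ Metric.ball 0 r) {κ : ℂ} {F : E3 → ℂ}
    (hF : AEStronglyMeasurable F (volume.restrict D)) {x : E3} (hx : x ∈ D)
    (h : volumePotential D κ F x ≠ 0) : Integrable F (volume.restrict D) := by
  -- The integral of a non-integrable function is zero by convention, so a nonzero value certifies
  -- integrability.
  have h1 : Integrable (fun y => green κ (x - y) * F y) (volume.restrict D) :=
    not_imp_comm.1 integral_undef h
  refine (h1.norm.const_mul (4 * Real.pi * (2 * r) * Real.exp (‖κ‖ * (2 * r)))).mono' hF ?_
  have hne : ∀ᵐ y ∂(volume.restrict D), y ≠ x :=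
    ae_restrict_of_ae (Measure.ae_ne volume x)
  filter_upwards [hne, ae_restrict_mem hDm] with y hy hyD
  have hxy : 0 < ‖x - y‖ := norm_pos_iff.2 (sub_ne_zero.2 hy.symm)
  have hd : ‖x - y‖ ≤ 2 * r := by
    have h1 := mem_ball_zero_iff.1 (hD hx)
    have h2 := mem_ball_zero_iff.1 (hD hyD)
    linarith [norm_sub_le x y]
  -- On the bounded set D the modulus of the Green's function is bounded below by a positive
  -- constant, so integrability of its product with F gives that of F.
  have hexp : Real.exp (-(‖κ‖ * (2 * r))) ≤ ‖Complex.exp (Complex.I * κ * (‖x - y‖ : ℂ))‖ := by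
    rw [Complex.norm_exp]
    gcongr
    refine neg_le_of_abs_le ((Complex.abs_re_le_norm _).trans ?_)
    rw [norm_mul, norm_mul, Complex.norm_I, one_mul, Complex.norm_real, norm_norm]
    gcongr
  have hg : 1 ≤ 4 * Real.pi * (2 * r) * Real.exp (‖κ‖ * (2 * r)) * ‖green κ (x - y)‖ := by
    rw [green, norm_div]
    have h4 : ‖4 * (Real.pi : ℂ) * (‖x - y‖ : ℂ)‖ = 4 * Real.pi * ‖x - y‖ := by
      simp [abs_of_pos Real.pi_pos]
    rw [h4, mul_div_assoc', le_div_iff₀ (by positivity), one_mul]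
    calc 4 * Real.pi * ‖x - y‖ ≤ 4 * Real.pi * (2 * r) := by gcongr
      _ = 4 * Real.pi * (2 * r) * Real.exp (‖κ‖ * (2 * r)) * Real.exp (-(‖κ‖ * (2 * r))) := by
        rw [mul_assoc _ (Real.exp _), ← Real.exp_add, add_neg_cancel, Real.exp_zero, mul_one]
      _ ≤ _ := by
        have : 0 ≤ 2 * r := hxy.le.trans hd
        gcongr
  rw [norm_mul, ← mul_assoc]
  exact le_mul_of_one_le_left (norm_nonneg _) hg

theorem measurable_kerr : Measurable kerr := by
  unfold kerr
  fun_prop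

/-- A resonant state satisfies the nonlinear Helmholtz equation. -/
theorem kerr_ae_eq_of_solves {r : ℝ} {D : Set E3} (hDo : IsOpen D) (hD : D ⊆ Metric.ball 0 r)
    {ε : ℝ} {w : ℂ} (hw : w ≠ 0) {u : H2 D} (hu : SolvesLippmannSchwinger D ε w u) :
    (-(w ^ 2)⁻¹ • (lapL2 D u + (((ε : ℂ) * w) ^ 2) • toL2 u) : L2 D) =ᵐ[volume.restrict D]
      fun x => kerr (toL2 u x) := by
  have hDm := hDo.measurableSet
  have := isFiniteMeasure_restrict_of_subset_ball hD
  set κ : ℂ := (ε : ℂ) * w with hκ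
  set F : E3 → ℂ := fun x => kerr (toL2 u x) with hF
  have hFm : AEStronglyMeasurable F (volume.restrict D) :=
    (measurable_kerr.comp_aemeasurable (Lp.aestronglyMeasurable (toL2 u)).aemeasurable)
      |>.aestronglyMeasurable
  -- N(u) is not assumed integrable. Either some potential of N(u) is nonzero, which forces
  -- integrability, or all vanish on D, and then u and N(u) are zero.
  have hFi : Integrable F (volume.restrict D) := by
    by_cases h : ∃ x ∈ D, volumePotential D κ F x ≠ 0
    · obtain ⟨x, hx, h⟩ := h
      exact integrable_of_volumePotential_ne_zero hDm hD hFm hx h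
    · push Not at h
      refine (integrable_zero E3 ℂ (volume.restrict D)).congr ?_
      filter_upwards [hu, ae_restrict_mem hDm] with x hx hxD
      have h1 : toL2 u x = 0 := by rw [hx, h x hxD, mul_zero]
      simp [hF, h1, kerr]
  set G : L2 D := lapL2 D u + (κ ^ 2) • toL2 u with hG
  -- Tested against ψ: weak derivatives move Δ + κ² from u to ψ, symmetry moves K^κ from N(u) to (Δ
  -- + κ²)ψ, and K^κ(Δ + κ²)ψ = -ψ.
  have key : (fun x => G x + w ^ 2 * F x) =ᵐ[volume.restrict D] 0 := by
    refine ae_eq_zero_of_forall_test hDo ?_ fun ψ hψ => ?_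
    · exact (locallyIntegrableOn_of_memLp (Lp.memLp G)).add
        (locallyIntegrableOn_of_locallyIntegrable_restrict (hFi.const_mul _).locallyIntegrable)
    set f : testSpace D := ⟨_, hψ.mem_testSpace⟩ with hf
    have hFψ : Integrable (fun x => F x * (ψ x : ℂ)) (volume.restrict D) := by
      obtain ⟨C, hC⟩ := hψ.hasCompactSupport.exists_bound_of_continuous hψ.contDiff.continuous
      refine hFi.mul_bdd (c := C) (Complex.continuous_ofReal.comp
        hψ.contDiff.continuous).aestronglyMeasurable (Eventually.of_forall fun x => ?_)
      exact (Complex.norm_real _).trans_le (hC x)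
    have hGψ : Integrable (fun x => G x * (ψ x : ℂ)) (volume.restrict D) :=
      (Lp.memLp G).integrable_mul hψ.memLp
    have hlap : MemLp (lap f.1) 2 (volume.restrict D) := f.2.1.lap.memLp.restrict D
    have h1 : ∫ x in D, G x * (ψ x : ℂ) = ∫ x in D, toL2 u x * (lap f.1 + κ ^ 2 • f.1) x := by
      rw [hG, integral_add_mul _ _ hψ.memLp, integral_lapL2_mul u hψ, integral_smul_mul]
      have h2 : Integrable (fun x => toL2 u x * lap f.1 x) (volume.restrict D) :=
        (Lp.memLp (toL2 u)).integrable_mul hlap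
      have h3 : Integrable (fun x => κ ^ 2 * (toL2 u x * (ψ x : ℂ))) (volume.restrict D) :=
        ((Lp.memLp (toL2 u)).integrable_mul hψ.memLp).const_mul _
      rw [← integral_const_mul, ← integral_add h2 h3]
      refine integral_congr_ae (Eventually.of_forall fun x => ?_)
      simp only [Pi.add_apply, Pi.smul_apply, smul_eq_mul, hf]
      ring
    have h4 : ∫ x in D, toL2 u x * (lap f.1 + κ ^ 2 • f.1) x =
        w ^ 2 * ∫ x in D, volumePotential D κ F x * (lap f.1 + κ ^ 2 • f.1) x := by
      rw [← integral_const_mul]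
      refine integral_congr_ae (hu.mono fun x hx => ?_)
      simp only [hx]
      ring
    have h5 : ∫ x in D, volumePotential D κ F x * (lap f.1 + κ ^ 2 • f.1) x =
        ∫ x in D, -(F x * (ψ x : ℂ)) := by
      have h6 : MemLp (κ ^ 2 • f.1) 2 (volume.restrict D) :=
        (f.2.1.const_mul (κ ^ 2)).memLp.restrict D
      rw [integral_volumePotential_mul hDm hD κ hFi (hlap.add h6)]
      refine setIntegral_congr_fun hDm fun x hx => ?_
      simp only [volumePotential_helmholtz hDm hD κ f hx, mul_neg]
      rfl
    simp only [add_mul, mul_assoc]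
    rw [integral_add hGψ (hFψ.const_mul _), h1, h4, h5, integral_neg, integral_const_mul]
    ring
  have hw2 : w ^ 2 ≠ 0 := pow_ne_zero 2 hw
  filter_upwards [key, Lp.coeFn_smul (-(w ^ 2)⁻¹) G] with x h1 h2
  rw [h2, Pi.smul_apply, smul_eq_mul]
  have h1' : G x + w ^ 2 * F x = 0 := h1
  field_simp
  linear_combination -h1'

/-! ### Uniqueness of weak derivatives and representatives of resonant states -/

theorem L2_eq_of_forall_test {D : Set E3} (hDo : IsOpen D) {f g : L2 D}
    (h : ∀ ψ : E3 → ℝ, IsTest D ψ → ∫ x in D, f x * (ψ x : ℂ) = ∫ x in D, g x * (ψ x : ℂ)) :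
    f = g := by
  rw [← sub_eq_zero]
  refine (Lp.eq_zero_iff_ae_eq_zero).2 (ae_eq_zero_of_forall_test hDo
    (locallyIntegrableOn_of_memLp (Lp.memLp _)) fun ψ hψ => ?_)
  rw [← pairing_apply hψ.memLp, map_sub, pairing_apply, pairing_apply, h ψ hψ, sub_self]

theorem IsWeakDeriv.unique {D : Set E3} (hDo : IsOpen D) {i : Fin 3} {f g g' : L2 D}
    (h : IsWeakDeriv D i f g) (h' : IsWeakDeriv D i f g') : g = g' :=
  L2_eq_of_forall_test hDo fun ψ hψ => neg_injective ((h ψ hψ).symm.trans (h' ψ hψ))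

/-- Weak derivatives are unique on an open set. Identities in H²(D) may therefore be checked in
L²(D). -/
theorem toL2_injective {D : Set E3} (hDo : IsOpen D) :
    Function.Injective (toL2 : H2 D → L2 D) := by
  intro u v h
  have h0 : (u : PiLp 2 (fun _ : JetIndex => L2 D)) (Sum.inl ()) =
    (v : PiLp 2 (fun _ : JetIndex => L2 D)) (Sum.inl ()) := h
  have h1 : ∀ i, (u : PiLp 2 (fun _ : JetIndex => L2 D)) (Sum.inr (Sum.inl i)) =
      (v : PiLp 2 (fun _ : JetIndex => L2 D)) (Sum.inr (Sum.inl i)) := fun i =>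
    (u.2.1 i).unique hDo (h0 ▸ v.2.1 i)
  refine Subtype.ext (PiLp.ext fun a => ?_)
  match a with
  | Sum.inl () => exact h0
  | Sum.inr (Sum.inl i) => exact h1 i
  | Sum.inr (Sum.inr (i, j)) => exact (u.2.2 i j).unique hDo (h1 i ▸ v.2.2 i j)

/-- The nonlinearity `N(u)` of a resonant state, expressed through the Laplacian of `u`. -/
def kerrL2 {D : Set E3} (ε : ℝ) (w : ℂ) (u : H2 D) : L2 D :=
  -(w ^ 2)⁻¹ • (lapL2 D u + (((ε : ℂ) * w) ^ 2) • toL2 u)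

/-- The `L^∞(D)` representative of a resonant state. -/
def stateInf (r : ℝ) {D : Set E3} (ε : ℝ) (w : ℂ) (u : H2 D) : LInf D :=
  w ^ 2 • potInf r D ((ε : ℂ) * w) (kerrL2 ε w u)

section

variable {r : ℝ} {D : Set E3} {ε : ℝ} {w : ℂ} {u : H2 D}
  [IsFiniteMeasure ((volume : Measure E3).restrict D)]

theorem toL2_eq_potL2 (hDo : IsOpen D) (hD : D ⊆ Metric.ball 0 r) (hw : w ≠ 0)
    (hu : SolvesLippmannSchwinger D ε w u) :
    toL2 u = w ^ 2 • potL2 r D ((ε : ℂ) * w) (kerrL2 ε w u) := by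
  refine Lp.ext ?_
  have h := kerr_ae_eq_of_solves hDo hD hw hu
  rw [SolvesLippmannSchwinger, ← volumePotential_congr h] at hu
  filter_upwards [hu, coeFn_potL2 hDo.measurableSet hD ((ε : ℂ) * w) (kerrL2 ε w u),
    Lp.coeFn_smul (w ^ 2) (potL2 r D ((ε : ℂ) * w) (kerrL2 ε w u))] with x h1 h2 h3
  rw [h3, Pi.smul_apply, h2, h1]
  rfl

theorem infToL2_stateInf (hDo : IsOpen D) (hD : D ⊆ Metric.ball 0 r) (hw : w ≠ 0)
    (hu : SolvesLippmannSchwinger D ε w u) : infToL2 D (stateInf r ε w u) = toL2 u := by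
  rw [toL2_eq_potL2 hDo hD hw hu, stateInf, map_smul]
  rfl

theorem kerrL2_eq (hDo : IsOpen D) (hD : D ⊆ Metric.ball 0 r) (hw : w ≠ 0)
    (hu : SolvesLippmannSchwinger D ε w u) :
    kerrL2 ε w u = toL2 u + absSqMul D (stateInf r ε w u) (toL2 u) := by
  refine Lp.ext ((kerr_ae_eq_of_solves hDo hD hw hu).trans ?_)
  have h1 := coeFn_infToL2 D (stateInf r ε w u)
  rw [infToL2_stateInf hDo hD hw hu] at h1
  filter_upwards [h1, coeFn_absSqMul D (stateInf r ε w u) (toL2 u),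
    Lp.coeFn_add (toL2 u) (absSqMul D (stateInf r ε w u) (toL2 u))] with x h1 h2 h3
  rw [h3, Pi.add_apply, h2, ← h1, kerr]

theorem eq_potential_H2 (hDo : IsOpen D) (hD : D ⊆ Metric.ball 0 r) (hw : w ≠ 0)
    (hu : SolvesLippmannSchwinger D ε w u) {E : ℂ → L2 D →L[ℂ] H2 D}
    (hE : ∀ κ f, toL2 (E κ f) = potL2 r D κ f) :
    u = w ^ 2 • E ((ε : ℂ) * w) (kerrL2 ε w u) := by
  refine toL2_injective hDo ?_
  have h : toL2 (w ^ 2 • E ((ε : ℂ) * w) (kerrL2 ε w u)) =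
    w ^ 2 • toL2 (E ((ε : ℂ) * w) (kerrL2 ε w u)) := rfl
  rw [h, hE, ← toL2_eq_potL2 hDo hD hw hu]

end

/-! ### Expansion of the potentials at wavenumber zero -/

/-- The derivative at `κ = 0` of the factor `exp(i κ |z|) / 4π`. -/
def expKernelDeriv (R : ℝ) : E3 →ᵇ ℂ := (4 * (Real.pi : ℂ))⁻¹ • (Complex.I • distTrunc R)

/-- Pointwise |e^ζ - 1 - ζ| ≤ |ζ|² for |ζ| ≤ 1. It is uniform in z because the truncated distance is
bounded. -/
theorem isBigO_expKernel (R : ℝ) :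
    (fun κ : ℂ => expKernel R κ - expKernel R 0 - κ • expKernelDeriv R)
      =O[𝓝 0] fun κ => κ ^ 2 := by
  set Y : E3 →ᵇ ℂ := Complex.I • distTrunc R with hY
  have hsmall : ∀ᶠ κ : ℂ in 𝓝 0, ‖κ‖ * ‖Y‖ < 1 := by
    have : Tendsto (fun κ : ℂ => ‖κ‖ * ‖Y‖) (𝓝 0) (𝓝 (‖(0 : ℂ)‖ * ‖Y‖)) :=
      (continuous_norm.mul continuous_const).tendsto 0
    rw [norm_zero, zero_mul] at this
    exact this.eventually_lt_const one_pos
  refine IsBigO.of_bound (‖(4 * (Real.pi : ℂ))⁻¹‖ * ‖Y‖ ^ 2) (hsmall.mono fun κ hκ => ?_)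
  rw [BoundedContinuousFunction.norm_le (by positivity)]
  intro z
  have h1 : (expKernel R κ - expKernel R 0 - κ • expKernelDeriv R) z =
      (4 * (Real.pi : ℂ))⁻¹ * (Complex.exp (κ * Y z) - 1 - κ * Y z) := by
    simp only [expKernel, expKernelDeriv, BoundedContinuousFunction.sub_apply,
      BoundedContinuousFunction.smul_apply, exp_apply, smul_eq_mul, zero_mul, Complex.exp_zero, hY]
    ring
  have hYz : ‖κ * Y z‖ ≤ ‖κ‖ * ‖Y‖ := by
    rw [norm_mul]
    gcongr
    exact Y.norm_coe_le_norm z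
  rw [h1, norm_mul, norm_pow]
  have h2 := Complex.norm_exp_sub_one_sub_id_le (hYz.trans hκ.le)
  calc _ ≤ ‖(4 * (Real.pi : ℂ))⁻¹‖ * (‖κ‖ * ‖Y‖) ^ 2 := by
        gcongr
        exact h2.trans (by gcongr)
    _ = _ := by ring

/-- The derivative of `κ ↦ K_D^κ` at `0`. -/
def potL2Deriv (r : ℝ) (D : Set E3) [IsFiniteMeasure ((volume : Measure E3).restrict D)] :
    L2 D →L[ℂ] L2 D :=
  (infToL2 D).comp (singOp r D D (expKernelDeriv (2 * r)))

theorem isBigO_potL2 (r : ℝ) (D : Set E3) [IsFiniteMeasure ((volume : Measure E3).restrict D)] :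
    (fun κ : ℂ => potL2 r D κ - potL2 r D 0 - κ • potL2Deriv r D) =O[𝓝 0] fun κ => κ ^ 2 := by
  let S : (E3 →ᵇ ℂ) →L[ℂ] L2 D →L[ℂ] L2 D :=
    (ContinuousLinearMap.compL ℂ (L2 D) (LInf D) (L2 D) (infToL2 D)).comp (singOp r D D)
  have h : (fun κ : ℂ => potL2 r D κ - potL2 r D 0 - κ • potL2Deriv r D) =
      fun κ => S (expKernel (2 * r) κ - expKernel (2 * r) 0 - κ • expKernelDeriv (2 * r)) := by
    funext κ
    rw [map_sub, map_sub, map_smul]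
    rfl
  rw [h]
  exact (S.isBigO_comp _ _).trans (isBigO_expKernel (2 * r))

/-- The factor |x - y| from differentiating the exponential cancels the singularity, so the
derivative of K^κ at 0 has the constant kernel i/(4π). Reality of φ makes both integrals equal to
∫φ. -/
theorem inner_potL2Deriv {r : ℝ} {D : Set E3} [IsFiniteMeasure ((volume : Measure E3).restrict D)]
    (hDm : MeasurableSet D) (hD : D ⊆ Metric.ball 0 r) {φ : L2 D}
    (hφ : ∀ᵐ x ∂(volume.restrict D), (φ x).im = 0) :
    inner ℂ φ (potL2Deriv r D φ) =
      Complex.I / (4 * (Real.pi : ℂ)) * (∫ x in D, φ x) ^ 2 := by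
  have h1 : potL2Deriv r D φ =ᵐ[volume.restrict D]
      fun _ => Complex.I / (4 * (Real.pi : ℂ)) * ∫ y in D, φ y := by
    refine (coeFn_infToL2 D _).trans ((coeFn_singOp hDm hDm hD hD _ φ).trans ?_)
    filter_upwards [ae_restrict_mem hDm] with x hx
    rw [← integral_const_mul]
    refine integral_congr_ae ?_
    have hne : ∀ᵐ y ∂(volume.restrict D), y ≠ x := ae_restrict_of_ae (Measure.ae_ne volume x)
    filter_upwards [hne, ae_restrict_mem hDm] with y hy hyD
    have hxy : (‖x - y‖ : ℂ) ≠ 0 := by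
      exact_mod_cast (norm_pos_iff.2 (sub_ne_zero.2 hy.symm)).ne'
    have hd : ‖x - y‖ ≤ 2 * r := by
      have h1 := mem_ball_zero_iff.1 (hD hx)
      have h2 := mem_ball_zero_iff.1 (hD hyD)
      linarith [norm_sub_le x y]
    rw [expKernelDeriv, BoundedContinuousFunction.smul_apply,
      BoundedContinuousFunction.smul_apply, distTrunc_apply hd]
    have hπ : (Real.pi : ℂ) ≠ 0 := by exact_mod_cast Real.pi_ne_zero
    simp only [smul_eq_mul]
    push_cast
    field_simp
  have h2 : ∫ x in D, (starRingEnd ℂ) (φ x) = ∫ x in D, φ x :=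
    integral_congr_ae (hφ.mono fun x hx => Complex.conj_eq_iff_im.2 hx)
  rw [L2.inner_def, sq, ← mul_assoc]
  nth_rewrite 2 [← h2]
  rw [← integral_const_mul]
  refine integral_congr_ae (h1.mono fun x hx => ?_)
  simp only [hx, RCLike.inner_apply]

theorem isBigO_clm_apply {α E F : Type*} [NormedAddCommGroup E] [NormedSpace ℂ E]
    [NormedAddCommGroup F] [NormedSpace ℂ F] {l : Filter α} {T : α → E →L[ℂ] F} {x : α → E}
    {g₁ g₂ : α → ℝ} (hT : T =O[l] g₁) (hx : x =O[l] g₂) :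
    (fun p => T p (x p)) =O[l] fun p => g₁ p * g₂ p := by
  refine IsBigO.trans (IsBigO.of_bound 1 (Eventually.of_forall fun p => ?_))
    (hT.norm_left.mul hx.norm_left)
  rw [one_mul, norm_mul, norm_norm, norm_norm]
  exact (T p).le_opNorm (x p)

theorem contDiff_potL2 (r : ℝ) (D : Set E3)
    [IsFiniteMeasure ((volume : Measure E3).restrict D)] : ContDiff ℂ ∞ (potL2 r D) :=
  (ContinuousLinearMap.compL ℂ (L2 D) (LInf D) (L2 D) (infToL2 D)).contDiff.comp
    (contDiff_potInf r D)

/-! ### A priori estimates along an arbitrary branch -/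

/-- The relations satisfied, along a filter `l` of parameters `(a, ε)`, by a family of resonant
states `f` in `L²(D)` with nonlinearity `N = f + |v|² f`, where `v` represents `f` in `L^∞(D)`. -/
structure IsReducedBranch (r : ℝ) (D : Set E3)
    [IsFiniteMeasure ((volume : Measure E3).restrict D)] (φ : L2 D) (c : ℂ)
    (l : Filter (ℝ × ℝ)) (w : ℝ × ℝ → ℂ) (f N : ℝ × ℝ → L2 D) (v : ℝ × ℝ → LInf D) : Prop where
  le_nhds : l ≤ 𝓝 0
  tendsto_freq : Tendsto w l (𝓝 c)
  tendsto_state : Tendsto f l (𝓝 0)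
  bounded : v =O[l] fun _ => (1 : ℝ)
  state_eq : ∀ᶠ p in l, infToL2 D (v p) = f p
  field_eq : ∀ᶠ p in l, v p = w p ^ 2 • potInf r D ((p.2 : ℂ) * w p) (N p)
  kerr_eq : ∀ᶠ p in l, N p = f p + absSqMul D (v p) (f p)
  orthogonal : ∀ᶠ p in l, inner ℂ φ (f p - (p.1 : ℂ) • φ) = 0

theorem isBigO_absSqMul {D : Set E3} {α : Type*} (l : Filter α) (v : α → LInf D) (f : α → L2 D) :
    (fun p => absSqMul D (v p) (f p)) =O[l] fun p => ‖v p‖ ^ 2 * ‖f p‖ :=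
  IsBigO.of_bound 1 (Eventually.of_forall fun p => by
    rw [one_mul, Real.norm_of_nonneg (by positivity)]
    exact norm_absSqMul_le D _ _)

namespace IsReducedBranch

variable {r : ℝ} {D : Set E3} [IsFiniteMeasure ((volume : Measure E3).restrict D)] {φ : L2 D}
  {c : ℂ} {l : Filter (ℝ × ℝ)} {w : ℝ × ℝ → ℂ} {f N : ℝ × ℝ → L2 D} {v : ℝ × ℝ → LInf D}

theorem isBigO_freq (H : IsReducedBranch r D φ c l w f N v) : w =O[l] fun _ => (1 : ℝ) :=
  H.tendsto_freq.isBigO_one ℝ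

theorem isBigO_wavenumber (H : IsReducedBranch r D φ c l w f N v) :
    (fun p => (p.2 : ℂ) * w p) =O[l] fun p => |p.2| := by
  have h1 : (fun p : ℝ × ℝ => (p.2 : ℂ)) =O[l] fun p => |p.2| :=
    IsBigO.of_bound 1 (Eventually.of_forall fun p => by
      simp only [Complex.norm_real, Real.norm_eq_abs, abs_abs, one_mul, le_refl])
  simpa using h1.mul H.isBigO_freq

theorem tendsto_abs_snd (H : IsReducedBranch r D φ c l w f N v) :
    Tendsto (fun p : ℝ × ℝ => |p.2|) l (𝓝 0) := by
  have h : Tendsto (fun p : ℝ × ℝ => |p.2|) (𝓝 0) (𝓝 |(0 : ℝ × ℝ).2|) :=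
    (continuous_abs.comp continuous_snd).tendsto 0
  simp only [Prod.snd_zero, abs_zero] at h
  exact h.mono_left H.le_nhds

theorem tendsto_wavenumber (H : IsReducedBranch r D φ c l w f N v) :
    Tendsto (fun p => (p.2 : ℂ) * w p) l (𝓝 0) :=
  H.isBigO_wavenumber.trans_tendsto H.tendsto_abs_snd

theorem isBigO_comp_sub {F : Type*} [NormedAddCommGroup F] [NormedSpace ℂ F]
    (H : IsReducedBranch r D φ c l w f N v) {G : ℂ → F} (hG : ContDiff ℂ ∞ G) :
    (fun p : ℝ × ℝ => G ((p.2 : ℂ) * w p) - G 0) =O[l] fun p => |p.2| := by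
  have h := (hG.differentiable (by simp) 0).isBigO_sub
  simp only [sub_zero] at h
  exact (h.comp_tendsto H.tendsto_wavenumber).trans H.isBigO_wavenumber

theorem isBigO_comp {F : Type*} [NormedAddCommGroup F] [NormedSpace ℂ F]
    (H : IsReducedBranch r D φ c l w f N v) {G : ℂ → F} (hG : ContDiff ℂ ∞ G) :
    (fun p : ℝ × ℝ => G ((p.2 : ℂ) * w p)) =O[l] fun _ => (1 : ℝ) :=
  ((hG.continuous.tendsto 0).comp H.tendsto_wavenumber).isBigO_one ℝ

theorem isBigO_freq_sq_smul_sub {F : Type*} [NormedAddCommGroup F] [NormedSpace ℂ F]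
    (H : IsReducedBranch r D φ c l w f N v) {G : ℂ → F} (hG : ContDiff ℂ ∞ G) :
    (fun p : ℝ × ℝ => w p ^ 2 • G ((p.2 : ℂ) * w p) - c ^ 2 • G 0)
      =O[l] fun p => ‖w p - c‖ + |p.2| := by
  have h1 : (fun p => w p ^ 2 - c ^ 2) =O[l] fun p => ‖w p - c‖ := by
    have h2 : (fun p => w p + c) =O[l] fun _ => (1 : ℝ) :=
      (H.tendsto_freq.add_const c).isBigO_one ℝ
    have h3 : (fun p => w p - c) =O[l] fun p => ‖w p - c‖ := (isBigO_refl _ _).norm_right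
    refine (h2.mul h3).congr (fun p => ?_) (fun p => one_mul _)
    ring
  have e1 : (fun p : ℝ × ℝ => ‖w p - c‖) =O[l] fun p => ‖w p - c‖ + |p.2| :=
    IsBigO.of_bound 1 (Eventually.of_forall fun p => by
      rw [one_mul, norm_norm, Real.norm_of_nonneg (by positivity)]
      linarith [abs_nonneg p.2])
  have e2 : (fun p : ℝ × ℝ => |p.2|) =O[l] fun p => ‖w p - c‖ + |p.2| :=
    IsBigO.of_bound 1 (Eventually.of_forall fun p => by
      rw [one_mul, Real.norm_eq_abs, abs_abs, Real.norm_of_nonneg (by positivity)]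
      linarith [norm_nonneg (w p - c)])
  have h4 := (h1.smul (H.isBigO_comp hG)).trans (by simpa using e1)
  have h5 := ((H.isBigO_comp_sub hG).const_smul_left (c ^ 2)).trans e2
  refine (h4.add h5).congr_left fun p => ?_
  simp only [Pi.smul_apply, sub_smul, smul_sub]
  abel

theorem isBigO_kerr (H : IsReducedBranch r D φ c l w f N v) : N =O[l] fun p => ‖f p‖ := by
  have h1 : (fun p => ‖v p‖ ^ 2 * ‖f p‖) =O[l] fun p => ‖f p‖ := by
    simpa using (H.bounded.norm_left.pow 2).mul (isBigO_refl (fun p => ‖f p‖) l)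
  refine ((isBigO_refl f l).norm_right.add ((isBigO_absSqMul l v f).trans h1)).congr'
    (H.kerr_eq.mono fun p hp => hp.symm) EventuallyEq.rfl

/-- Bootstrap: boundedness of v makes N = O(‖f‖), and v = ω² K^{εω} N then improves bounded to
O(‖f‖) in L^∞. This makes the cubic term genuinely cubic. -/
theorem isBigO_field (H : IsReducedBranch r D φ c l w f N v) : v =O[l] fun p => ‖f p‖ := by
  have h1 := isBigO_clm_apply (H.isBigO_comp (contDiff_potInf r D)) H.isBigO_kerr
  have h2 := (H.isBigO_freq.pow 2).smul h1
  refine h2.congr' (H.field_eq.mono fun p hp => hp.symm) (Eventually.of_forall fun p => ?_)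
  simp

theorem isBigO_cubic (H : IsReducedBranch r D φ c l w f N v) :
    (fun p => absSqMul D (v p) (f p)) =O[l] fun p => ‖f p‖ ^ 3 := by
  refine (isBigO_absSqMul l v f).trans (((H.isBigO_field.norm_left.pow 2).mul
    (isBigO_refl (fun p => ‖f p‖) l)).congr_right fun p => ?_)
  ring

/-- The residual of the linearised equation. -/
def residual (r : ℝ) (D : Set E3) [IsFiniteMeasure ((volume : Measure E3).restrict D)]
    (c : ℂ) (w : ℝ × ℝ → ℂ) (f : ℝ × ℝ → L2 D) (v : ℝ × ℝ → LInf D) (p : ℝ × ℝ) : L2 D :=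
  (w p ^ 2 • potL2 r D ((p.2 : ℂ) * w p) - c ^ 2 • potL2 r D 0) (f p) +
    (w p ^ 2 • potL2 r D ((p.2 : ℂ) * w p)) (absSqMul D (v p) (f p))

theorem sub_eq_residual (H : IsReducedBranch r D φ c l w f N v) :
    ∀ᶠ p in l, f p - c ^ 2 • potL2 r D 0 (f p) = residual r D c w f v p := by
  filter_upwards [H.state_eq, H.field_eq, H.kerr_eq] with p h1 h2 h3
  have h4 : f p = (w p ^ 2 • potL2 r D ((p.2 : ℂ) * w p)) (N p) := by
    rw [← h1, h2, map_smul]; rfl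
  rw [h3, map_add] at h4
  have h5 : (c ^ 2 • potL2 r D 0) (f p) = c ^ 2 • potL2 r D 0 (f p) := rfl
  rw [residual, sub_apply, h5]
  nth_rewrite 1 [h4]
  abel

theorem isBigO_residual (H : IsReducedBranch r D φ c l w f N v) :
    residual r D c w f v =O[l] fun p => (‖w p - c‖ + |p.2| + ‖f p‖ ^ 2) * ‖f p‖ := by
  have h1 := isBigO_clm_apply (H.isBigO_freq_sq_smul_sub (contDiff_potL2 r D))
    (isBigO_refl f l).norm_right
  have h2 : (fun p : ℝ × ℝ => w p ^ 2 • potL2 r D ((p.2 : ℂ) * w p)) =O[l] fun _ => (1 : ℝ) := by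
    simpa using (H.isBigO_freq.pow 2).smul (H.isBigO_comp (contDiff_potL2 r D))
  have h3 := isBigO_clm_apply h2 H.isBigO_cubic
  have e1 : (fun p : ℝ × ℝ => (‖w p - c‖ + |p.2|) * ‖f p‖) =O[l]
      fun p => (‖w p - c‖ + |p.2| + ‖f p‖ ^ 2) * ‖f p‖ :=
    IsBigO.of_bound 1 (Eventually.of_forall fun p => by
      rw [one_mul, Real.norm_of_nonneg (by positivity), Real.norm_of_nonneg (by positivity)]
      refine mul_le_mul_of_nonneg_right ?_ (norm_nonneg _)
      linarith [sq_nonneg ‖f p‖])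
  have e2 : (fun p : ℝ × ℝ => 1 * ‖f p‖ ^ 3) =O[l]
      fun p => (‖w p - c‖ + |p.2| + ‖f p‖ ^ 2) * ‖f p‖ :=
    IsBigO.of_bound 1 (Eventually.of_forall fun p => by
      rw [one_mul, one_mul, Real.norm_of_nonneg (by positivity),
        Real.norm_of_nonneg (by positivity), pow_succ]
      gcongr
      linarith [norm_nonneg (w p - c), abs_nonneg p.2])
  exact (h1.trans e1).add (h3.trans e2)

/-- The bordered operator sends f - aφ to the residual: φ is in the kernel of 1 - μ⁻¹K, and the
rank-one term vanishes by orthogonality. Its inverse is bounded. -/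
theorem isBigO_corr_residual (H : IsReducedBranch r D φ c l w f N v)
    (hDm : MeasurableSet D) (hD : D ⊆ Metric.ball 0 r) {μ : ℝ} (hμ : 0 < μ)
    (hφ : IsSimpleEigenpair D μ φ) (hc : c ^ 2 = (μ : ℂ)⁻¹) :
    (fun p => f p - (p.1 : ℂ) • φ) =O[l] residual r D c w f v := by
  have hμc : (μ : ℂ) ≠ 0 := by exact_mod_cast hμ.ne'
  have hKφ := (newtonianEigenEq_iff hDm hD μ φ).1 hφ.eigen_eq
  obtain ⟨A, hA⟩ := isUnit_bordered hDm hD hμ hφ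
  have h1 : ∀ᶠ p in l, (↑A⁻¹ : L2 D →L[ℂ] L2 D) (residual r D c w f v p) =
      f p - (p.1 : ℂ) • φ := by
    filter_upwards [H.sub_eq_residual, H.orthogonal] with p h2 h3
    have h4 : bordered r D μ φ (f p - (p.1 : ℂ) • φ) = residual r D c w f v p := by
      rw [bordered_apply, h3, zero_smul, add_zero, map_sub, map_smul, hKφ, ← h2, hc, smul_sub,
        smul_comm (p.1 : ℂ) (μ : ℂ) φ, inv_smul_smul₀ hμc]
      abel
    rw [← h4, ← hA, ← mul_apply_eq_comp, Units.inv_mul, one_apply_eq_self]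
  exact ((↑A⁻¹ : L2 D →L[ℂ] L2 D).isBigO_comp _ l).congr' h1 EventuallyEq.rfl

/-- The residual is ‖f‖ times a quantity tending to zero, so f - aφ = o(‖f‖), and this error is
absorbed to leave f = O(‖aφ‖). -/
theorem isBigO_state (H : IsReducedBranch r D φ c l w f N v)
    (hDm : MeasurableSet D) (hD : D ⊆ Metric.ball 0 r) {μ : ℝ} (hμ : 0 < μ)
    (hφ : IsSimpleEigenpair D μ φ) (hc : c ^ 2 = (μ : ℂ)⁻¹) : f =O[l] fun p => |p.1| := by
  have h1 := (H.isBigO_corr_residual hDm hD hμ hφ hc).trans H.isBigO_residual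
  have h2 : Tendsto (fun p => ‖w p - c‖ + |p.2| + ‖f p‖ ^ 2) l (𝓝 0) := by
    have h3 : Tendsto (fun p => ‖w p - c‖) l (𝓝 0) := by
      simpa using (H.tendsto_freq.sub_const c).norm
    have h4 : Tendsto (fun p => ‖f p‖ ^ 2) l (𝓝 0) := by
      simpa using (H.tendsto_state.norm).pow 2
    simpa using (h3.add H.tendsto_abs_snd).add h4
  have h3 : (fun p => (‖w p - c‖ + |p.2| + ‖f p‖ ^ 2) * ‖f p‖) =o[l] f := by
    have := ((isLittleO_one_iff ℝ).2 h2).mul_isBigO (isBigO_refl (fun p => ‖f p‖) l)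
    simpa using this
  have h4 := (h1.trans_isLittleO h3).right_isBigO_sub
  have h5 : (fun p => f p - (f p - (p.1 : ℂ) • φ)) =O[l] fun p => |p.1| :=
    IsBigO.of_bound ‖φ‖ (Eventually.of_forall fun p => by
      rw [sub_sub_cancel, norm_smul, Complex.norm_real, Real.norm_eq_abs, Real.norm_eq_abs,
        abs_abs, mul_comm])
  exact h4.trans h5

end IsReducedBranch

theorem isBigO_of_nonneg_le {α : Type*} {l : Filter α} {f g : α → ℝ} (h0 : ∀ p, 0 ≤ f p)
    (h : ∀ p, f p ≤ g p) : f =O[l] g :=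
  IsBigO.of_bound 1 (Eventually.of_forall fun p => by
    rw [one_mul, Real.norm_of_nonneg (h0 p), Real.norm_of_nonneg ((h0 p).trans (h p))]
    exact h p)

theorem isBigO_snd_mul_fst (l : Filter (ℝ × ℝ)) :
    (fun p : ℝ × ℝ => |p.2| * |p.1|) =O[l] fun p => (|p.2| + p.1 ^ 2) * |p.1| :=
  isBigO_of_nonneg_le (fun p => by positivity) fun p =>
    mul_le_mul_of_nonneg_right (by linarith [sq_nonneg p.1]) (abs_nonneg _)

theorem isBigO_fst_cube (l : Filter (ℝ × ℝ)) :
    (fun p : ℝ × ℝ => |p.1| ^ 3) =O[l] fun p => (|p.2| + p.1 ^ 2) * |p.1| :=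
  isBigO_of_nonneg_le (fun p => by positivity) fun p => by
    rw [pow_succ, sq_abs]
    exact mul_le_mul_of_nonneg_right (by linarith [abs_nonneg p.2]) (abs_nonneg _)

namespace IsReducedBranch

variable {r : ℝ} {D : Set E3} [IsFiniteMeasure ((volume : Measure E3).restrict D)] {φ : L2 D}
  {c : ℂ} {l : Filter (ℝ × ℝ)} {w : ℝ × ℝ → ℂ} {f N : ℝ × ℝ → L2 D} {v : ℝ × ℝ → LInf D} {μ : ℝ}

theorem mono (H : IsReducedBranch r D φ c l w f N v) {l' : Filter (ℝ × ℝ)} (h : l' ≤ l) :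
    IsReducedBranch r D φ c l' w f N v where
  le_nhds := h.trans H.le_nhds
  tendsto_freq := H.tendsto_freq.mono_left h
  tendsto_state := H.tendsto_state.mono_left h
  bounded := H.bounded.mono h
  state_eq := H.state_eq.filter_mono h
  field_eq := H.field_eq.filter_mono h
  kerr_eq := H.kerr_eq.filter_mono h
  orthogonal := H.orthogonal.filter_mono h

theorem tendsto_fst (H : IsReducedBranch r D φ c l w f N v) :
    Tendsto (fun p : ℝ × ℝ => p.1) l (𝓝 0) :=
  (continuous_fst.tendsto (0 : ℝ × ℝ)).mono_left H.le_nhds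

theorem isBigO_pot_cubic (H : IsReducedBranch r D φ c l w f N v)
    (hf : f =O[l] fun p => |p.1|) :
    (fun p => inner ℂ φ (potL2 r D ((p.2 : ℂ) * w p) (absSqMul D (v p) (f p))))
      =O[l] fun p => |p.1| ^ 3 := by
  have h1 := isBigO_clm_apply (H.isBigO_comp (contDiff_potL2 r D))
    (H.isBigO_cubic.trans (hf.norm_left.pow 3))
  exact ((innerSL ℂ φ).isBigO_comp _ l).trans (by simpa using h1)

/-- The solvability condition: pairing the linearised equation with φ kills 1 - μ⁻¹K by
self-adjointness, and ⟨φ, f⟩ = a. What remains determines the frequency. -/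
theorem frequency_eq (H : IsReducedBranch r D φ c l w f N v)
    (hDm : MeasurableSet D) (hD : D ⊆ Metric.ball 0 r) (hμ : 0 < μ)
    (hφ : IsSimpleEigenpair D μ φ) (hc : c ^ 2 = (μ : ℂ)⁻¹) :
    ∀ᶠ p in l, (w p ^ 2 - c ^ 2) * μ * p.1 =
      -w p ^ 2 * (inner ℂ φ ((potL2 r D ((p.2 : ℂ) * w p) - potL2 r D 0) (f p)) +
        inner ℂ φ (potL2 r D ((p.2 : ℂ) * w p) (absSqMul D (v p) (f p)))) := by
  have hμc : (μ : ℂ) ≠ 0 := by exact_mod_cast hμ.ne'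
  have hKφ := (newtonianEigenEq_iff hDm hD μ φ).1 hφ.eigen_eq
  have hφφ : inner ℂ φ φ = (1 : ℂ) := by
    rw [inner_self_eq_norm_sq_to_K, hφ.norm_eq_one]; simp
  have hK : ∀ x, inner ℂ φ (potL2 r D 0 x) = μ * inner ℂ φ x := fun x => by
    rw [inner_potL2_zero hDm hD, hKφ, inner_smul_left, Complex.conj_ofReal]
  filter_upwards [H.sub_eq_residual, H.orthogonal] with p h1 h2
  have h3 : inner ℂ φ (f p) = (p.1 : ℂ) := by
    rw [inner_sub_right, inner_smul_right, hφφ, mul_one] at h2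
    exact sub_eq_zero.1 h2
  have h4 := congrArg (inner ℂ φ) h1
  rw [inner_sub_right, inner_smul_right, hK, h3, hc, inv_mul_cancel_left₀ hμc, sub_self, residual,
    inner_add_right, sub_apply, inner_sub_right] at h4
  have e1 : ∀ x, (w p ^ 2 • potL2 r D ((p.2 : ℂ) * w p)) x =
    w p ^ 2 • potL2 r D ((p.2 : ℂ) * w p) x := fun x => rfl
  have e2 : (c ^ 2 • potL2 r D 0) (f p) = c ^ 2 • potL2 r D 0 (f p) := rfl
  rw [e1, e1, e2, inner_smul_right, inner_smul_right, inner_smul_right, hK, h3] at h4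
  rw [sub_apply, inner_sub_right, hK, h3]
  linear_combination -h4

/-- Both terms on the right of `frequency_eq` are of this size because f = O(|a|), and (ω + c)μ
stays away from zero. The factor a is kept because it may vanish along `l`. -/
theorem isBigO_freq_mul (H : IsReducedBranch r D φ c l w f N v)
    (hDm : MeasurableSet D) (hD : D ⊆ Metric.ball 0 r) (hμ : 0 < μ)
    (hφ : IsSimpleEigenpair D μ φ) (hc : c ^ 2 = (μ : ℂ)⁻¹) :
    (fun p => (w p - c) * (p.1 : ℂ)) =O[l] fun p => (|p.2| + p.1 ^ 2) * |p.1| := by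
  have hμc : (μ : ℂ) ≠ 0 := by exact_mod_cast hμ.ne'
  have hc0 : c ≠ 0 := by
    rintro rfl
    exact inv_ne_zero hμc (by rw [← hc]; simp)
  have hf := H.isBigO_state hDm hD hμ hφ hc
  have h1 := isBigO_clm_apply (H.isBigO_comp_sub (contDiff_potL2 r D)) hf
  have h2 := ((innerSL ℂ φ).isBigO_comp _ l).trans h1
  have h3 := (H.isBigO_freq.pow 2).neg_left.mul
    ((h2.trans (isBigO_snd_mul_fst l)).add
      ((H.isBigO_pot_cubic hf).trans (isBigO_fst_cube l)))
  have hinv : Tendsto (fun p => ((w p + c) * μ)⁻¹) l (𝓝 (((c + c) * μ)⁻¹)) :=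
    ((H.tendsto_freq.add_const c).mul_const _).inv₀ (by
      rw [← two_mul]; simp [hc0, hμc])
  have hne : ∀ᶠ p in l, w p + c ≠ 0 :=
    (H.tendsto_freq.add_const c).eventually_ne (by rw [← two_mul]; simp [hc0])
  have h4 := (hinv.isBigO_one ℝ).mul h3
  refine h4.congr' ?_ (Eventually.of_forall fun p => by simp)
  filter_upwards [H.frequency_eq hDm hD hμ hφ hc, hne] with p h5 h6
  have h7 : ((w p + c) * μ)⁻¹ * ((w p ^ 2 - c ^ 2) * μ * p.1) = (w p - c) * p.1 := by
    field_simp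
    ring
  rw [← h7, h5]
  rfl

/-- In the residual bound |ω - c| is multiplied by ‖f‖ = O(|a|), so the estimate of (ω - c)a applies
without dividing by a. -/
theorem isBigO_corr (H : IsReducedBranch r D φ c l w f N v)
    (hDm : MeasurableSet D) (hD : D ⊆ Metric.ball 0 r) (hμ : 0 < μ)
    (hφ : IsSimpleEigenpair D μ φ) (hc : c ^ 2 = (μ : ℂ)⁻¹) :
    (fun p => f p - (p.1 : ℂ) • φ) =O[l] fun p => (|p.2| + p.1 ^ 2) * |p.1| := by
  have hf := H.isBigO_state hDm hD hμ hφ hc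
  refine ((H.isBigO_corr_residual hDm hD hμ hφ hc).trans H.isBigO_residual).trans ?_
  have h1 : (fun p => (‖w p - c‖ + |p.2| + ‖f p‖ ^ 2) * ‖f p‖) =O[l]
      fun p => (‖w p - c‖ + |p.2| + p.1 ^ 2) * |p.1| := by
    have e1 : (fun p => ‖w p - c‖ + |p.2|) =O[l] fun p => ‖w p - c‖ + |p.2| + p.1 ^ 2 :=
      isBigO_of_nonneg_le (fun p => by positivity) fun p => by linarith [sq_nonneg p.1]
    have e2 : (fun p => ‖f p‖ ^ 2) =O[l] fun p => ‖w p - c‖ + |p.2| + p.1 ^ 2 :=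
      (hf.norm_left.pow 2).trans (isBigO_of_nonneg_le (fun p => by positivity) fun p => by
        rw [sq_abs]
        linarith [norm_nonneg (w p - c), abs_nonneg p.2])
    exact (e1.add e2).mul hf.norm_left
  refine h1.trans ?_
  have h2 := (H.isBigO_freq_mul hDm hD hμ hφ hc).norm_left
  refine (h2.add (isBigO_refl (fun p => (|p.2| + p.1 ^ 2) * |p.1|) l)).congr_left fun p => ?_
  rw [norm_mul, Complex.norm_real, Real.norm_eq_abs]
  ring

theorem isBigO_kerr_sub (H : IsReducedBranch r D φ c l w f N v)
    (hDm : MeasurableSet D) (hD : D ⊆ Metric.ball 0 r) (hμ : 0 < μ)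
    (hφ : IsSimpleEigenpair D μ φ) (hc : c ^ 2 = (μ : ℂ)⁻¹) :
    (fun p => N p - (p.1 : ℂ) • φ) =O[l] fun p => (|p.2| + p.1 ^ 2) * |p.1| := by
  have hf := H.isBigO_state hDm hD hμ hφ hc
  have h1 := H.isBigO_cubic.trans (hf.norm_left.pow 3)
  refine ((H.isBigO_corr hDm hD hμ hφ hc).add (h1.trans (isBigO_fst_cube l))).congr'
    (H.kerr_eq.mono fun p hp => ?_) EventuallyEq.rfl
  simp only
  rw [hp]
  abel

/-- Second order expansion in any space `F` carrying a smooth family of potentials. -/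
theorem isBigO_potential_sub {F : Type*} [NormedAddCommGroup F] [NormedSpace ℂ F]
    (H : IsReducedBranch r D φ c l w f N v)
    (hDm : MeasurableSet D) (hD : D ⊆ Metric.ball 0 r) (hμ : 0 < μ)
    (hφ : IsSimpleEigenpair D μ φ) (hc : c ^ 2 = (μ : ℂ)⁻¹) {E : ℂ → L2 D →L[ℂ] F}
    (hE : ContDiff ℂ ∞ E) :
    (fun p => w p ^ 2 • E ((p.2 : ℂ) * w p) (N p) - (p.1 : ℂ) • c ^ 2 • E 0 φ)
      =O[l] fun p => p.1 ^ 2 + p.2 ^ 2 := by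
  have hf := H.isBigO_state hDm hD hμ hφ hc
  have hN : N =O[l] fun p => |p.1| := H.isBigO_kerr.trans hf.norm_left
  have h1 := isBigO_clm_apply (H.isBigO_freq_sq_smul_sub hE) hN
  -- The frequency error occurs only with a factor |a|, so the state expansion needs no separate
  -- treatment of a = 0.
  have h2 : (fun p => (‖w p - c‖ + |p.2|) * |p.1|) =O[l]
      fun p => (|p.2| + p.1 ^ 2) * |p.1| := by
    refine ((H.isBigO_freq_mul hDm hD hμ hφ hc).norm_left.add
      (isBigO_snd_mul_fst l)).congr_left fun p => ?_
    rw [norm_mul, Complex.norm_real, Real.norm_eq_abs]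
    ring
  have h3 := ((c ^ 2 • E 0).isBigO_comp _ l).trans (H.isBigO_kerr_sub hDm hD hμ hφ hc)
  have h4 : (fun p : ℝ × ℝ => (|p.2| + p.1 ^ 2) * |p.1|) =O[l] fun p => p.1 ^ 2 + p.2 ^ 2 := by
    refine IsBigO.of_bound 2 ?_
    have ha : ∀ᶠ p in l, |p.1| < 1 :=
      H.tendsto_fst.abs.eventually_lt_const (by simp)
    filter_upwards [ha] with p hp
    rw [Real.norm_of_nonneg (by positivity), Real.norm_of_nonneg (by positivity)]
    have h5 : p.1 ^ 2 * |p.1| ≤ p.1 ^ 2 * 1 := by gcongr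
    nlinarith [sq_nonneg (|p.2| - |p.1|), sq_abs p.1, sq_abs p.2, sq_nonneg p.1, sq_nonneg p.2]
  refine (((h1.trans h2).add h3).trans h4).congr_left fun p => ?_
  have e1 : (w p ^ 2 • E ((p.2 : ℂ) * w p) - c ^ 2 • E 0) (N p) =
    w p ^ 2 • E ((p.2 : ℂ) * w p) (N p) - c ^ 2 • E 0 (N p) := rfl
  have e2 : (c ^ 2 • E 0) (N p - (p.1 : ℂ) • φ) = c ^ 2 • E 0 (N p - (p.1 : ℂ) • φ) := rfl
  rw [e1, e2, map_sub, map_smul, smul_sub, smul_comm (c ^ 2) (p.1 : ℂ)]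
  abel

end IsReducedBranch

/-! ### Expansion of the frequency at nonzero amplitude -/

theorem isBigO_of_mul_fst {l : Filter (ℝ × ℝ)} (hl : ∀ᶠ p in l, p.1 ≠ 0) {X : ℝ × ℝ → ℂ}
    {g : ℝ × ℝ → ℝ} (h : (fun p => X p * (p.1 : ℂ)) =O[l] fun p => g p * |p.1|) : X =O[l] g := by
  obtain ⟨C, hC⟩ := h.bound
  refine IsBigO.of_bound C ?_
  filter_upwards [hC, hl] with p h1 h2
  rw [norm_mul, norm_mul, Complex.norm_real, Real.norm_eq_abs p.1, Real.norm_eq_abs |p.1|, abs_abs,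
    ← mul_assoc] at h1
  exact le_of_mul_le_mul_right h1 (abs_pos.2 h2)

namespace IsReducedBranch

variable {r : ℝ} {D : Set E3} [IsFiniteMeasure ((volume : Measure E3).restrict D)] {φ : L2 D}
  {c : ℂ} {l : Filter (ℝ × ℝ)} {w : ℝ × ℝ → ℂ} {f N : ℝ × ℝ → L2 D} {v : ℝ × ℝ → LInf D} {μ : ℝ}

theorem isBigO_theta_sq (H : IsReducedBranch r D φ c l w f N v) :
    (fun p : ℝ × ℝ => (|p.2| + p.1 ^ 2) ^ 2) =O[l] fun p => p.1 ^ 2 + p.2 ^ 2 := by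
  refine IsBigO.of_bound 2 ?_
  have ha : ∀ᶠ p in l, |p.1| < 1 := H.tendsto_fst.abs.eventually_lt_const (by simp)
  filter_upwards [ha] with p hp
  rw [Real.norm_of_nonneg (by positivity), Real.norm_of_nonneg (by positivity)]
  have h1 : p.1 ^ 2 ≤ 1 := by rw [← sq_abs]; exact pow_le_one₀ (abs_nonneg _) hp.le
  have h2 : (p.1 ^ 2) ^ 2 ≤ p.1 ^ 2 := by nlinarith [sq_nonneg p.1]
  nlinarith [sq_nonneg (|p.2| - p.1 ^ 2), sq_abs p.2]

/-- The part of the frequency equation left after extracting the first order radiation term. -/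
theorem isBigO_frequency_remainder (H : IsReducedBranch r D φ c l w f N v)
    (hDm : MeasurableSet D) (hD : D ⊆ Metric.ball 0 r) (hμ : 0 < μ)
    (hφ : IsSimpleEigenpair D μ φ) (hc : c ^ 2 = (μ : ℂ)⁻¹) :
    (fun p => ((w p ^ 2 - c ^ 2) * μ + w p ^ 2 * ((p.2 : ℂ) * w p) *
        inner ℂ φ (potL2Deriv r D φ)) * (p.1 : ℂ))
      =O[l] fun p => (p.1 ^ 2 + p.2 ^ 2) * |p.1| := by
  have hf := H.isBigO_state hDm hD hμ hφ hc
  have e0 : (fun p : ℝ × ℝ => |p.2|) =O[l] fun p => |p.2| + p.1 ^ 2 :=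
    isBigO_of_nonneg_le (fun p => by positivity) fun p => by linarith [sq_nonneg p.1]
  -- There are three errors: the second-order Taylor remainder of K^κ on f (`h1`), the derivative
  -- applied to f - aφ instead of aφ (`h3`), and the cubic term (`h5`).
  have h1 : (fun p => inner ℂ φ ((potL2 r D ((p.2 : ℂ) * w p) - potL2 r D 0 -
      ((p.2 : ℂ) * w p) • potL2Deriv r D) (f p))) =O[l]
      fun p => (p.1 ^ 2 + p.2 ^ 2) * |p.1| := by
    have h2 := ((isBigO_potL2 r D).comp_tendsto H.tendsto_wavenumber).trans
      (((H.isBigO_wavenumber.trans e0).pow 2).trans H.isBigO_theta_sq)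
    exact ((innerSL ℂ φ).isBigO_comp _ l).trans (isBigO_clm_apply h2 hf)
  have h3 : (fun p => ((p.2 : ℂ) * w p) *
      inner ℂ φ (potL2Deriv r D (f p - (p.1 : ℂ) • φ))) =O[l]
      fun p => (p.1 ^ 2 + p.2 ^ 2) * |p.1| := by
    have h4 : (fun p => inner ℂ φ (potL2Deriv r D (f p - (p.1 : ℂ) • φ))) =O[l]
        fun p => (|p.2| + p.1 ^ 2) * |p.1| :=
      (((innerSL ℂ φ).comp (potL2Deriv r D)).isBigO_comp _ l).trans
        (H.isBigO_corr hDm hD hμ hφ hc)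
    refine ((H.isBigO_wavenumber.trans e0).mul h4).trans ?_
    refine (H.isBigO_theta_sq.mul (isBigO_refl (fun p : ℝ × ℝ => |p.1|) l)).congr_left fun p => ?_
    ring
  have h5 : (fun p : ℝ × ℝ => |p.1| ^ 3) =O[l] fun p => (p.1 ^ 2 + p.2 ^ 2) * |p.1| :=
    isBigO_of_nonneg_le (fun p => by positivity) fun p => by
      rw [pow_succ, sq_abs]
      exact mul_le_mul_of_nonneg_right (by linarith [sq_nonneg p.2]) (abs_nonneg _)
  have h6 := (H.isBigO_freq.pow 2).neg_left.mul
    ((h1.add h3).add ((H.isBigO_pot_cubic hf).trans h5))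
  refine h6.congr' ?_ (Eventually.of_forall fun p => by simp)
  filter_upwards [H.frequency_eq hDm hD hμ hφ hc] with p h7
  have e1 : ((((p.2 : ℂ) * w p) • potL2Deriv r D) (f p)) =
    ((p.2 : ℂ) * w p) • potL2Deriv r D (f p) := rfl
  rw [sub_apply _ (((p.2 : ℂ) * w p) • potL2Deriv r D), inner_sub_right, e1, inner_smul_right,
    map_sub, map_smul, inner_sub_right, inner_smul_right]
  linear_combination -h7

/-- First order expansion of the frequency where the amplitude does not vanish. -/
theorem isBigO_frequency (H : IsReducedBranch r D φ c l w f N v)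
    (hDm : MeasurableSet D) (hD : D ⊆ Metric.ball 0 r) (hμ : 0 < μ)
    (hφ : IsSimpleEigenpair D μ φ) (hc : c ^ 2 = (μ : ℂ)⁻¹) (hl : ∀ᶠ p in l, p.1 ≠ 0)
    (hφ_real : ∀ᵐ x ∂(volume.restrict D), (φ x).im = 0) :
    (fun p => w p - (c - Complex.I * c ^ 4 / (8 * (Real.pi : ℂ)) * (∫ x in D, φ x) ^ 2 *
      (p.2 : ℂ))) =O[l] fun p => p.1 ^ 2 + p.2 ^ 2 := by
  have hμc : (μ : ℂ) ≠ 0 := by exact_mod_cast hμ.ne'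
  have hπ : (Real.pi : ℂ) ≠ 0 := by exact_mod_cast Real.pi_ne_zero
  have hc0 : c ≠ 0 := by
    rintro rfl
    exact inv_ne_zero hμc (by rw [← hc]; simp)
  set m : ℂ := inner ℂ φ (potL2Deriv r D φ) with hm
  have hw : (fun p => w p - c) =O[l] fun p => |p.2| + p.1 ^ 2 :=
    isBigO_of_mul_fst hl (H.isBigO_freq_mul hDm hD hμ hφ hc)
  have h1 := isBigO_of_mul_fst hl (H.isBigO_frequency_remainder hDm hD hμ hφ hc)
  rw [← hm] at h1
  -- Linearisation around c: `h2` is the error of replacing ω² - c² by 2c(ω - c), and `h3` that of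
  -- replacing ω³ε by c³ε.
  have h2 : (fun p => (μ : ℂ) * (w p - c) ^ 2) =O[l] fun p => p.1 ^ 2 + p.2 ^ 2 :=
    ((hw.pow 2).trans H.isBigO_theta_sq).const_mul_left _
  have h3 : (fun p => (w p - c) * (p.2 : ℂ) * ((w p ^ 2 + w p * c + c ^ 2) * m)) =O[l]
      fun p => p.1 ^ 2 + p.2 ^ 2 := by
    have h4 : (fun p : ℝ × ℝ => (p.2 : ℂ)) =O[l] fun p => |p.2| + p.1 ^ 2 :=
      IsBigO.of_bound 1 (Eventually.of_forall fun p => by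
        rw [one_mul, Complex.norm_real, Real.norm_eq_abs, Real.norm_of_nonneg (by positivity)]
        linarith [sq_nonneg p.1])
    have h5 : Tendsto (fun p => (w p ^ 2 + w p * c + c ^ 2) * m) l
        (𝓝 ((c ^ 2 + c * c + c ^ 2) * m)) :=
      (((H.tendsto_freq.pow 2).add (H.tendsto_freq.mul_const c)).add_const _).mul_const m
    have h6 := (hw.mul h4).mul (h5.isBigO_one ℝ)
    refine IsBigO.trans (h6.congr_right fun p => ?_) H.isBigO_theta_sq
    ring
  -- What is left is 2cμ(ω - c) + c³εm. With μ = c⁻² this yields ω - c ≈ -c⁴εm/2, and m =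
  -- (i/4π)(∫φ)² accounts for the 8π.
  refine (((h1.sub h2).sub h3).const_mul_left ((2 * c * μ)⁻¹)).congr_left fun p => ?_
  have hm' : m = Complex.I / (4 * (Real.pi : ℂ)) * (∫ x in D, φ x) ^ 2 :=
    inner_potL2Deriv hDm hD hφ_real
  rw [hm']
  have hμ' : (μ : ℂ) = (c ^ 2)⁻¹ := by rw [hc, inv_inv]
  rw [hμ']
  field_simp
  ring

end IsReducedBranch

/-! ### Zero amplitude, and the reduction of a resonance branch -/

theorem isOpen_paramSet (δ : ℝ) : IsOpen (paramSet δ) :=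
  (isOpen_lt continuous_const continuous_snd).inter
    (isOpen_lt ((continuous_abs.comp continuous_fst).add continuous_snd) continuous_const)

/-- An estimate for nonzero amplitudes extends to all amplitudes by continuity. -/
theorem isBigO_paramSet_of_ne {δ : ℝ} {X : ℝ × ℝ → ℂ} (hX : ContinuousOn X (paramSet δ))
    {g : ℝ × ℝ → ℝ} (hg : Continuous g)
    (h : X =O[𝓝[paramSet δ] 0 ⊓ 𝓟 {p | p.1 ≠ 0}] g) : X =O[𝓝[paramSet δ] 0] g := by
  obtain ⟨C, hC⟩ := h.bound
  refine IsBigO.of_bound C ?_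
  rw [eventually_inf_principal, eventually_nhdsWithin_iff, eventually_nhds_iff] at hC
  obtain ⟨V, hV, hVo, h0⟩ := hC
  filter_upwards [mem_nhdsWithin_of_mem_nhds (hVo.mem_nhds h0), self_mem_nhdsWithin] with p hpV hp
  by_cases hp1 : p.1 ≠ 0
  · exact hV p hpV hp hp1
  push Not at hp1
  -- A point (0, ε) is approached by (t, ε) with t ≠ 0, where the bound holds with the same
  -- constant.
  have hline : Tendsto (fun t : ℝ => ((t, p.2) : ℝ × ℝ)) (𝓝[≠] 0) (𝓝 p) := by
    have h1 : Tendsto (fun t : ℝ => ((t, p.2) : ℝ × ℝ)) (𝓝 0) (𝓝 (0, p.2)) :=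
      (Continuous.prodMk continuous_id continuous_const).tendsto 0
    have h2 : ((0 : ℝ), p.2) = p := Prod.ext hp1.symm rfl
    rw [h2] at h1
    exact h1.mono_left nhdsWithin_le_nhds
  have hXp : Tendsto (fun t : ℝ => ‖X (t, p.2)‖) (𝓝[≠] 0) (𝓝 ‖X p‖) :=
    ((hX.continuousAt ((isOpen_paramSet δ).mem_nhds hp)).tendsto.comp hline).norm
  have hgp : Tendsto (fun t : ℝ => C * ‖g (t, p.2)‖) (𝓝[≠] 0) (𝓝 (C * ‖g p‖)) :=
    ((hg.tendsto p).comp hline).norm.const_mul C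
  refine le_of_tendsto_of_tendsto hXp hgp ?_
  filter_upwards [self_mem_nhdsWithin, hline.eventually (hVo.mem_nhds hpV),
    hline.eventually ((isOpen_paramSet δ).mem_nhds hp)] with t h1 h2 h3
  exact hV _ h2 h3 h1

/-- The reduced form of a resonance branch. -/
theorem IsResonanceBranch.isReducedBranch {r : ℝ} {D : Set E3}
    [IsFiniteMeasure ((volume : Measure E3).restrict D)] (hDo : IsOpen D)
    (hD : D ⊆ Metric.ball 0 r) {μ : ℝ} (hμ : 0 < μ) {φ : L2 D} {Φ : H2 D} (hΦ : toL2 Φ = φ)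
    {δ : ℝ} {w : ℝ × ℝ → ℂ} {u h : ℝ × ℝ → H2 D} (H : IsResonanceBranch D μ φ δ w u h) :
    IsReducedBranch r D φ (((√μ)⁻¹ : ℝ) : ℂ) (𝓝[paramSet δ] 0) w (fun p => toL2 (u p))
      (fun p => kerrL2 p.2 (w p) (u p)) (fun p => stateInf r p.2 (w p) (u p)) := by
  set l := 𝓝[paramSet δ] (0 : ℝ × ℝ) with hl
  have hmem : ∀ᶠ p in l, p ∈ paramSet δ := self_mem_nhdsWithin
  have hc0 : (((√μ)⁻¹ : ℝ) : ℂ) ≠ 0 := by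
    exact_mod_cast (inv_pos.2 (Real.sqrt_pos.2 hμ)).ne'
  have hw : ∀ᶠ p in l, w p ≠ 0 := H.tendsto_freq.eventually_ne hc0
  have hfst : Tendsto (fun p : ℝ × ℝ => (p.1 : ℂ)) l (𝓝 0) := by
    have : Continuous fun p : ℝ × ℝ => (p.1 : ℂ) := Complex.continuous_ofReal.comp continuous_fst
    have h0 := this.tendsto 0
    simp only [Prod.fst_zero, Complex.ofReal_zero] at h0
    exact h0.mono_left nhdsWithin_le_nhds
  have hκ : Tendsto (fun p : ℝ × ℝ => (p.2 : ℂ) * w p) l (𝓝 0) := by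
    have : Continuous fun p : ℝ × ℝ => (p.2 : ℂ) := Complex.continuous_ofReal.comp continuous_snd
    have h0 := this.tendsto 0
    simp only [Prod.snd_zero, Complex.ofReal_zero] at h0
    simpa using (h0.mono_left nhdsWithin_le_nhds).mul H.tendsto_freq
  have hu : Tendsto u l (𝓝 0) := by
    have h1 : Tendsto (fun p : ℝ × ℝ => (p.1 : ℂ) • Φ + h p) l (𝓝 ((0 : ℂ) • Φ + 0)) :=
      (hfst.smul_const Φ).add H.tendsto_corr
    rw [zero_smul, zero_add] at h1
    refine h1.congr' (hmem.mono fun p hp => toL2_injective hDo ?_)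
    rw [H.decomp p hp, ← hΦ]
    rfl
  have hL : Tendsto (fun p => toL2 (u p)) l (𝓝 0) := by
    have := ((toL2L D).continuous.tendsto 0).comp hu
    rwa [map_zero] at this
  -- Through the Laplacian, N(u) depends continuously on u ∈ H²(D), so convergence in H² alone gives
  -- N(u) → 0 in L².
  have hN : Tendsto (fun p => kerrL2 p.2 (w p) (u p)) l (𝓝 0) := by
    have h1 := (((lapL2 D).continuous.tendsto 0).comp hu).add ((hκ.pow 2).smul hL)
    have h2 := ((H.tendsto_freq.pow 2).inv₀ (pow_ne_zero 2 hc0)).neg.smul h1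
    rw [map_zero, smul_zero, add_zero, smul_zero] at h2
    exact h2
  constructor
  · exact nhdsWithin_le_nhds
  · exact H.tendsto_freq
  · exact hL
  -- The L^∞ bound on the state comes from the smoothing of the potential applied to the bounded
  -- N(u).
  · have h1 := isBigO_clm_apply
      ((((contDiff_potInf r D).continuous.tendsto 0).comp hκ).isBigO_one ℝ) (hN.isBigO_one ℝ)
    exact (((H.tendsto_freq.pow 2).isBigO_one ℝ).smul h1).congr (fun p => rfl) (fun p => by simp)
  · filter_upwards [hmem, hw] with p hp hw using infToL2_stateInf hDo hD hw (H.solves p hp)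
  · exact Eventually.of_forall fun p => rfl
  · filter_upwards [hmem, hw] with p hp hw using kerrL2_eq hDo hD hw (H.solves p hp)
  · filter_upwards [hmem] with p hp
    rw [H.decomp p hp, add_sub_cancel_left, H.orthogonal p hp]

end DielectricResonance

end

/-! ### The main theorem -/

theorem mainTheorem10 (D : Set DielectricResonance.E3) (hD_open : IsOpen D)
    (hD_conn : IsConnected D) (hD_bdd : Bornology.IsBounded D)
    (hD_bdry : DielectricResonance.HasBoundaryOfClass 1 D)
    (μ : ℝ) (hμ : 0 < μ) (φ : DielectricResonance.L2 D)
    (hφ : DielectricResonance.IsSimpleEigenpair D μ φ)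
    (hφ_real : ∀ᵐ x ∂(volume.restrict D), (φ x).im = 0) :
    (∃ δ : ℝ, 0 < δ ∧ ∃ (ω : ℝ × ℝ → ℂ) (u h : ℝ × ℝ → DielectricResonance.H2 D),
      DielectricResonance.IsResonanceBranch D μ φ δ ω u h) ∧
    ∃ Φ : DielectricResonance.H2 D, DielectricResonance.toL2 Φ = φ ∧
      ∀ (δ : ℝ) (ω : ℝ × ℝ → ℂ) (u h : ℝ × ℝ → DielectricResonance.H2 D), 0 < δ →
        DielectricResonance.IsResonanceBranch D μ φ δ ω u h →
        ((fun p : ℝ × ℝ => ω p - ((((√μ)⁻¹ : ℝ) : ℂ)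
            - Complex.I * (((√μ)⁻¹ : ℝ) : ℂ) ^ 4 / (8 * (Real.pi : ℂ))
              * (∫ x in D, φ x) ^ 2 * (p.2 : ℂ)))
          =O[𝓝[DielectricResonance.paramSet δ] 0] fun p : ℝ × ℝ => p.1 ^ 2 + p.2 ^ 2) ∧
        ((fun p : ℝ × ℝ => u p - (p.1 : ℂ) • Φ)
          =O[𝓝[DielectricResonance.paramSet δ] 0] fun p : ℝ × ℝ => p.1 ^ 2 + p.2 ^ 2) := by
  refine ⟨DielectricResonance.exists_isResonanceBranch hD_open hD_bdd hμ hφ, ?_⟩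
  obtain ⟨r, hD⟩ := hD_bdd.subset_ball (0 : DielectricResonance.E3)
  have hDm := hD_open.measurableSet
  have := DielectricResonance.isFiniteMeasure_restrict_of_subset_ball hD
  have hμc : (μ : ℂ) ≠ 0 := by exact_mod_cast hμ.ne'
  have hc : (((√μ)⁻¹ : ℝ) : ℂ) ^ 2 = (μ : ℂ)⁻¹ := by
    rw [← Complex.ofReal_pow, inv_pow, Real.sq_sqrt hμ.le, Complex.ofReal_inv]
  have hKφ := (DielectricResonance.newtonianEigenEq_iff hDm hD μ φ).1 hφ.eigen_eq
  obtain ⟨E, hE, hEK⟩ := DielectricResonance.exists_potential_H2 hD_open hD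
  set c : ℂ := (((√μ)⁻¹ : ℝ) : ℂ) with hcdef
  -- The H² lift of φ is chosen as c² K φ, which is precisely the leading term produced by
  -- `isBigO_potential_sub`.
  have hΦ : DielectricResonance.toL2 (c ^ 2 • E 0 φ) = φ := by
    have h1 : DielectricResonance.toL2 (c ^ 2 • E 0 φ) =
      c ^ 2 • DielectricResonance.toL2 (E 0 φ) := rfl
    rw [h1, hEK, hKφ, hc, inv_smul_smul₀ hμc]
  refine ⟨c ^ 2 • E 0 φ, hΦ, fun δ ω u h _ H => ?_⟩
  have hR := H.isReducedBranch hD_open hD hμ hΦ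
  constructor
  -- The frequency estimate is proved along the trace of the filter on a ≠ 0 and then extended by
  -- continuity of ω.
  · refine DielectricResonance.isBigO_paramSet_of_ne ?_ (by fun_prop)
      ((hR.mono inf_le_left).isBigO_frequency hDm hD hμ hφ hc ?_ hφ_real)
    · refine H.contDiffOn_freq.continuousOn.sub (Continuous.continuousOn ?_)
      exact continuous_const.sub (continuous_const.mul
        (Complex.continuous_ofReal.comp continuous_snd))
    · exact eventually_inf_principal.2 (Eventually.of_forall fun p hp => hp)
  · refine (hR.isBigO_potential_sub hDm hD hμ hφ hc hE).congr' ?_ EventuallyEq.rfl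
    have hw : ∀ᶠ p in 𝓝[DielectricResonance.paramSet δ] (0 : ℝ × ℝ), ω p ≠ 0 :=
      H.tendsto_freq.eventually_ne (by
        exact_mod_cast (inv_pos.2 (Real.sqrt_pos.2 hμ)).ne')
    filter_upwards [hw, self_mem_nhdsWithin] with p hp hpδ
    rw [← DielectricResonance.eq_potential_H2 hD_open hD hp (H.solves p hpδ) hEK]
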